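/- **Model.** There are $N$ agents, a standard Borel state space $\mathbb X$, standard Borel measurement spaces $\mathbb Y^i$ and finite non-empty action spaces $\mathbb U^i$; $\mathbf y=(y^1,\dots,y^N)$, $\mathbf u=(u^1,\dots,u^N)$. The system is $$x_{t+1}=\Phi(x_t,\mathbf u_t,v_t),\qquad y^i_t=\varphi^i(x_t,w^i_t),$$ with $\Phi,\varphi^i$ measurable, and with $x_0$, all $v_t$ and all $w^i_t$ independent, $(v_t)_t$ and each $(w^i_t)_t$ identically distributed. $\mathcal T(\cdot\mid x,\mathbf u)$ and $Q^i(\cdot\mid x)$ denote the induced transition kernel and channels, and $Q^i(dy\mid x)=h^i(x,y)\,\psi^i(dy)$ with probability measures $\psi^i$ and measurable $h^i\ge 0$. The stage cost $c:\mathbb X\times\prod_i\mathbb U^i\to\mathbb R$ is measurable and bounded, $0<\beta<1$, and $K,M\ge1$. **Information and actions.** Period $q$ consists of the times $qK,\dots,qK+K-1$. Under $K$-step periodic sharing, agent $i$ at time $qK+r$ ($0\le r<K$) applies a measurable function $\gamma^i_{q,r}$ of the common information $I^C_q=(\mathbf y_{[0,qK-1]},\mathbf u_{[0,qK-1]})$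 and of its private information $(y^i_{[qK,qK+r]},u^i_{[qK,qK+r-1]})$. The map-valued action $a_q\in\mathbb A$ is the family of maps $f^i_{qK+r}=\gamma^i_{q,r}(I^C_q,\cdot)$, $i\le N$, $r<K$, from private information to actions. $\mathbb A$ is the set of all families of measurable such maps, with the product of the Borel $\sigma$-algebras of the Young topologies: $f_n\to f$ iff, for all fixed past own actions, $\psi^i(dy_0)\cdots\psi^i(dy_r)\,\delta_{f_n(y,u)}$ converges weakly to $\psi^i(dy_0)\cdots\psi^i(dy_r)\,\delta_{f(y,u)}$. $\mathcal P(\mathbb X)$ carries its Borel $\sigma$-algebra for the weak topology. Elements of $\mathbb A$ are evaluated through a fixed jointly measurable version $\mathrm{ev}$ of $(f,p)\mapsto f(p)$ (for each $f$ and each past own actions, $\mathrm{ev}(f,\cdot)=f$ for almost every measurement sequence under the product of the $\psi^i$). **Centralized reduction.** Let $\pi_q=P(x_{qK}\in\cdot\mid I^C_q)$. Let $$F(Z,\mathbf u,\mathbf y)(\cdot)=\frac{\int \mathcal T(\cdot\mid x,\mathbf u)\prod_i h^i(x,y^i)\,Z(dx)}{\int\prod_i h^i(x,y^i)\,Z(dx)}$$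 (and $F(Z,\mathbf u,\mathbf y)=Z$ where the denominator is $0$ or $\infty$), and let $G(\pi,\mathbf u,\mathbf y)$ be the result of $K$ successive updates $F$ along the actions and measurements of one period. For $\pi\in\mathcal P(\mathbb X)$ and $a\in\mathbb A$ let $P_{\pi,a}$ be the law of one period started from $x\sim\pi$ under the maps $a$; let $\theta(\cdot\mid\pi,a)$ be the law of $G(\pi,\mathbf u,\mathbf y)$ under $P_{\pi,a}$ and $\tilde c(\pi,a)=E_{\pi,a}\big[\sum_{r<K}\beta^r c(x_r,\mathbf u_r)\big]$. The $K$-periodic belief-sharing reduction is the Markov decision process (MDP) with state $\pi_q$, action $a_q$, kernel $\theta$, period cost $\tilde c$ and discount factor $\beta^K$. **Window process.** For $q\ge M$ let $\hat Z_q=(\pi_{q-M},I^M_q)$ with $I^M_q=(\mathbf y_{[(q-M)K,qK-1]},a_{[q-M,q-1]})$. For $z=(\pi,\mathbf y\text{-blocks},a\text{-blocks})$ let $\phi(z)$ be obtained from $\pi$ by applying $G$ successively along the $M$ blocks, the actions $\mathbf u$ being generated from the measurements and the maps by $\mathrm{ev}$. Let $\tilde\theta(\cdot\mid z,a)$ be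 the law of the next window state: $\pi$ is updated by $G$ with the oldest block, that block is dropped, and $(\mathbf y,a)$ is appended, where $\mathbf y$ are the measurements of a period with law $P_{\phi(z),a}$. Let $r(z,a)=\tilde c(\phi(z),a)$. **Theorem.** A version $\mathrm{ev}$ as above exists; $\theta$ and $\tilde\theta$ are Markov kernels, $\phi$, $\tilde c$ and $r$ are measurable, $\tilde c$ (hence $r$) is bounded, and $(\hat Z_q,a_q)_{q\ge M}$ is a controlled Markov decision process equivalent to the $K$-periodic belief-sharing reduction, in the following sense. 1. For all $z,a$: $\phi_*\tilde\theta(\cdot\mid z,a)=\theta(\cdot\mid\phi(z),a)$. 2. Under every admissible team policy $\gamma$ and for all $q\ge M$, almost surely: $\phi(\hat Z_q)=\pi_q$; $P(\hat Z_{q+1}\in B\mid \hat Z_s,a_s,\,M\le s\le q)=\tilde\theta(B\mid\hat Z_q,a_q)$ and $P(\pi_{q+1}\in B\mid \pi_s,a_s,\,M\le s\le q)=\theta(B\mid\pi_q,a_q)$ for all measurable $B$; and $E\big[\sum_{r<K}\beta^{r}c(x_{qK+r},\mathbf u_{qK+r})\mid\hat Z_s,a_s,\,M\le s\le q\big]=r(\hat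 Z_q,a_q)$. Moreover $$J_M(\gamma):=\sum_{t\ge MK}\beta^tE^\gamma[c(x_t,\mathbf u_t)]=\sum_{q\ge M}\beta^{Kq}E^\gamma[r(\hat Z_q,a_q)]=\sum_{q\ge M}\beta^{Kq}E^\gamma[\tilde c(\pi_q,a_q)].$$ 3. For every admissible team policy $\gamma^0$ and every measurable deterministic history-dependent policy $g$ of the MDP $(\tilde\theta,r,\beta^K)$, there is an admissible team policy $\gamma$ that agrees with $\gamma^0$ in the periods $q<M$ and under which, for all $q\ge M$, almost surely $a_q=g_q(\hat Z_M,\dots,\hat Z_q)$ (as elements of $\mathbb A$, up to the identification of maps with the same Young measures); the law of $(\hat Z_M,\dots,\hat Z_q)$ is that of the MDP with kernel $\tilde\theta$ under $g$ with initial law the law of $\hat Z_M$ under $\gamma^0$, and $J_M(\gamma)$ is $\beta^{KM}$ times the cost of $g$ in that MDP. 4. For every measurable deterministic Markov policy $g$ of the MDP $(\theta,\tilde c,\beta^K)$ and every initial law $\nu$ of a window state, the policy $g\circ\phi$ has the same cost in the MDP $(\tilde\theta,r,\beta^K)$ started from $\nu$ as $g$ has in the MDP $(\theta,\tilde c,\beta^K)$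 started from $\phi_*\nu$. 5. For every admissible team policy $\gamma^0$, the infimum of $J_M(\gamma)$ over the admissible team policies $\gamma$ that agree with $\gamma^0$ in the periods $q<M$ equals $\beta^{KM}$ times each of the following: the optimal costs of the MDP $(\tilde\theta,r,\beta^K)$ over history-dependent and over Markov policies, started from the law of $\hat Z_M$ under $\gamma^0$; and the optimal cost of the MDP $(\theta,\tilde c,\beta^K)$ over Markov policies, started from the law of $\pi_M$ under $\gamma^0$. -/

import Mathlib

open MeasureTheory ProbabilityTheory
open scoped NNReal ENNReal

noncomputable section

namespace PeriodicSharing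

/-! ## Private information, local maps and their measurable structure -/

/-- The private information of agent `i` at stage `r` of a period: its own measurements at the
stages `0, …, r` and its own actions at the stages `0, …, r - 1` of that period. -/
abbrev PrivInfo {N : ℕ} (Y U : Fin N → Type*) (i : Fin N) (r : ℕ) : Type _ :=
  (Fin (r + 1) → Y i) × (Fin r → U i)

/-- A local map of agent `i` at stage `r`: a measurable function from private information to
actions.  The type carries the reference measures `ψ`, because its measurable structure is defined
through them. -/
structure LocalMap {N : ℕ} {Y : Fin N → Type*} [∀ i, MeasurableSpace (Y i)] (U : Fin N → Type*)
    [∀ i, MeasurableSpace (U i)] (ψ : ∀ i, ProbabilityMeasure (Y i)) (i : Fin N) (r : ℕ) where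
  toFun : PrivInfo Y U i r → U i
  measurable_toFun : Measurable toFun

section LocalMaps

variable {N : ℕ} {Y U : Fin N → Type*} [∀ i, MeasurableSpace (Y i)] [∀ i, MeasurableSpace (U i)]
  {ψ : ∀ i, ProbabilityMeasure (Y i)} {i : Fin N} {r : ℕ}

/-- For given past own actions `up`, the measure `ψ(dy_0) ⋯ ψ(dy_r) f(du | y_0, …, y_r, up)` on
`Y^{r+1} × U`, where `f(du | ·)` is the Dirac measure at the value of the local map `f`. -/
def LocalMap.youngLaw (f : LocalMap U ψ i r) (up : Fin r → U i) :
    Measure ((Fin (r + 1) → Y i) × U i) :=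
  (Measure.pi fun _ : Fin (r + 1) => (ψ i : Measure (Y i))).map fun y => (y, f.toFun (y, up))

/-- The Borel σ-algebra of the Young topology on local maps.  In that topology `f_n → f` iff, for
all past actions `up`, the measures `f_n.youngLaw up` converge weakly to `f.youngLaw up`; on
probability measures over a standard Borel space the Borel σ-algebra of the weak topology is the
one generated by the evaluations `μ ↦ μ B`, which is the σ-algebra Mathlib puts on measures. -/
instance LocalMap.instMeasurableSpace : MeasurableSpace (LocalMap U ψ i r) :=
  MeasurableSpace.comap LocalMap.youngLaw inferInstance

instance LocalMap.isProbabilityMeasure_youngLaw (f : LocalMap U ψ i r) (up : Fin r → U i) :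
    IsProbabilityMeasure (f.youngLaw up) := by
  unfold LocalMap.youngLaw
  refine Measure.isProbabilityMeasure_map (Measurable.aemeasurable ?_)
  exact measurable_id.prodMk (f.measurable_toFun.comp measurable_prodMk_right)

variable [∀ i, Finite (U i)] [∀ i, MeasurableSingletonClass (U i)]

variable (U ψ i r) in
/-- `LocalMap.youngLaw` as a kernel. -/
def youngKernel : Kernel (LocalMap U ψ i r × (Fin r → U i)) ((Fin (r + 1) → Y i) × U i) where
  toFun p := p.1.youngLaw p.2
  measurable' := by
    have h : Measurable (LocalMap.youngLaw : LocalMap U ψ i r → _) := comap_measurable _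
    exact measurable_from_prod_countable_left fun up => (measurable_pi_apply up).comp h

instance : IsMarkovKernel (youngKernel U ψ i r) :=
  ⟨fun p => LocalMap.isProbabilityMeasure_youngLaw p.1 p.2⟩

variable [∀ i, StandardBorelSpace (Y i)] [∀ i, Nonempty (U i)]

open scoped Classical in
/-- Pointwise evaluation `(f, p) ↦ f p` is not jointly measurable when local maps carry the Young
topology, which only sees them up to `ψ`-null sets.  `f.eval` is the jointly measurable version of
`f`: disintegrate `f.youngLaw` with respect to the measurements, and return the atom of the
conditional law `f(du | p)` (which is a Dirac measure at `f p` for almost every measurement). -/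
def LocalMap.eval (f : LocalMap U ψ i r) (p : PrivInfo Y U i r) : U i :=
  if h : ∃ u, (youngKernel U ψ i r).condKernel ((f, p.2), p.1) {u} = 1 then h.choose
  else Classical.arbitrary (U i)

end LocalMaps

/-- The map-valued joint action of a period of length `K`: one local map per agent and stage. -/
abbrev ActionMap {N : ℕ} {Y : Fin N → Type*} [∀ i, MeasurableSpace (Y i)] (U : Fin N → Type*)
    [∀ i, MeasurableSpace (U i)] (ψ : ∀ i, ProbabilityMeasure (Y i)) (K : ℕ) : Type _ :=
  ∀ (i : Fin N) (r : Fin K), LocalMap U ψ i r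

/-! ## The decentralized stochastic control model -/

/-- The σ-algebras generated by the initial state and by the individual noise variables. -/
@[reducible] def noiseSigma {N : ℕ} {X V Ω : Type*} {W : Fin N → Type*} [MeasurableSpace X] [MeasurableSpace V]
    [∀ i, MeasurableSpace (W i)] (x₀ : Ω → X) (v : ℕ → Ω → V) (w : ∀ i, ℕ → Ω → W i) :
    Unit ⊕ ℕ ⊕ (Fin N × ℕ) → MeasurableSpace Ω
  | .inl _ => MeasurableSpace.comap x₀ inferInstance
  | .inr (.inl t) => MeasurableSpace.comap (v t) inferInstance
  | .inr (.inr p) => MeasurableSpace.comap (w p.1 p.2) inferInstance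

/-- `N` agents, state space `X`, measurement spaces `Y i`, action spaces `U i`, dynamics
`x_{t+1} = Φ(x_t, u_t, v_t)`, measurements `y^i_t = φ^i(x_t, w^i_t)`, independent initial state and
i.i.d. noises, channels with densities `h^i(x, ·)` with respect to reference probability measures
`ψ^i`, and a discounted bounded stage cost `c`. -/
structure TeamModel (N : ℕ) (X : Type*) (Y U : Fin N → Type*) (V : Type*) (W : Fin N → Type*)
    (Ω : Type*) [MeasurableSpace X] [∀ i, MeasurableSpace (Y i)] [∀ i, MeasurableSpace (U i)]
    [MeasurableSpace V] [∀ i, MeasurableSpace (W i)] [MeasurableSpace Ω] where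
  P : Measure Ω
  isProb : IsProbabilityMeasure P
  Φ : X → (∀ i, U i) → V → X
  measurable_Φ : Measurable fun p : X × (∀ i, U i) × V => Φ p.1 p.2.1 p.2.2
  φ : ∀ i, X → W i → Y i
  measurable_φ : ∀ i, Measurable fun p : X × W i => φ i p.1 p.2
  x₀ : Ω → X
  measurable_x₀ : Measurable x₀
  v : ℕ → Ω → V
  measurable_v : ∀ t, Measurable (v t)
  w : ∀ i, ℕ → Ω → W i
  measurable_w : ∀ i t, Measurable (w i t)
  indep : iIndep (noiseSigma x₀ v w) P
  identDistrib_v : ∀ t, P.map (v t) = P.map (v 0)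
  identDistrib_w : ∀ i t, P.map (w i t) = P.map (w i 0)
  ψ : ∀ i, ProbabilityMeasure (Y i)
  h : ∀ i, X → Y i → ℝ≥0
  measurable_h : ∀ i, Measurable fun p : X × Y i => h i p.1 p.2
  channel_density : ∀ i x, P.map (fun ω => φ i x (w i 0 ω)) =
    (ψ i : Measure (Y i)).withDensity fun y => (h i x y : ℝ≥0∞)
  c : X → (∀ i, U i) → ℝ
  measurable_c : Measurable fun p : X × (∀ i, U i) => c p.1 p.2
  bounded_c : ∃ C, ∀ x u, |c x u| ≤ C
  β : ℝ
  β_pos : 0 < β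
  β_lt_one : β < 1

attribute [instance] TeamModel.isProb

section Model

variable {N : ℕ} {X : Type*} {Y U : Fin N → Type*} {V : Type*} {W : Fin N → Type*} {Ω : Type*}
  [MeasurableSpace X] [∀ i, MeasurableSpace (Y i)] [∀ i, MeasurableSpace (U i)]
  [MeasurableSpace V] [∀ i, MeasurableSpace (W i)] [MeasurableSpace Ω]

/-- The transition kernel `𝒯(· | x, u)` induced by the dynamics. -/
def TeamModel.transition (S : TeamModel N X Y U V W Ω) (x : X) (u : ∀ i, U i) : Measure X :=
  S.P.map fun ω => S.Φ x u (S.v 0 ω)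

/-- The measurement channel `Q^i(· | x)`. -/
def TeamModel.channel (S : TeamModel N X Y U V W Ω) (i : Fin N) (x : X) : Measure (Y i) :=
  S.P.map fun ω => S.φ i x (S.w i 0 ω)

/-- The common information in period `q` of the `K`-step periodic information sharing pattern: all
measurements and all actions of all agents in the periods `0, …, q - 1`. -/
abbrev CommonInfo (Y U : Fin N → Type*) (K q : ℕ) : Type _ :=
  (Fin q → Fin K → ∀ i, Y i) × (Fin q → Fin K → ∀ i, U i)

/-- An admissible team policy under the `K`-step periodic information sharing pattern: in period
`q`, at stage `r`, agent `i` applies a jointly measurable function of the common information and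
of its private information.  The section at the common information is the local map. -/
structure TeamPolicy (S : TeamModel N X Y U V W Ω) (K : ℕ) where
  act : ∀ q : ℕ, CommonInfo Y U K q → ActionMap U S.ψ K
  measurable_act : ∀ (q : ℕ) (i : Fin N) (r : Fin K),
    Measurable fun p : CommonInfo Y U K q × PrivInfo Y U i r => (act q p.1 i r).toFun p.2

/-! ### The closed-loop processes -/

/-- The first `r` stages of period `q` started in state `x` under the action `a`: the resulting
state and the measurements and actions of all agents at those stages. -/
def TeamModel.runPeriod (S : TeamModel N X Y U V W Ω) {K : ℕ} (a : ActionMap U S.ψ K) (q : ℕ)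
    (ω : Ω) (x : X) :
    (r : ℕ) → r ≤ K → X × (Fin r → ∀ i, Y i) × (Fin r → ∀ i, U i)
  | 0, _ => (x, Fin.elim0, Fin.elim0)
  | r + 1, hr =>
    let s := S.runPeriod a q ω x r (Nat.le_of_succ_le hr)
    let ys : Fin (r + 1) → ∀ i, Y i :=
      Fin.snoc (α := fun _ => ∀ i, Y i) s.2.1 fun i => S.φ i s.1 (S.w i (q * K + r) ω)
    let u : ∀ i, U i := fun i => (a i ⟨r, hr⟩).toFun (fun j => ys j i, fun j => s.2.2 j i)
    (S.Φ s.1 u (S.v (q * K + r) ω), ys, Fin.snoc (α := fun _ => ∀ i, U i) s.2.2 u)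

/-- The state `x_{qK}` at the beginning of period `q`, with the common information of period `q`. -/
def TeamModel.history (S : TeamModel N X Y U V W Ω) {K : ℕ} (γ : TeamPolicy S K) (ω : Ω) :
    (q : ℕ) → X × CommonInfo Y U K q
  | 0 => (S.x₀ ω, Fin.elim0, Fin.elim0)
  | q + 1 =>
    let s := S.history γ ω q
    let b := S.runPeriod (γ.act q s.2) q ω s.1 K le_rfl
    (b.1, Fin.snoc (α := fun _ => Fin K → ∀ i, Y i) s.2.1 b.2.1,
      Fin.snoc (α := fun _ => Fin K → ∀ i, U i) s.2.2 b.2.2)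

/-- The map-valued action `a_q`. -/
def TeamModel.action (S : TeamModel N X Y U V W Ω) {K : ℕ} (γ : TeamPolicy S K) (q : ℕ) (ω : Ω) :
    ActionMap U S.ψ K :=
  γ.act q (S.history γ ω q).2

/-- The first `r` stages of period `q` of the closed-loop system. -/
def TeamModel.period (S : TeamModel N X Y U V W Ω) {K : ℕ} (γ : TeamPolicy S K) (q : ℕ) (ω : Ω)
    (r : ℕ) (hr : r ≤ K) : X × (Fin r → ∀ i, Y i) × (Fin r → ∀ i, U i) :=
  S.runPeriod (S.action γ q ω) q ω (S.history γ ω q).1 r hr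

/-- All measurements `y_{[qK, qK+K-1]}` of period `q`. -/
def TeamModel.measurements (S : TeamModel N X Y U V W Ω) {K : ℕ} (γ : TeamPolicy S K) (q : ℕ)
    (ω : Ω) : Fin K → ∀ i, Y i :=
  (S.period γ q ω K le_rfl).2.1

/-- The state `x_t`. -/
def TeamModel.stateAt (S : TeamModel N X Y U V W Ω) {K : ℕ} [NeZero K] (γ : TeamPolicy S K)
    (t : ℕ) (ω : Ω) : X :=
  (S.period γ (t / K) ω (t % K) (Nat.mod_lt t (NeZero.pos K)).le).1

/-- The joint action `u_t`. -/
def TeamModel.controlAt (S : TeamModel N X Y U V W Ω) {K : ℕ} [NeZero K] (γ : TeamPolicy S K)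
    (t : ℕ) (ω : Ω) : ∀ i, U i :=
  (S.period γ (t / K) ω K le_rfl).2.2 ⟨t % K, Nat.mod_lt t (NeZero.pos K)⟩

/-- The discounted cost from time `T` on. -/
def TeamModel.costFrom (S : TeamModel N X Y U V W Ω) {K : ℕ} [NeZero K] (T : ℕ)
    (γ : TeamPolicy S K) : ℝ :=
  ∑' t : ℕ, S.β ^ (T + t) * ∫ ω, S.c (S.stateAt γ (T + t) ω) (S.controlAt γ (T + t) ω) ∂S.P

/-- The predictor `π_q = P(x_{qK} ∈ · | y_{[0,qK-1]}, u_{[0,qK-1]})`, a regular conditional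
distribution evaluated at the common information. -/
def TeamModel.predictor [StandardBorelSpace X] [Nonempty X] (S : TeamModel N X Y U V W Ω) {K : ℕ}
    (γ : TeamPolicy S K) (q : ℕ) (ω : Ω) : ProbabilityMeasure X :=
  ⟨condDistrib (fun ω => (S.history γ ω q).1) (fun ω => (S.history γ ω q).2) S.P
    (S.history γ ω q).2, inferInstance⟩

/-! ### Bayesian updates -/

open scoped Classical in
/-- One-step Bayesian update of the predictor,
`F(Z, u, y)(·) = ∫ 𝒯(· | x, u) ∏ᵢ hⁱ(x, yⁱ) Z(dx) / ∫ ∏ᵢ hⁱ(x, yⁱ) Z(dx)`;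
where the denominator is `0` or `∞` the predictor is left unchanged. -/
def TeamModel.stepUpdate (S : TeamModel N X Y U V W Ω) (Z : ProbabilityMeasure X) (u : ∀ i, U i)
    (y : ∀ i, Y i) : ProbabilityMeasure X :=
  let m : Measure X := (Z : Measure X).withDensity fun x => ∏ i, (S.h i x (y i) : ℝ≥0∞)
  let m' : Measure X := (m Set.univ)⁻¹ • m.bind fun x => S.transition x u
  if hm : IsProbabilityMeasure m' then ⟨m', hm⟩ else Z

/-- The update `G` over one period: `K` one-step updates. -/
def TeamModel.periodUpdate (S : TeamModel N X Y U V W Ω) {K : ℕ} (π : ProbabilityMeasure X)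
    (us : Fin K → ∀ i, U i) (ys : Fin K → ∀ i, Y i) : ProbabilityMeasure X :=
  Fin.foldl K (fun Z r => S.stepUpdate Z (us r) (ys r)) π

/-! ### The centralized reduction: predictor as state -/

/-- Joint law of the state after `r` stages of a period and of the measurements and actions at
those stages, if the period starts with `x_{qK} ∼ π` and the action is `a`. -/
def TeamModel.stageLaw (S : TeamModel N X Y U V W Ω) {K : ℕ} (π : ProbabilityMeasure X)
    (a : ActionMap U S.ψ K) :
    (r : ℕ) → r ≤ K → Measure (X × (Fin r → ∀ i, Y i) × (Fin r → ∀ i, U i))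
  | 0, _ => (π : Measure X).map fun x => (x, Fin.elim0, Fin.elim0)
  | r + 1, hr => (S.stageLaw π a r (Nat.le_of_succ_le hr)).bind fun s =>
      (Measure.pi fun i => S.channel i s.1).bind fun y =>
        let ys : Fin (r + 1) → ∀ i, Y i := Fin.snoc (α := fun _ => ∀ i, Y i) s.2.1 y
        let u : ∀ i, U i := fun i => (a i ⟨r, hr⟩).toFun (fun j => ys j i, fun j => s.2.2 j i)
        (S.transition s.1 u).map fun x' =>
          (x', ys, Fin.snoc (α := fun _ => ∀ i, U i) s.2.2 u)

/-- The expected cost of stage `r` of a period that starts with `x_{qK} ∼ π` under the action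
`a`. -/
def TeamModel.stageCost (S : TeamModel N X Y U V W Ω) {K : ℕ} (π : ProbabilityMeasure X)
    (a : ActionMap U S.ψ K) (r : Fin K) : ℝ :=
  ∫ s, (∫ y, S.c s.1 (fun i => (a i r).toFun
      (fun j => (Fin.snoc (α := fun _ => ∀ i, Y i) s.2.1 y : Fin (r.1 + 1) → ∀ i, Y i) j i,
        fun j => s.2.2 j i))
    ∂(Measure.pi fun i => S.channel i s.1)) ∂(S.stageLaw π a r r.isLt.le)

/-- The cost `c̃(π, a)` of a period. -/
def TeamModel.periodCost (S : TeamModel N X Y U V W Ω) {K : ℕ} (π : ProbabilityMeasure X)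
    (a : ActionMap U S.ψ K) : ℝ :=
  ∑ r : Fin K, S.β ^ (r : ℕ) * S.stageCost π a r

/-- The transition law `θ(· | π, a)` of the centralized reduction: the law of `G(π, u, y)`. -/
def TeamModel.beliefTransition (S : TeamModel N X Y U V W Ω) {K : ℕ} (π : ProbabilityMeasure X)
    (a : ActionMap U S.ψ K) : Measure (ProbabilityMeasure X) :=
  (S.stageLaw π a K le_rfl).map fun s => S.periodUpdate π s.2.2 s.2.1

/-! ### The sliding window state -/

/-- The values of `Ẑ_q = (π_{q-M}, (y_{[(q-M)K, qK-1]}, a_{[q-M, q-1]}))`. -/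
abbrev WindowState (S : TeamModel N X Y U V W Ω) (K M : ℕ) : Type _ :=
  ProbabilityMeasure X × (Fin M → Fin K → ∀ i, Y i) × (Fin M → ActionMap U S.ψ K)

/-- The process `Ẑ`, indexed by `k = q - M`: `S.window M γ k` is `Ẑ_{M+k}`. -/
def TeamModel.window [StandardBorelSpace X] [Nonempty X] (S : TeamModel N X Y U V W Ω) {K : ℕ}
    (M : ℕ) (γ : TeamPolicy S K) (k : ℕ) (ω : Ω) : WindowState S K M :=
  (S.predictor γ k ω, fun j => S.measurements γ (k + j) ω, fun j => S.action γ (k + j) ω)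

variable [∀ i, Finite (U i)] [∀ i, MeasurableSingletonClass (U i)] [∀ i, Nonempty (U i)]
  [∀ i, StandardBorelSpace (Y i)]

/-- The actions of the first `r` stages of a period, generated from the measurements `y` by the
local maps `a`. -/
def TeamModel.playTo (S : TeamModel N X Y U V W Ω) {K : ℕ} (a : ActionMap U S.ψ K)
    (y : Fin K → ∀ i, Y i) : (r : ℕ) → r ≤ K → Fin r → ∀ i, U i
  | 0, _ => Fin.elim0
  | r + 1, hr =>
    let us := S.playTo a y r (Nat.le_of_succ_le hr)
    Fin.snoc (α := fun _ => ∀ i, U i) us fun i =>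
      (a i ⟨r, hr⟩).eval (fun j => y (Fin.castLE hr j) i, fun j => us j i)

/-- The actions of a period, generated from the measurements `y` by the local maps `a`. -/
def TeamModel.play (S : TeamModel N X Y U V W Ω) {K : ℕ} (a : ActionMap U S.ψ K)
    (y : Fin K → ∀ i, Y i) : Fin K → ∀ i, U i :=
  S.playTo a y K le_rfl

/-- The map `Ẑ_q ↦ π_q`: recursive Bayesian updating along the window. -/
def TeamModel.filter (S : TeamModel N X Y U V W Ω) {K M : ℕ} (z : WindowState S K M) :
    ProbabilityMeasure X :=
  Fin.foldl M (fun π j => S.periodUpdate π (S.play (z.2.2 j) (z.2.1 j)) (z.2.1 j)) z.1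

/-- The next window state, when the action is `a` and the new measurements are `y`: update the
predictor with the oldest block of the window, drop that block, and append the new one. -/
def TeamModel.windowStep (S : TeamModel N X Y U V W Ω) {K M : ℕ} [NeZero M]
    (z : WindowState S K M) (a : ActionMap U S.ψ K) (y : Fin K → ∀ i, Y i) : WindowState S K M :=
  (S.periodUpdate z.1 (S.play (z.2.2 0) (z.2.1 0)) (z.2.1 0),
    fun j => if hj : (j : ℕ) + 1 < M then z.2.1 ⟨j + 1, hj⟩ else y,
    fun j => if hj : (j : ℕ) + 1 < M then z.2.2 ⟨j + 1, hj⟩ else a)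

/-- The transition law `θ̃(· | z, a)`: the law of the next window state, when the new measurements
are produced by a period that starts from `x_{qK} ∼ π_q`, with `π_q` computed from `z`. -/
def TeamModel.windowTransition (S : TeamModel N X Y U V W Ω) {K M : ℕ} [NeZero M]
    (z : WindowState S K M) (a : ActionMap U S.ψ K) : Measure (WindowState S K M) :=
  (S.stageLaw (S.filter z) a K le_rfl).map fun s => S.windowStep z a s.2.1

/-- The cost `r(z, a) = c̃(π_q, a)`, with `π_q` computed from `z`. -/
def TeamModel.windowCost (S : TeamModel N X Y U V W Ω) {K M : ℕ} (z : WindowState S K M)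
    (a : ActionMap U S.ψ K) : ℝ :=
  S.periodCost (S.filter z) a

end Model

/-! ## Controlled Markov processes and Markov decision processes -/

section MDP

variable {Ω 𝓢 𝓐 : Type*} [MeasurableSpace Ω] [MeasurableSpace 𝓢] [MeasurableSpace 𝓐]

/-- The σ-algebra generated by `Z_0, …, Z_k` and `A_0, …, A_k`. -/
@[reducible] def pastSigma (Z : ℕ → Ω → 𝓢) (A : ℕ → Ω → 𝓐) (k : ℕ) : MeasurableSpace Ω :=
  ⨆ j : Fin (k + 1), MeasurableSpace.comap (Z j) inferInstance ⊔
    MeasurableSpace.comap (A j) inferInstance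

/-- `(Z_k, A_k)` is a controlled Markov process with transition kernel `κ`:
`P(Z_{k+1} ∈ B | Z_0, A_0, …, Z_k, A_k) = κ(B | Z_k, A_k)` almost surely. -/
structure IsControlledMarkov (P : Measure Ω) (Z : ℕ → Ω → 𝓢) (A : ℕ → Ω → 𝓐)
    (κ : Kernel (𝓢 × 𝓐) 𝓢) : Prop where
  measurable_state : ∀ k, Measurable (Z k)
  measurable_action : ∀ k, Measurable (A k)
  markov : ∀ (k : ℕ) (B : Set 𝓢), MeasurableSet B →
    P[(Z (k + 1) ⁻¹' B).indicator (fun _ => (1 : ℝ)) | pastSigma Z A k]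
      =ᵐ[P] fun ω => (κ (Z k ω, A k ω)).real B

/-- A deterministic history-dependent policy.  (Past actions are functions of past states.) -/
structure HistoryPolicy (𝓢 𝓐 : Type*) [MeasurableSpace 𝓢] [MeasurableSpace 𝓐] where
  act : ∀ k : ℕ, (Fin (k + 1) → 𝓢) → 𝓐
  measurable_act : ∀ k, Measurable (act k)

/-- A deterministic Markov policy. -/
structure MarkovPolicy (𝓢 𝓐 : Type*) [MeasurableSpace 𝓢] [MeasurableSpace 𝓐] where
  act : ℕ → 𝓢 → 𝓐
  measurable_act : ∀ k, Measurable (act k)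

/-- A Markov policy as a history-dependent policy. -/
def MarkovPolicy.toHistory (g : MarkovPolicy 𝓢 𝓐) : HistoryPolicy 𝓢 𝓐 where
  act k s := g.act k (s (Fin.last k))
  measurable_act k := (g.measurable_act k).comp (measurable_pi_apply _)

/-- A Markov policy on `𝓢'` used on `𝓢` through a measurable map `f : 𝓢 → 𝓢'`. -/
def MarkovPolicy.comp {𝓢' : Type*} [MeasurableSpace 𝓢'] (g : MarkovPolicy 𝓢' 𝓐) (f : 𝓢 → 𝓢')
    (hf : Measurable f) : MarkovPolicy 𝓢 𝓐 where
  act k s := g.act k (f s)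
  measurable_act k := (g.measurable_act k).comp hf

/-- The law of the first `k + 1` states of the Markov decision process with transition kernel `κ`
and initial law `ν` under the policy `g`. -/
def histLaw (κ : Kernel (𝓢 × 𝓐) 𝓢) (ν : Measure 𝓢) (g : HistoryPolicy 𝓢 𝓐) :
    (k : ℕ) → Measure (Fin (k + 1) → 𝓢)
  | 0 => ν.map fun s _ => s
  | k + 1 => (histLaw κ ν g k).bind fun s =>
      (κ (s (Fin.last k), g.act k s)).map fun s' => Fin.snoc (α := fun _ => 𝓢) s s'

/-- The expected discounted cost `∑ b^k E[r(S_k, A_k)]`. -/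
def expectedCost (κ : Kernel (𝓢 × 𝓐) 𝓢) (r : 𝓢 → 𝓐 → ℝ) (b : ℝ) (ν : Measure 𝓢)
    (g : HistoryPolicy 𝓢 𝓐) : ℝ :=
  ∑' k : ℕ, b ^ k * ∫ s, r (s (Fin.last k)) (g.act k s) ∂histLaw κ ν g k

end MDP

end PeriodicSharing

end

/-!
# The sliding-window reduction of a team problem with periodic information sharing

The common information of a period determines everything the agents share, so the team behaves like
a single controller whose action is the family of local maps used in a period. Four facts make this
precise.

**Measurability.** The σ-algebra on actions only sees local maps up to null sets of the reference
measures, so evaluation of a local map has to be replaced by a version obtained from a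
disintegration of its Young measure (`LocalMap.measurable_eval`, `LocalMap.eval_ae_eq`). Since the
channels have densities, the measurements of an agent during a period are absolutely continuous with
respect to the product of its reference measures (`TeamModel.ae_stageLaw_of_ae_ref`). Hence nothing
changes almost surely when the versions are used, the law of a period is a measurable function of
its initial law and of the action (`TeamModel.measurable_stageLaw`), and the actions of a period are
almost surely generated from its measurements (`TeamModel.ae_action_eq_play`). Conversely,
measurable functions take the same value at actions with the same Young measures
(`ActionMap.eq_of_youngLaw_eq`).

**Filtering.** By independence of the noises, a period of the closed-loop system has, given the
common information, the law of a period started from the predictor (`TeamModel.lintegral_period`).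
Within such a period the conditional law of the state is updated by Bayes' rule
(`TeamModel.lintegral_stageLaw_eq_updateTo`), so that the predictor is almost surely updated by the
recursive filter (`TeamModel.ae_predictor_succ`). This gives the identity between filtered window
and predictor, the controlled Markov property of both processes (`TeamModel.condExp_indicator`), and
the formula for the costs (`TeamModel.condExp_cost`).

**Implementation.** The window states are functions of the common information. A policy of the
window process is therefore implemented by a team policy, defined period by period: the windows up
to period `M + k` depend only on the actions before that period, so that the action of period
`M + k` can be read off from the policy already constructed (`TeamModel.implementTo`,
`TeamModel.map_windows_eq_histLaw`).

**Optimal costs.** Implementation, and lifting of Markov policies along the filter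
(`expectedCost_comp`), give one chain of inequalities between the optimal costs. It is closed by
showing that Markov policies of the predictor process do as well, up to `ε`, as any team policy
(`IsControlledMarkov.exists_markovPolicy_le`): the conditional law of the common information given
the predictor turns a team policy into a randomized Markov policy with the same joint laws of
predictor and action at each time, driven by uniform seeds in the unit interval; over a finite
horizon the seeds can be fixed one after the other without increasing the cost; and discounting
makes the remaining costs negligible. No measurable selection theorem is needed.
-/

namespace PeriodicSharing

/-! ### Jointly measurable evaluation of local maps -/

section Eval

variable {N : ℕ} {Y U : Fin N → Type*} [∀ i, MeasurableSpace (Y i)] [∀ i, MeasurableSpace (U i)]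
  {ψ : ∀ i, ProbabilityMeasure (Y i)} {i : Fin N} {r : ℕ}
  [∀ i, Finite (U i)] [∀ i, MeasurableSingletonClass (U i)]
  [∀ i, StandardBorelSpace (Y i)] [∀ i, Nonempty (U i)]

/-- The choice made in `LocalMap.eval` is unique: a conditional law has at most one atom of mass
one. -/
theorem LocalMap.eval_eq_of_condKernel {f : LocalMap U ψ i r} {p : PrivInfo Y U i r} {u : U i}
    (hu : (youngKernel U ψ i r).condKernel ((f, p.2), p.1) {u} = 1) : f.eval p = u := by
  have hex : ∃ u, (youngKernel U ψ i r).condKernel ((f, p.2), p.1) {u} = 1 := ⟨u, hu⟩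
  rw [LocalMap.eval, dif_pos hex]
  by_contra hne
  -- A probability measure cannot have two distinct atoms of mass one.
  have h2 := measure_union (μ := (youngKernel U ψ i r).condKernel ((f, p.2), p.1))
    (Set.disjoint_singleton.2 hne) (measurableSet_singleton u)
  rw [hex.choose_spec, hu] at h2
  have h3 : (youngKernel U ψ i r).condKernel ((f, p.2), p.1) ({hex.choose} ∪ {u}) ≤ 1 :=
    prob_le_one
  rw [h2] at h3
  norm_num at h3

theorem LocalMap.measurable_eval :
    Measurable fun p : LocalMap U ψ i r × PrivInfo Y U i r => p.1.eval p.2 := by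
  classical
  let κ := (youngKernel U ψ i r).condKernel
  have hκ (u : U i) : Measurable fun p : LocalMap U ψ i r × PrivInfo Y U i r =>
      κ ((p.1, p.2.2), p.2.1) {u} :=
    (Kernel.measurable_coe κ (measurableSet_singleton u)).comp (by fun_prop)
  have hset (u : U i) : MeasurableSet
      {p : LocalMap U ψ i r × PrivInfo Y U i r | κ ((p.1, p.2.2), p.2.1) {u} = 1} :=
    hκ u (measurableSet_singleton 1)
  have hex : MeasurableSet
      {p : LocalMap U ψ i r × PrivInfo Y U i r | ∃ u, κ ((p.1, p.2.2), p.2.1) {u} = 1} := by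
    have := MeasurableSet.iUnion hset
    convert this using 1
    ext p; simp
  refine measurable_to_countable' fun u => ?_
  by_cases hu : u = Classical.arbitrary (U i)
  · convert (hset u).union hex.compl using 1
    ext p
    simp only [Set.mem_preimage, Set.mem_singleton_iff, Set.mem_union, Set.mem_ofPred_eq,
      Set.mem_compl_iff]
    refine ⟨fun h => ?_, fun h => h.elim LocalMap.eval_eq_of_condKernel fun h => ?_⟩
    · by_cases he : ∃ u, κ ((p.1, p.2.2), p.2.1) {u} = 1
      · obtain ⟨u', hu'⟩ := he
        rw [← h, LocalMap.eval_eq_of_condKernel hu']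
        exact Or.inl hu'
      · exact Or.inr he
    · rw [LocalMap.eval, dif_neg h, hu]
  · convert hset u using 1
    ext p
    simp only [Set.mem_preimage, Set.mem_singleton_iff, Set.mem_ofPred_eq]
    refine ⟨fun h => ?_, LocalMap.eval_eq_of_condKernel⟩
    by_cases he : ∃ u, κ ((p.1, p.2.2), p.2.1) {u} = 1
    · obtain ⟨u', hu'⟩ := he
      rwa [← h, LocalMap.eval_eq_of_condKernel hu']
    · rw [LocalMap.eval, dif_neg he] at h
      exact absurd h.symm hu

/-- The Young measure of `f` disintegrates into the reference measure and the Dirac measures at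
the values of `f`, so that uniqueness of disintegrations identifies the conditional laws. -/
theorem LocalMap.eval_ae_eq (f : LocalMap U ψ i r) (up : Fin r → U i) :
    ∀ᵐ y ∂(Measure.pi fun _ : Fin (r + 1) => (ψ i : Measure (Y i))),
      f.eval (y, up) = f.toFun (y, up) := by
  have hm : Measurable fun y : Fin (r + 1) → Y i => f.toFun (y, up) :=
    f.measurable_toFun.comp measurable_prodMk_right
  have hfst : (Kernel.fst (youngKernel U ψ i r)) (f, up) =
      Measure.pi fun _ : Fin (r + 1) => (ψ i : Measure (Y i)) := by
    rw [Kernel.fst_apply]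
    change (f.youngLaw up).map Prod.fst = _
    have h := Measure.map_map (μ := Measure.pi fun _ : Fin (r + 1) => (ψ i : Measure (Y i)))
      measurable_fst (measurable_id.prodMk hm)
    exact h.trans Measure.map_id
  have h1 := Kernel.condKernel_apply_eq_condKernel (youngKernel U ψ i r) (f, up)
  have h2 : ∀ᵐ y ∂(f.youngLaw up).fst,
      Kernel.deterministic _ hm y = (f.youngLaw up).condKernel y := by
    refine eq_condKernel_of_measure_eq_compProd _ ?_
    have h3 : (f.youngLaw up).fst = Measure.pi fun _ : Fin (r + 1) => (ψ i : Measure (Y i)) := by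
      rw [← hfst, Kernel.fst_apply]; rfl
    rw [h3, Measure.compProd_deterministic]
    rfl
  have h3 : (f.youngLaw up).fst = Measure.pi fun _ : Fin (r + 1) => (ψ i : Measure (Y i)) := by
    rw [← hfst, Kernel.fst_apply]; rfl
  rw [h3] at h2
  rw [hfst] at h1
  filter_upwards [h1, h2] with y h1 h2
  refine LocalMap.eval_eq_of_condKernel ?_
  have : (youngKernel U ψ i r) (f, up) = f.youngLaw up := rfl
  simp only [h1, this, ← h2]
  simp [Kernel.deterministic_apply]

end Eval

/-! ### Joint densities of the measurement channels -/

theorem lintegral_pi_prod_eq_prod {ι : Type*} [Fintype ι] {α : ι → Type*}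
    [∀ i, MeasurableSpace (α i)] (μ : ∀ i, Measure (α i)) [∀ i, IsProbabilityMeasure (μ i)]
    {f : ∀ i, α i → ℝ≥0∞} (hf : ∀ i, Measurable (f i)) :
    ∫⁻ x, ∏ i, f i (x i) ∂Measure.pi μ = ∏ i, ∫⁻ x, f i x ∂μ i := by
  have hi : iIndepFun (fun i (x : ∀ i, α i) => f i (x i)) (Measure.pi μ) :=
    iIndepFun_pi (fun i => (hf i).aemeasurable)
  have h := lintegral_prod_eq_prod_lintegral_of_indepFun Finset.univ _ hi
    fun i => (hf i).comp (measurable_pi_apply i)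
  refine h.trans (Finset.prod_congr rfl fun i _ => ?_)
  rw [← (measurePreserving_eval μ i).map_eq, lintegral_map (hf i) (measurable_pi_apply i)]

theorem pi_withDensity_eq {ι : Type*} [Fintype ι] {α : ι → Type*}
    [∀ i, MeasurableSpace (α i)] (μ : ∀ i, Measure (α i)) [∀ i, IsProbabilityMeasure (μ i)]
    {f : ∀ i, α i → ℝ≥0∞} (hf : ∀ i, Measurable (f i))
    [∀ i, SigmaFinite ((μ i).withDensity (f i))] :
    (Measure.pi fun i => (μ i).withDensity (f i)) =
      (Measure.pi μ).withDensity fun x => ∏ i, f i (x i) := by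
  refine Measure.pi_eq fun s hs => ?_
  rw [withDensity_apply _ (MeasurableSet.univ_pi hs), ← lintegral_indicator (.univ_pi hs)]
  have : ∀ x, (Set.univ.pi s).indicator (fun x : ∀ i, α i => ∏ i, f i (x i)) x =
      ∏ i, (s i).indicator (f i) (x i) := by
    intro x
    by_cases hx : x ∈ Set.univ.pi s
    · rw [Set.indicator_of_mem hx]
      exact Finset.prod_congr rfl fun i _ =>
        (Set.indicator_of_mem (hx i (Set.mem_univ i)) _).symm
    · rw [Set.indicator_of_notMem hx]
      obtain ⟨i, -, hi⟩ : ∃ i, i ∈ Set.univ ∧ x i ∉ s i := by simpa [Set.mem_pi] using hx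
      exact (Finset.prod_eq_zero (Finset.mem_univ i) (Set.indicator_of_notMem hi _)).symm
  simp_rw [this]
  rw [lintegral_pi_prod_eq_prod μ fun i => (hf i).indicator (hs i)]
  refine Finset.prod_congr rfl fun i _ => ?_
  rw [lintegral_indicator (hs i), withDensity_apply _ (hs i)]

/-! ### Measurability of parametrized integrals -/

section Parametrized

variable {α β γ : Type*} [MeasurableSpace α] [MeasurableSpace β] [MeasurableSpace γ]

theorem measurable_lintegral_param {κ : α → Measure β} (hκ : Measurable κ)
    [h : ∀ a, IsProbabilityMeasure (κ a)] {f : α → β → ℝ≥0∞}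
    (hf : Measurable (Function.uncurry f)) : Measurable fun a => ∫⁻ b, f a b ∂κ a := by
  let η : Kernel α β := ⟨κ, hκ⟩
  have : IsMarkovKernel η := ⟨h⟩
  exact Measurable.lintegral_kernel_prod_right (κ := η) hf

theorem measurable_map_param {μ : Measure β} [SFinite μ] {F : α → β → γ}
    (hF : Measurable (Function.uncurry F)) : Measurable fun a => μ.map (F a) := by
  have h : (fun a => μ.map (F a)) =
      fun a => (μ.map (Prod.mk a)).map (Function.uncurry F) := by
    funext a
    rw [Measure.map_map hF measurable_prodMk_left]
    rfl
  rw [h]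
  exact (Measure.measurable_map _ hF).comp Measurable.map_prodMk_left

theorem measurable_map_param' {κ : α → Measure β} (hκ : Measurable κ)
    [h : ∀ a, IsProbabilityMeasure (κ a)] {F : α → β → γ}
    (hF : Measurable (Function.uncurry F)) : Measurable fun a => (κ a).map (F a) := by
  let η : Kernel α β := ⟨κ, hκ⟩
  have : IsMarkovKernel η := ⟨h⟩
  refine Measure.measurable_of_measurable_coe _ fun s hs => ?_
  have h : ∀ a, (κ a).map (F a) s = η a (Prod.mk a ⁻¹' (Function.uncurry F ⁻¹' s)) := fun a => by
    rw [Measure.map_apply hF.of_uncurry_left hs]; rfl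
  simp_rw [h]
  exact Kernel.measurable_kernel_prodMk_left (hF hs)

theorem measurable_bind_param {κ : α → Measure β} (hκ : Measurable κ)
    [∀ a, IsProbabilityMeasure (κ a)] {η : α → β → Measure γ}
    (hη : Measurable (Function.uncurry η)) : Measurable fun a => (κ a).bind (η a) := by
  refine Measure.measurable_of_measurable_coe _ fun s hs => ?_
  simp_rw [fun a => Measure.bind_apply (m := κ a) hs (hη.of_uncurry_left (x := a)).aemeasurable]
  exact measurable_lintegral_param hκ ((Measure.measurable_coe hs).comp hη)

theorem measurable_of_lintegral {κ : α → Measure β}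
    (h : ∀ f : β → ℝ≥0∞, Measurable f → Measurable fun a => ∫⁻ b, f b ∂κ a) : Measurable κ := by
  refine Measure.measurable_of_measurable_coe _ fun s hs => ?_
  simpa [lintegral_indicator hs] using h (s.indicator 1) (measurable_one.indicator hs)

theorem measurable_finSnoc {r : ℕ} {f : α → Fin r → β} {g : α → β} (hf : Measurable f)
    (hg : Measurable g) :
    Measurable fun a => (Fin.snoc (α := fun _ => β) (f a) (g a) : Fin (r + 1) → β) := by
  refine measurable_pi_iff.2 fun j => ?_
  induction j using Fin.lastCases with
  | last => simpa using hg
  | cast j => simpa [Function.comp_def] using (measurable_pi_apply j).comp hf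

end Parametrized

section Model

variable {N : ℕ} {X : Type*} {Y U : Fin N → Type*} {V : Type*} {W : Fin N → Type*} {Ω : Type*}
  [MeasurableSpace X] [∀ i, MeasurableSpace (Y i)] [∀ i, MeasurableSpace (U i)]
  [MeasurableSpace V] [∀ i, MeasurableSpace (W i)] [MeasurableSpace Ω]

/-! ### The kernels of the model -/

/-- The joint measurement channel of all agents. -/
noncomputable def TeamModel.jointChannel (S : TeamModel N X Y U V W Ω) (x : X) :
    Measure (∀ i, Y i) :=
  Measure.pi fun i => S.channel i x

theorem TeamModel.measurable_noise_channel (S : TeamModel N X Y U V W Ω) (i : Fin N) (x : X)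
    (t : ℕ) : Measurable fun ω => S.φ i x (S.w i t ω) :=
  (S.measurable_φ i).comp (measurable_const.prodMk (S.measurable_w i t))

instance TeamModel.isProbabilityMeasure_channel (S : TeamModel N X Y U V W Ω) (i : Fin N) (x : X) :
    IsProbabilityMeasure (S.channel i x) :=
  Measure.isProbabilityMeasure_map (S.measurable_noise_channel i x 0).aemeasurable

instance TeamModel.isProbabilityMeasure_transition (S : TeamModel N X Y U V W Ω) (x : X)
    (u : ∀ i, U i) : IsProbabilityMeasure (S.transition x u) :=
  Measure.isProbabilityMeasure_map (S.measurable_Φ.comp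
    (measurable_const.prodMk (measurable_const.prodMk (S.measurable_v 0)))).aemeasurable

instance TeamModel.isProbabilityMeasure_jointChannel (S : TeamModel N X Y U V W Ω) (x : X) :
    IsProbabilityMeasure (S.jointChannel x) := by
  unfold TeamModel.jointChannel; infer_instance

theorem TeamModel.measurable_transition (S : TeamModel N X Y U V W Ω) :
    Measurable fun p : X × (∀ i, U i) => S.transition p.1 p.2 := by
  refine measurable_map_param (F := fun (p : X × (∀ i, U i)) ω => S.Φ p.1 p.2 (S.v 0 ω)) ?_
  exact S.measurable_Φ.comp ((measurable_fst.comp measurable_fst).prodMk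
    ((measurable_snd.comp measurable_fst).prodMk ((S.measurable_v 0).comp measurable_snd)))

/-- The joint law of the measurement noises of one stage. -/
noncomputable def TeamModel.noiseLaw (S : TeamModel N X Y U V W Ω) : Measure (∀ i, W i) :=
  Measure.pi fun i => S.P.map (S.w i 0)

instance TeamModel.isProbabilityMeasure_map_w (S : TeamModel N X Y U V W Ω) (i : Fin N) (t : ℕ) :
    IsProbabilityMeasure (S.P.map (S.w i t)) :=
  Measure.isProbabilityMeasure_map (S.measurable_w i t).aemeasurable

instance TeamModel.isProbabilityMeasure_noiseLaw (S : TeamModel N X Y U V W Ω) :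
    IsProbabilityMeasure S.noiseLaw := by
  unfold TeamModel.noiseLaw; infer_instance

theorem TeamModel.jointChannel_eq_map (S : TeamModel N X Y U V W Ω) (x : X) :
    S.jointChannel x = S.noiseLaw.map fun w i => S.φ i x (w i) := by
  have hm (i : Fin N) : Measurable (S.φ i x) := (S.measurable_φ i).comp measurable_prodMk_left
  have h (i : Fin N) : S.channel i x = (S.P.map (S.w i 0)).map (S.φ i x) := by
    rw [Measure.map_map (hm i) (S.measurable_w i 0)]; rfl
  have hsf (i : Fin N) : SigmaFinite ((S.P.map (S.w i 0)).map (S.φ i x)) := by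
    rw [← h i]; infer_instance
  rw [TeamModel.jointChannel, TeamModel.noiseLaw, Measure.pi_map_pi fun i => (hm i).aemeasurable]
  simp_rw [h]

theorem TeamModel.measurable_jointChannel (S : TeamModel N X Y U V W Ω) :
    Measurable S.jointChannel := by
  rw [funext S.jointChannel_eq_map]
  refine measurable_map_param (F := fun x (w : ∀ i, W i) i => S.φ i x (w i)) ?_
  exact measurable_pi_iff.2 fun i => (S.measurable_φ i).comp
    (measurable_fst.prodMk ((measurable_pi_apply i).comp measurable_snd))

/-- The joint reference measure on the measurements of one stage. -/
noncomputable def TeamModel.refLaw (S : TeamModel N X Y U V W Ω) : Measure (∀ i, Y i) :=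
  Measure.pi fun i => (S.ψ i : Measure (Y i))

instance TeamModel.isProbabilityMeasure_refLaw (S : TeamModel N X Y U V W Ω) :
    IsProbabilityMeasure S.refLaw := by
  unfold TeamModel.refLaw; infer_instance

theorem TeamModel.measurable_h_apply (S : TeamModel N X Y U V W Ω) (i : Fin N) (x : X) :
    Measurable fun y => (S.h i x y : ℝ≥0∞) :=
  ((S.measurable_h i).comp measurable_prodMk_left).coe_nnreal_ennreal

theorem TeamModel.channel_eq_withDensity (S : TeamModel N X Y U V W Ω) (i : Fin N) (x : X) :
    S.channel i x = (S.ψ i : Measure (Y i)).withDensity fun y => (S.h i x y : ℝ≥0∞) :=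
  S.channel_density i x

theorem TeamModel.jointChannel_eq_withDensity (S : TeamModel N X Y U V W Ω) (x : X) :
    S.jointChannel x = S.refLaw.withDensity fun y => ∏ i, (S.h i x (y i) : ℝ≥0∞) := by
  have hsf (i : Fin N) : SigmaFinite
      ((S.ψ i : Measure (Y i)).withDensity fun y => (S.h i x y : ℝ≥0∞)) := by
    rw [← S.channel_eq_withDensity]; infer_instance
  rw [TeamModel.jointChannel, TeamModel.refLaw,
    ← pi_withDensity_eq _ (fun i => S.measurable_h_apply i x)]
  simp_rw [S.channel_eq_withDensity]

/-! ### The law of a period -/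

/-- The joint action at stage `r` of a period, given the measurements up to stage `r` and the
actions before stage `r`. -/
def TeamModel.control (S : TeamModel N X Y U V W Ω) {K : ℕ} (a : ActionMap U S.ψ K) {r : ℕ}
    (hr : r < K) (ys : Fin (r + 1) → ∀ i, Y i) (us : Fin r → ∀ i, U i) : ∀ i, U i :=
  fun i => (a i ⟨r, hr⟩).toFun (fun j => ys j i, fun j => us j i)

theorem TeamModel.measurable_control (S : TeamModel N X Y U V W Ω) {K : ℕ} (a : ActionMap U S.ψ K)
    {r : ℕ} (hr : r < K) :
    Measurable fun p : (Fin (r + 1) → ∀ i, Y i) × (Fin r → ∀ i, U i) =>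
      S.control a hr p.1 p.2 := by
  refine measurable_pi_iff.2 fun i => (a i ⟨r, hr⟩).measurable_toFun.comp ?_
  fun_prop

/-- The values of the state after `r` stages of a period together with the measurements and actions
at those stages. -/
abbrev StageData (X : Type*) {N : ℕ} (Y U : Fin N → Type*) (r : ℕ) : Type _ :=
  X × (Fin r → ∀ i, Y i) × (Fin r → ∀ i, U i)

/-- The data after one more stage, given its measurements `y`, its joint action `u` and the next
state `x'`. -/
def stageSnoc {r : ℕ} (s : StageData X Y U r) (y : ∀ i, Y i) (u : ∀ i, U i) (x' : X) :
    StageData X Y U (r + 1) :=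
  (x', Fin.snoc (α := fun _ => ∀ i, Y i) s.2.1 y, Fin.snoc (α := fun _ => ∀ i, U i) s.2.2 u)

theorem measurable_stageSnoc {α : Type*} [MeasurableSpace α] {r : ℕ}
    {s : α → StageData X Y U r} {y : α → ∀ i, Y i} {u : α → ∀ i, U i} {x : α → X}
    (hs : Measurable s) (hy : Measurable y) (hu : Measurable u) (hx : Measurable x) :
    Measurable fun p => stageSnoc (s p) (y p) (u p) (x p) :=
  hx.prodMk ((measurable_finSnoc hs.snd.fst hy).prodMk (measurable_finSnoc hs.snd.snd hu))

/-- The joint action at stage `r`, given the data before stage `r` and the new measurements. -/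
def TeamModel.nextControl (S : TeamModel N X Y U V W Ω) {K : ℕ} (a : ActionMap U S.ψ K) {r : ℕ}
    (hr : r < K) (s : StageData X Y U r) (y : ∀ i, Y i) : ∀ i, U i :=
  S.control a hr (Fin.snoc (α := fun _ => ∀ i, Y i) s.2.1 y) s.2.2

theorem TeamModel.measurable_nextControl (S : TeamModel N X Y U V W Ω) {K : ℕ}
    (a : ActionMap U S.ψ K) {r : ℕ} (hr : r < K) :
    Measurable fun p : StageData X Y U r × (∀ i, Y i) => S.nextControl a hr p.1 p.2 :=
  (S.measurable_control a hr).comp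
    ((measurable_finSnoc measurable_fst.snd.fst measurable_snd).prodMk measurable_fst.snd.snd)

/-- The law of the data after stage `r`, given the data before it and the measurements. -/
noncomputable def TeamModel.stageStep (S : TeamModel N X Y U V W Ω) {r : ℕ}
    (s : StageData X Y U r) (y : ∀ i, Y i) (u : ∀ i, U i) : Measure (StageData X Y U (r + 1)) :=
  (S.transition s.1 u).map (stageSnoc s y u)

instance TeamModel.isProbabilityMeasure_stageStep (S : TeamModel N X Y U V W Ω) {r : ℕ}
    (s : StageData X Y U r) (y : ∀ i, Y i) (u : ∀ i, U i) :
    IsProbabilityMeasure (S.stageStep s y u) :=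
  Measure.isProbabilityMeasure_map (measurable_stageSnoc measurable_const measurable_const
    measurable_const measurable_id).aemeasurable

theorem TeamModel.measurable_stageStep (S : TeamModel N X Y U V W Ω) {r : ℕ} :
    Measurable fun p : StageData X Y U r × (∀ i, Y i) × (∀ i, U i) =>
      S.stageStep p.1 p.2.1 p.2.2 := by
  refine measurable_map_param' (κ := fun p : StageData X Y U r × (∀ i, Y i) × (∀ i, U i) =>
    S.transition p.1.1 p.2.2) (F := fun p => stageSnoc p.1 p.2.1 p.2.2)
    (S.measurable_transition.comp (measurable_fst.fst.prodMk measurable_snd.snd)) ?_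
  exact measurable_stageSnoc measurable_fst.fst measurable_fst.snd.fst
    measurable_fst.snd.snd measurable_snd

theorem TeamModel.lintegral_stageStep (S : TeamModel N X Y U V W Ω) {r : ℕ}
    (s : StageData X Y U r) (y : ∀ i, Y i) (u : ∀ i, U i) {f : StageData X Y U (r + 1) → ℝ≥0∞}
    (hf : Measurable f) :
    ∫⁻ s', f s' ∂S.stageStep s y u = ∫⁻ x', f (stageSnoc s y u x') ∂S.transition s.1 u :=
  lintegral_map hf (measurable_stageSnoc measurable_const measurable_const
    measurable_const measurable_id)

theorem TeamModel.stageLaw_succ (S : TeamModel N X Y U V W Ω) {K : ℕ} (π : ProbabilityMeasure X)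
    (a : ActionMap U S.ψ K) {r : ℕ} (hr : r < K) :
    S.stageLaw π a (r + 1) hr = (S.stageLaw π a r hr.le).bind fun s =>
      (S.jointChannel s.1).bind fun y => S.stageStep s y (S.nextControl a hr s y) :=
  rfl

theorem TeamModel.measurable_stageStep_nextControl (S : TeamModel N X Y U V W Ω) {K : ℕ}
    (a : ActionMap U S.ψ K) {r : ℕ} (hr : r < K) :
    Measurable (Function.uncurry fun (s : StageData X Y U r) y =>
      S.stageStep s y (S.nextControl a hr s y)) :=
  S.measurable_stageStep.comp (measurable_fst.prodMk
    (measurable_snd.prodMk (S.measurable_nextControl a hr)))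

theorem TeamModel.measurable_stage_bind (S : TeamModel N X Y U V W Ω) {K : ℕ}
    (a : ActionMap U S.ψ K) {r : ℕ} (hr : r < K) :
    Measurable fun s : StageData X Y U r =>
      (S.jointChannel s.1).bind fun y => S.stageStep s y (S.nextControl a hr s y) :=
  measurable_bind_param (κ := fun s : StageData X Y U r => S.jointChannel s.1)
    (S.measurable_jointChannel.comp measurable_fst) (S.measurable_stageStep_nextControl a hr)

theorem TeamModel.lintegral_stageLaw_succ (S : TeamModel N X Y U V W Ω) {K : ℕ}
    (π : ProbabilityMeasure X) (a : ActionMap U S.ψ K) {r : ℕ} (hr : r < K)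
    {f : StageData X Y U (r + 1) → ℝ≥0∞} (hf : Measurable f) :
    ∫⁻ s, f s ∂S.stageLaw π a (r + 1) hr =
      ∫⁻ s, ∫⁻ y, ∫⁻ s', f s' ∂S.stageStep s y (S.nextControl a hr s y) ∂S.jointChannel s.1
        ∂S.stageLaw π a r hr.le := by
  rw [S.stageLaw_succ, Measure.lintegral_bind (S.measurable_stage_bind a hr).aemeasurable
    hf.aemeasurable]
  refine lintegral_congr fun s => ?_
  rw [Measure.lintegral_bind (S.measurable_stageStep_nextControl a hr).of_uncurry_left.aemeasurable
    hf.aemeasurable]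

theorem TeamModel.lintegral_stageLaw_zero (S : TeamModel N X Y U V W Ω) {K : ℕ}
    (π : ProbabilityMeasure X) (a : ActionMap U S.ψ K)
    {f : StageData X Y U 0 → ℝ≥0∞} (hf : Measurable f) :
    ∫⁻ s, f s ∂S.stageLaw π a 0 (Nat.zero_le K) =
      ∫⁻ x, f (x, Fin.elim0, Fin.elim0) ∂(π : Measure X) :=
  lintegral_map hf (by fun_prop)

instance TeamModel.isProbabilityMeasure_stageLaw (S : TeamModel N X Y U V W Ω) {K : ℕ}
    (π : ProbabilityMeasure X) (a : ActionMap U S.ψ K) (r : ℕ) (hr : r ≤ K) :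
    IsProbabilityMeasure (S.stageLaw π a r hr) := by
  induction r with
  | zero =>
    constructor
    rw [← lintegral_one, S.lintegral_stageLaw_zero π a measurable_const]
    simp
  | succ r ih =>
    have := ih (Nat.le_of_succ_le hr)
    constructor
    rw [← lintegral_one, S.lintegral_stageLaw_succ π a hr measurable_const]
    simp

theorem TeamModel.ae_stageLaw_succ (S : TeamModel N X Y U V W Ω) {K : ℕ}
    (π : ProbabilityMeasure X) (a : ActionMap U S.ψ K) {r : ℕ} (hr : r < K)
    {p : StageData X Y U (r + 1) → Prop} (hp : MeasurableSet {s | p s})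
    (h : ∀ᵐ s ∂S.stageLaw π a r hr.le, ∀ᵐ y ∂S.jointChannel s.1,
      ∀ x', p (stageSnoc s y (S.nextControl a hr s y) x')) :
    ∀ᵐ s ∂S.stageLaw π a (r + 1) hr, p s := by
  rw [ae_iff]
  have hc : MeasurableSet {s | ¬ p s} := hp.compl
  rw [← lintegral_indicator_one hc, S.lintegral_stageLaw_succ π a hr (measurable_one.indicator hc)]
  refine (lintegral_congr_ae ?_).trans lintegral_zero
  filter_upwards [h] with s hs
  refine (lintegral_congr_ae ?_).trans lintegral_zero
  filter_upwards [hs] with y hy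
  rw [S.lintegral_stageStep _ _ _ (measurable_one.indicator hc)]
  refine (lintegral_congr fun x' => ?_).trans lintegral_zero
  exact Set.indicator_of_notMem (by simpa using hy x') _

end Model

section Model

variable {N : ℕ} {X : Type*} {Y U : Fin N → Type*} {V : Type*} {W : Fin N → Type*} {Ω : Type*}
  [MeasurableSpace X] [∀ i, MeasurableSpace (Y i)] [∀ i, MeasurableSpace (U i)]
  [MeasurableSpace V] [∀ i, MeasurableSpace (W i)] [MeasurableSpace Ω]

/-! ### Local maps and their measurable versions along a period -/

theorem TeamModel.ae_channel_of_ae_ref (S : TeamModel N X Y U V W Ω) (i : Fin N) (x : X)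
    {p : Y i → Prop} (hp : ∀ᵐ y ∂(S.ψ i : Measure (Y i)), p y) :
    ∀ᵐ y ∂S.jointChannel x, p (y i) := by
  have h : ∀ᵐ y ∂S.channel i x, p y := by
    rw [S.channel_eq_withDensity]
    exact (withDensity_absolutelyContinuous _ _).ae_le hp
  exact (measurePreserving_eval (fun i => S.channel i x) i).quasiMeasurePreserving.ae h

/-- A product measure on `r + 1` factors, disintegrated along the last factor. -/
theorem ae_ae_snoc_of_ae_pi {β : Type*} [MeasurableSpace β] (μ : Measure β) [IsProbabilityMeasure μ]
    {r : ℕ} {p : (Fin (r + 1) → β) → Prop}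
    (h : ∀ᵐ y ∂Measure.pi fun _ : Fin (r + 1) => μ, p y) :
    ∀ᵐ y ∂Measure.pi fun _ : Fin r => μ, ∀ᵐ z ∂μ, p (Fin.snoc (α := fun _ => β) y z) := by
  have hmp := (measurePreserving_piFinSuccAbove (fun _ : Fin (r + 1) => μ) (Fin.last r)).symm
  have h1 := hmp.quasiMeasurePreserving.ae h
  have h2 := (Measure.measurePreserving_swap (μ := Measure.pi fun _ : Fin r => μ)
    (ν := μ)).quasiMeasurePreserving.ae h1
  have h3 := Measure.ae_ae_of_ae_prod h2
  filter_upwards [h3] with y hy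
  filter_upwards [hy] with z hz
  convert hz using 1
  simp [MeasurableEquiv.piFinSuccAbove, Fin.insertNthEquiv, Fin.insertNth_last']

/-- Under the law of a period, the measurements of every agent are absolutely continuous with
respect to the product of its reference measures. -/
theorem TeamModel.ae_stageLaw_of_ae_ref (S : TeamModel N X Y U V W Ω) {K : ℕ}
    (π : ProbabilityMeasure X) (a : ActionMap U S.ψ K) (i : Fin N) {r : ℕ} (hr : r ≤ K)
    {p : (Fin r → Y i) → Prop}
    (hp : ∀ᵐ y ∂Measure.pi fun _ : Fin r => (S.ψ i : Measure (Y i)), p y) :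
    ∀ᵐ s ∂S.stageLaw π a r hr, p fun j => s.2.1 j i := by
  induction r with
  | zero =>
    have hp0 : ∀ y, p y := by
      intro y
      rw [Measure.pi_of_empty, ae_dirac_iff (Set.toFinite _).measurableSet] at hp
      convert hp using 1
    exact Filter.Eventually.of_forall fun s => hp0 _
  | succ r ih =>
    obtain ⟨t, htp, ht, ht0⟩ : ∃ t, (∀ y, ¬ p y → y ∈ t) ∧ MeasurableSet t ∧
        (Measure.pi fun _ : Fin (r + 1) => (S.ψ i : Measure (Y i))) t = 0 := by
      obtain ⟨t, h1, h2, h3⟩ := exists_measurable_superset_of_null hp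
      exact ⟨t, fun y hy => h1 hy, h2, h3⟩
    have htm : MeasurableSet {s : StageData X Y U (r + 1) | (fun j => s.2.1 j i) ∉ t} := by
      have : Measurable fun s : StageData X Y U (r + 1) => fun j => s.2.1 j i := by fun_prop
      exact (this ht).compl
    have hae : ∀ᵐ s ∂S.stageLaw π a (r + 1) hr, (fun j => s.2.1 j i) ∉ t := by
      refine S.ae_stageLaw_succ π a hr htm ?_
      have h1 := ih (Nat.le_of_succ_le hr)
        (ae_ae_snoc_of_ae_pi _ (measure_eq_zero_iff_ae_notMem.1 ht0))
      filter_upwards [h1] with s hs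
      filter_upwards [S.ae_channel_of_ae_ref i s.1 hs] with y hy x'
      convert hy using 2
      funext j
      induction j using Fin.lastCases <;> simp [stageSnoc]
    filter_upwards [hae] with s hs
    by_contra hn
    exact hs (htp _ hn)

/-- The point mass at `x` as an initial law. -/
noncomputable def diracLaw (x : X) : ProbabilityMeasure X :=
  ⟨Measure.dirac x, inferInstance⟩

theorem measurable_diracLaw : Measurable (diracLaw : X → ProbabilityMeasure X) :=
  Measure.measurable_dirac.subtype_mk

/-- The law of a period is the mixture over its initial state. -/
theorem TeamModel.lintegral_stageLaw_eq (S : TeamModel N X Y U V W Ω) {K : ℕ}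
    (π : ProbabilityMeasure X) (a : ActionMap U S.ψ K) {r : ℕ} (hr : r ≤ K)
    {f : StageData X Y U r → ℝ≥0∞} (hf : Measurable f) :
    ∫⁻ s, f s ∂S.stageLaw π a r hr =
      ∫⁻ x, ∫⁻ s, f s ∂S.stageLaw (diracLaw x) a r hr ∂(π : Measure X) := by
  induction r with
  | zero =>
    have hm : Measurable fun x : X => f (x, Fin.elim0, Fin.elim0) :=
      hf.comp (measurable_id.prodMk measurable_const)
    simp_rw [fun π => S.lintegral_stageLaw_zero π a hf]
    simp [diracLaw, lintegral_dirac' _ hm]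
  | succ r ih =>
    simp_rw [fun π => S.lintegral_stageLaw_succ π a hr hf]
    refine ih (Nat.le_of_succ_le hr) ?_
    refine measurable_lintegral_param (κ := fun s : StageData X Y U r => S.jointChannel s.1)
      (S.measurable_jointChannel.comp measurable_fst) ?_
    exact measurable_lintegral_param (κ := fun p : StageData X Y U r × (∀ i, Y i) =>
      S.stageStep p.1 p.2 (S.nextControl a hr p.1 p.2))
      (S.measurable_stageStep_nextControl a hr) (hf.comp measurable_snd)

variable [∀ i, Finite (U i)] [∀ i, MeasurableSingletonClass (U i)] [∀ i, Nonempty (U i)]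
  [∀ i, StandardBorelSpace (Y i)]

/-- The joint action at stage `r`, computed with the measurable versions of the local maps. -/
noncomputable def TeamModel.evalControl (S : TeamModel N X Y U V W Ω) {K : ℕ}
    (a : ActionMap U S.ψ K) {r : ℕ}
    (hr : r < K) (ys : Fin (r + 1) → ∀ i, Y i) (us : Fin r → ∀ i, U i) : ∀ i, U i :=
  fun i => (a i ⟨r, hr⟩).eval (fun j => ys j i, fun j => us j i)

theorem TeamModel.measurable_evalControl (S : TeamModel N X Y U V W Ω) {K r : ℕ} (hr : r < K) :
    Measurable fun p : ActionMap U S.ψ K × (Fin (r + 1) → ∀ i, Y i) × (Fin r → ∀ i, U i) =>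
      S.evalControl p.1 hr p.2.1 p.2.2 := by
  refine measurable_pi_iff.2 fun i => ?_
  refine LocalMap.measurable_eval.comp (f := fun p : ActionMap U S.ψ K ×
    (Fin (r + 1) → ∀ i, Y i) × (Fin r → ∀ i, U i) =>
      (p.1 i ⟨r, hr⟩, ((fun j => p.2.1 j i, fun j => p.2.2 j i) : PrivInfo Y U i r))) ?_
  have h1 : Measurable fun a : ActionMap U S.ψ K => a i ⟨r, hr⟩ :=
    (measurable_pi_apply _).comp (measurable_pi_apply i)
  refine (h1.comp measurable_fst).prodMk ?_
  fun_prop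

/-- The local maps and their jointly measurable versions almost surely generate the same actions,
because they differ only on null sets of the reference measures. -/
theorem TeamModel.ae_control_eq (S : TeamModel N X Y U V W Ω) {K : ℕ}
    (π : ProbabilityMeasure X) (a : ActionMap U S.ψ K) {r : ℕ} (hr : r < K) :
    ∀ᵐ s ∂S.stageLaw π a r hr.le, ∀ᵐ y ∂S.jointChannel s.1,
      S.nextControl a hr s y =
        S.evalControl a hr (Fin.snoc (α := fun _ => ∀ i, Y i) s.2.1 y) s.2.2 := by
  have h (i : Fin N) := S.ae_stageLaw_of_ae_ref π a i hr.le (ae_ae_snoc_of_ae_pi _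
    (ae_all_iff.2 fun up : Fin r → U i => (a i ⟨r, hr⟩).eval_ae_eq up))
  filter_upwards [ae_all_iff.2 h] with s hs
  filter_upwards [ae_all_iff.2 fun i => S.ae_channel_of_ae_ref i s.1 (hs i)] with y hy
  funext i
  have := hy i fun j => s.2.2 j i
  have hsn : (Fin.snoc (α := fun _ => Y i) (fun j => s.2.1 j i) (y i) : Fin (r + 1) → Y i) =
      fun j => (Fin.snoc (α := fun _ => ∀ i, Y i) s.2.1 y : Fin (r + 1) → ∀ i, Y i) j i := by
    funext j
    induction j using Fin.lastCases <;> simp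
  rw [hsn] at this
  exact this.symm

theorem TeamModel.lintegral_stageLaw_succ_eval (S : TeamModel N X Y U V W Ω) {K : ℕ}
    (π : ProbabilityMeasure X) (a : ActionMap U S.ψ K) {r : ℕ} (hr : r < K)
    {f : StageData X Y U (r + 1) → ℝ≥0∞} (hf : Measurable f) :
    ∫⁻ s, f s ∂S.stageLaw π a (r + 1) hr =
      ∫⁻ s, ∫⁻ y, ∫⁻ s', f s' ∂S.stageStep s y
        (S.evalControl a hr (Fin.snoc (α := fun _ => ∀ i, Y i) s.2.1 y) s.2.2)
        ∂S.jointChannel s.1 ∂S.stageLaw π a r hr.le := by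
  rw [S.lintegral_stageLaw_succ π a hr hf]
  refine lintegral_congr_ae ?_
  filter_upwards [S.ae_control_eq π a hr] with s hs
  refine lintegral_congr_ae ?_
  filter_upwards [hs] with y hy
  rw [hy]

/-- Integrals over the law of a period are measurable in the action, because that law does not
change when the local maps are replaced by their jointly measurable versions. -/
theorem TeamModel.measurable_lintegral_stageLaw (S : TeamModel N X Y U V W Ω) {K r : ℕ}
    (hr : r ≤ K) {f : (ProbabilityMeasure X × ActionMap U S.ψ K) → StageData X Y U r → ℝ≥0∞}
    (hf : Measurable (Function.uncurry f)) :
    Measurable fun p : ProbabilityMeasure X × ActionMap U S.ψ K =>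
      ∫⁻ s, f p s ∂S.stageLaw p.1 p.2 r hr := by
  induction r with
  | zero =>
    simp_rw [fun p : ProbabilityMeasure X × ActionMap U S.ψ K =>
      S.lintegral_stageLaw_zero p.1 p.2 (hf.of_uncurry_left (x := p))]
    refine measurable_lintegral_param (κ := fun p : ProbabilityMeasure X × ActionMap U S.ψ K =>
      (p.1 : Measure X)) (measurable_subtype_coe.comp measurable_fst)
      (f := fun p x => f p (x, Fin.elim0, Fin.elim0)) ?_
    exact hf.comp (measurable_fst.prodMk (measurable_snd.prodMk measurable_const))
  | succ r ih =>
    simp_rw [fun p : ProbabilityMeasure X × ActionMap U S.ψ K =>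
      S.lintegral_stageLaw_succ_eval p.1 p.2 hr (hf.of_uncurry_left (x := p))]
    have hu : Measurable fun q : ((ProbabilityMeasure X × ActionMap U S.ψ K) ×
        StageData X Y U r) × (∀ i, Y i) => S.evalControl q.1.1.2 hr
          (Fin.snoc (α := fun _ => ∀ i, Y i) q.1.2.2.1 q.2) q.1.2.2.2 :=
      (S.measurable_evalControl hr).comp (measurable_fst.fst.snd.prodMk
        ((measurable_finSnoc measurable_fst.snd.snd.fst measurable_snd).prodMk
          measurable_fst.snd.snd.snd))
    refine ih (Nat.le_of_succ_le hr) (f := fun p s => ∫⁻ y, ∫⁻ s', f p s' ∂S.stageStep s y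
        (S.evalControl p.2 hr (Fin.snoc (α := fun _ => ∀ i, Y i) s.2.1 y) s.2.2)
        ∂S.jointChannel s.1) ?_
    refine measurable_lintegral_param
      (κ := fun q : (ProbabilityMeasure X × ActionMap U S.ψ K) × StageData X Y U r =>
        S.jointChannel q.2.1) (S.measurable_jointChannel.comp measurable_snd.fst) ?_
    refine measurable_lintegral_param
      (κ := fun q : ((ProbabilityMeasure X × ActionMap U S.ψ K) × StageData X Y U r) ×
        (∀ i, Y i) => S.stageStep q.1.2 q.2 (S.evalControl q.1.1.2 hr
          (Fin.snoc (α := fun _ => ∀ i, Y i) q.1.2.2.1 q.2) q.1.2.2.2))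
      (f := fun q s' => f q.1.1 s')
      (S.measurable_stageStep.comp (measurable_fst.snd.prodMk (measurable_snd.prodMk hu))) ?_
    exact hf.comp (measurable_fst.fst.fst.prodMk measurable_snd)

theorem TeamModel.measurable_stageLaw (S : TeamModel N X Y U V W Ω) {K r : ℕ} (hr : r ≤ K) :
    Measurable fun p : ProbabilityMeasure X × ActionMap U S.ψ K => S.stageLaw p.1 p.2 r hr :=
  measurable_of_lintegral fun _ hf => S.measurable_lintegral_stageLaw hr (hf.comp measurable_snd)

/-! ### Generated actions -/

theorem TeamModel.measurable_playTo (S : TeamModel N X Y U V W Ω) {K r : ℕ} (hr : r ≤ K) :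
    Measurable fun p : ActionMap U S.ψ K × (Fin K → ∀ i, Y i) => S.playTo p.1 p.2 r hr := by
  induction r with
  | zero => exact measurable_const
  | succ r ih =>
    refine measurable_finSnoc (ih (Nat.le_of_succ_le hr)) ?_
    refine (S.measurable_evalControl hr).comp
      (f := fun p : ActionMap U S.ψ K × (Fin K → ∀ i, Y i) =>
        (p.1, (fun j : Fin (r + 1) => p.2 (Fin.castLE hr j)),
          S.playTo p.1 p.2 r (Nat.le_of_succ_le hr))) ?_
    exact measurable_fst.prodMk (Measurable.prodMk (by fun_prop) (ih (Nat.le_of_succ_le hr)))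

theorem TeamModel.measurable_play (S : TeamModel N X Y U V W Ω) {K : ℕ} :
    Measurable fun p : ActionMap U S.ψ K × (Fin K → ∀ i, Y i) => S.play p.1 p.2 :=
  S.measurable_playTo le_rfl

/-- Under the law of a period, the actions are almost surely those generated from the measurements
by the measurable versions of the local maps. -/
theorem TeamModel.ae_action_eq_evalControl (S : TeamModel N X Y U V W Ω) {K r : ℕ}
    (π : ProbabilityMeasure X) (a : ActionMap U S.ψ K) (hr : r ≤ K) :
    ∀ᵐ s ∂S.stageLaw π a r hr, ∀ j : Fin r, s.2.2 j = S.evalControl a (j.2.trans_le hr)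
      (fun l => s.2.1 (Fin.castLE j.2 l)) (fun l => s.2.2 (Fin.castLE j.2.le l)) := by
  induction r with
  | zero => exact Filter.Eventually.of_forall fun s j => j.elim0
  | succ r ih =>
    refine S.ae_stageLaw_succ π a hr ?_ ?_
    · rw [Set.ofPred_forall]
      refine MeasurableSet.iInter fun j => measurableSet_eq_fun (by fun_prop) ?_
      refine (S.measurable_evalControl (j.2.trans_le hr)).comp (f := fun s : StageData X Y U (r + 1)
        => (a, (fun l => s.2.1 (Fin.castLE j.2 l)), (fun l => s.2.2 (Fin.castLE j.2.le l)))) ?_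
      fun_prop
    · filter_upwards [ih (Nat.le_of_succ_le hr), S.ae_control_eq π a hr] with s hs1 hs2
      filter_upwards [hs2] with y hy x' j
      induction j using Fin.lastCases with
      | last =>
        simp only [stageSnoc, Fin.snoc_last, hy]
        congr 1
        funext l
        exact (Fin.snoc_castSucc (α := fun _ : Fin (r + 1) => ∀ i, U i) _ _ l).symm
      | cast j =>
        simp only [stageSnoc, Fin.snoc_castSucc, hs1 j]
        congr 1
        · funext l
          exact (Fin.snoc_castSucc (α := fun _ : Fin (r + 1) => ∀ i, Y i) _ _
            (Fin.castLE j.2 l)).symm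
        · funext l
          exact (Fin.snoc_castSucc (α := fun _ : Fin (r + 1) => ∀ i, U i) _ _
            (Fin.castLE j.2.le l)).symm

theorem TeamModel.playTo_eq (S : TeamModel N X Y U V W Ω) {K : ℕ} (a : ActionMap U S.ψ K)
    {ys : Fin K → ∀ i, Y i} {us : Fin K → ∀ i, U i}
    (h : ∀ j : Fin K, us j = S.evalControl a j.2
      (fun l => ys (Fin.castLE j.2 l)) (fun l => us (Fin.castLE j.2.le l))) {r : ℕ} (hr : r ≤ K) :
    S.playTo a ys r hr = fun j => us (Fin.castLE hr j) := by
  induction r with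
  | zero => funext j; exact j.elim0
  | succ r ih =>
    funext j
    rw [TeamModel.playTo]
    induction j using Fin.lastCases with
    | last =>
      simp only [Fin.snoc_last]
      refine Eq.trans ?_ (h ⟨r, hr⟩).symm
      rw [ih (Nat.le_of_succ_le hr)]
      rfl
    | cast j =>
      simp only [Fin.snoc_castSucc]
      rw [ih (Nat.le_of_succ_le hr)]
      rfl

theorem TeamModel.ae_action_eq_play (S : TeamModel N X Y U V W Ω) {K : ℕ}
    (π : ProbabilityMeasure X) (a : ActionMap U S.ψ K) :
    ∀ᵐ s ∂S.stageLaw π a K le_rfl, s.2.2 = S.play a s.2.1 := by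
  filter_upwards [S.ae_action_eq_evalControl π a le_rfl] with s hs
  exact (S.playTo_eq a hs le_rfl).symm

end Model

/-! ### Bayesian updates -/

/-- A map into probability measures is measurable if it is so as a map into measures. -/
theorem measurable_of_coe_probabilityMeasure {α β : Type*} [MeasurableSpace α] [MeasurableSpace β]
    {η : α → ProbabilityMeasure β} (h : Measurable fun a => (η a : Measure β)) : Measurable η :=
  measurable_comap_iff.2 h

theorem measurable_lintegral_probabilityMeasure {α β : Type*} [MeasurableSpace α]
    [MeasurableSpace β] {η : α → ProbabilityMeasure β} (hη : Measurable η) {f : α → β → ℝ≥0∞}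
    (hf : Measurable (Function.uncurry f)) :
    Measurable fun a => ∫⁻ b, f a b ∂(η a : Measure β) :=
  measurable_lintegral_param (κ := fun a => (η a : Measure β)) (measurable_subtype_coe.comp hη) hf

section Model

variable {N : ℕ} {X : Type*} {Y U : Fin N → Type*} {V : Type*} {W : Fin N → Type*} {Ω : Type*}
  [MeasurableSpace X] [∀ i, MeasurableSpace (Y i)] [∀ i, MeasurableSpace (U i)]
  [MeasurableSpace V] [∀ i, MeasurableSpace (W i)] [MeasurableSpace Ω]

/-- The joint likelihood of the measurements `y` of one stage in the state `x`. -/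
noncomputable def TeamModel.likelihood (S : TeamModel N X Y U V W Ω) (x : X) (y : ∀ i, Y i) :
    ℝ≥0∞ :=
  ∏ i, (S.h i x (y i) : ℝ≥0∞)

theorem TeamModel.measurable_likelihood (S : TeamModel N X Y U V W Ω) :
    Measurable fun p : X × (∀ i, Y i) => S.likelihood p.1 p.2 := by
  refine Finset.measurable_prod _ fun i _ => ?_
  exact ((S.measurable_h i).comp (measurable_fst.prodMk
    ((measurable_pi_apply i).comp measurable_snd))).coe_nnreal_ennreal

/-- The normalizing constant of the Bayesian update. -/
noncomputable def TeamModel.evidence (S : TeamModel N X Y U V W Ω) (Z : ProbabilityMeasure X)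
    (y : ∀ i, Y i) : ℝ≥0∞ :=
  ∫⁻ x, S.likelihood x y ∂(Z : Measure X)

theorem TeamModel.measurable_evidence (S : TeamModel N X Y U V W Ω) :
    Measurable fun p : ProbabilityMeasure X × (∀ i, Y i) => S.evidence p.1 p.2 :=
  measurable_lintegral_param (κ := fun p : ProbabilityMeasure X × (∀ i, Y i) => (p.1 : Measure X))
    (measurable_subtype_coe.comp measurable_fst) (f := fun p x => S.likelihood x p.2)
    (S.measurable_likelihood.comp (measurable_snd.prodMk measurable_fst.snd))

/-- The unnormalized predictor after the measurements `y` and the joint action `u`. -/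
noncomputable def TeamModel.unnormalized (S : TeamModel N X Y U V W Ω) (Z : ProbabilityMeasure X)
    (u : ∀ i, U i) (y : ∀ i, Y i) : Measure X :=
  ((Z : Measure X).withDensity fun x => S.likelihood x y).bind fun x => S.transition x u

theorem TeamModel.lintegral_unnormalized (S : TeamModel N X Y U V W Ω) (Z : ProbabilityMeasure X)
    (u : ∀ i, U i) (y : ∀ i, Y i) {f : X → ℝ≥0∞} (hf : Measurable f) :
    ∫⁻ x', f x' ∂S.unnormalized Z u y =
      ∫⁻ x, S.likelihood x y * ∫⁻ x', f x' ∂S.transition x u ∂(Z : Measure X) := by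
  have hT : Measurable fun x => S.transition x u :=
    S.measurable_transition.comp measurable_prodMk_right
  rw [TeamModel.unnormalized, Measure.lintegral_bind hT.aemeasurable hf.aemeasurable,
    lintegral_withDensity_eq_lintegral_mul _ (f := fun x => S.likelihood x y)
      (S.measurable_likelihood.comp measurable_prodMk_right)
      (measurable_lintegral_param hT (f := fun _ x' => f x') (hf.comp measurable_snd))]
  rfl

theorem TeamModel.unnormalized_univ (S : TeamModel N X Y U V W Ω) (Z : ProbabilityMeasure X)
    (u : ∀ i, U i) (y : ∀ i, Y i) : S.unnormalized Z u y Set.univ = S.evidence Z y := by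
  rw [← lintegral_one, S.lintegral_unnormalized Z u y measurable_const]
  simp [TeamModel.evidence]

/-- The update is given by Bayes' formula exactly when the evidence is positive and finite. -/
theorem TeamModel.coe_stepUpdate (S : TeamModel N X Y U V W Ω) (Z : ProbabilityMeasure X)
    (u : ∀ i, U i) (y : ∀ i, Y i) [Decidable (S.evidence Z y = 0 ∨ S.evidence Z y = ∞)] :
    (S.stepUpdate Z u y : Measure X) =
      if S.evidence Z y = 0 ∨ S.evidence Z y = ∞ then (Z : Measure X)
        else (S.evidence Z y)⁻¹ • S.unnormalized Z u y := by
  have hE : ((Z : Measure X).withDensity fun x => S.likelihood x y) Set.univ = S.evidence Z y := by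
    rw [withDensity_apply _ .univ, Measure.restrict_univ]; rfl
  have hm : (((Z : Measure X).withDensity fun x => S.likelihood x y) Set.univ)⁻¹ •
      S.unnormalized Z u y = (S.evidence Z y)⁻¹ • S.unnormalized Z u y := by rw [hE]
  have hp : IsProbabilityMeasure ((((Z : Measure X).withDensity fun x => S.likelihood x y)
      Set.univ)⁻¹ • S.unnormalized Z u y) ↔ ¬ (S.evidence Z y = 0 ∨ S.evidence Z y = ∞) := by
    rw [hm, isProbabilityMeasure_iff, Measure.smul_apply, S.unnormalized_univ, smul_eq_mul]
    refine ⟨?_, fun h => ENNReal.inv_mul_cancel (fun h0 => h (.inl h0)) fun h0 => h (.inr h0)⟩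
    rintro h (h0 | h0) <;> simp [h0] at h
  rw [← hm]
  by_cases h : S.evidence Z y = 0 ∨ S.evidence Z y = ∞
  · rw [if_pos h]
    exact congrArg Subtype.val (dif_neg (fun h' => hp.1 h' h : ¬ IsProbabilityMeasure
      ((((Z : Measure X).withDensity fun x => S.likelihood x y)
      Set.univ)⁻¹ • S.unnormalized Z u y)))
  · rw [if_neg h]
    exact congrArg Subtype.val (dif_pos (hp.2 h))

theorem TeamModel.measurable_stepUpdate (S : TeamModel N X Y U V W Ω) {α : Type*}
    [MeasurableSpace α] {Z : α → ProbabilityMeasure X} {u : α → ∀ i, U i} {y : α → ∀ i, Y i}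
    (hZ : Measurable Z) (hu : Measurable u) (hy : Measurable y) :
    Measurable fun p => S.stepUpdate (Z p) (u p) (y p) := by
  classical
  refine measurable_of_coe_probabilityMeasure ?_
  simp_rw [S.coe_stepUpdate]
  have hE : Measurable fun p : α =>
      S.evidence (Z p) (y p) :=
    S.measurable_evidence.comp (hZ.prodMk hy)
  refine Measurable.ite ((hE (measurableSet_singleton 0)).union (hE (measurableSet_singleton ∞)))
    (measurable_subtype_coe.comp hZ) ?_
  refine measurable_of_lintegral fun f hf => ?_
  simp_rw [lintegral_smul_measure, S.lintegral_unnormalized _ _ _ hf, smul_eq_mul]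
  refine hE.inv.mul (measurable_lintegral_probabilityMeasure
    (η := Z)
    (f := fun p x => S.likelihood x (y p) * ∫⁻ x', f x' ∂S.transition x (u p)) hZ ?_)
  refine (S.measurable_likelihood.comp (measurable_snd.prodMk (hy.comp measurable_fst))).mul ?_
  exact measurable_lintegral_param
    (κ := fun q : α × X =>
      S.transition q.2 (u q.1)) (f := fun _ x' => f x')
    (S.measurable_transition.comp (measurable_snd.prodMk (hu.comp measurable_fst)))
    (hf.comp measurable_snd)

/-- The conditional law of the next state given the measurements of a stage is the Bayesian update,
whatever function of the measurements the joint action is. -/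
theorem TeamModel.lintegral_transition_eq_stepUpdate (S : TeamModel N X Y U V W Ω)
    (Z : ProbabilityMeasure X) {g : (∀ i, Y i) → ∀ i, U i} (hg : Measurable g)
    {F : (∀ i, Y i) → X → ℝ≥0∞} (hF : Measurable (Function.uncurry F)) :
    ∫⁻ x, ∫⁻ y, ∫⁻ x', F y x' ∂S.transition x (g y) ∂S.jointChannel x ∂(Z : Measure X) =
      ∫⁻ x, ∫⁻ y, ∫⁻ x', F y x' ∂(S.stepUpdate Z (g y) y : Measure X) ∂S.jointChannel x
        ∂(Z : Measure X) := by
  -- Both sides become integrals over the reference measure of the measurements.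
  have swap {G : X → (∀ i, Y i) → ℝ≥0∞} (hG : Measurable (Function.uncurry G)) :
      ∫⁻ x, ∫⁻ y, G x y ∂S.jointChannel x ∂(Z : Measure X) =
        ∫⁻ y, ∫⁻ x, S.likelihood x y * G x y ∂(Z : Measure X) ∂S.refLaw := by
    rw [← lintegral_lintegral_swap
      ((S.measurable_likelihood.mul hG).aemeasurable (μ := (Z : Measure X).prod S.refLaw))]
    · refine lintegral_congr fun x => ?_
      rw [S.jointChannel_eq_withDensity]
      exact lintegral_withDensity_eq_lintegral_mul _
        (S.measurable_likelihood.of_uncurry_left (f := S.likelihood)) hG.of_uncurry_left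
  have hE : ∫⁻ y, S.evidence Z y ∂S.refLaw = 1 := by
    have := swap (G := fun _ _ => 1) measurable_const
    simp only [mul_one] at this
    simpa [TeamModel.evidence] using this.symm
  have hEm : Measurable fun y => S.evidence Z y :=
    S.measurable_evidence.comp measurable_prodMk_left
  have hG1 : Measurable (Function.uncurry fun x y => ∫⁻ x', F y x' ∂S.transition x (g y)) :=
    measurable_lintegral_param (κ := fun p : X × (∀ i, Y i) => S.transition p.1 (g p.2))
      (S.measurable_transition.comp (measurable_fst.prodMk (hg.comp measurable_snd)))
      (f := fun p x' => F p.2 x') (hF.comp (measurable_fst.snd.prodMk measurable_snd))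
  have hG2 : Measurable fun y => ∫⁻ x', F y x' ∂(S.stepUpdate Z (g y) y : Measure X) :=
    measurable_lintegral_probabilityMeasure (S.measurable_stepUpdate measurable_const hg
      measurable_id) hF
  rw [swap hG1, swap (G := fun _ y => ∫⁻ x', F y x' ∂(S.stepUpdate Z (g y) y : Measure X))
    (hG2.comp measurable_snd)]
  refine lintegral_congr_ae ?_
  have hfin : ∀ᵐ y ∂S.refLaw, S.evidence Z y < ∞ :=
    ae_lt_top hEm (by rw [hE]; exact ENNReal.one_ne_top)
  filter_upwards [hfin] with y hy
  classical
  have hlik : Measurable fun x => S.likelihood x y :=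
    S.measurable_likelihood.comp measurable_prodMk_right
  rw [lintegral_mul_const _ hlik]
  change _ = S.evidence Z y * _
  rw [S.coe_stepUpdate]
  by_cases h0 : S.evidence Z y = 0
  · have : ∀ᵐ x ∂(Z : Measure X), S.likelihood x y = 0 := (lintegral_eq_zero_iff hlik).1 h0
    rw [h0, zero_mul]
    refine (lintegral_congr_ae ?_).trans lintegral_zero
    filter_upwards [this] with x hx
    rw [hx, zero_mul]
  · rw [if_neg (by simp [h0, hy.ne]), lintegral_smul_measure, smul_eq_mul, ← mul_assoc,
      ENNReal.mul_inv_cancel h0 hy.ne, one_mul, S.lintegral_unnormalized Z _ y hF.of_uncurry_left]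

/-- Bayesian updates along the first `r` stages of a period. -/
noncomputable def TeamModel.updateTo (S : TeamModel N X Y U V W Ω) {r : ℕ}
    (π : ProbabilityMeasure X) (us : Fin r → ∀ i, U i) (ys : Fin r → ∀ i, Y i) :
    ProbabilityMeasure X :=
  Fin.foldl r (fun Z j => S.stepUpdate Z (us j) (ys j)) π

theorem TeamModel.updateTo_snoc (S : TeamModel N X Y U V W Ω) {r : ℕ}
    (π : ProbabilityMeasure X) (us : Fin r → ∀ i, U i) (ys : Fin r → ∀ i, Y i) (u : ∀ i, U i)
    (y : ∀ i, Y i) :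
    S.updateTo π (Fin.snoc (α := fun _ => ∀ i, U i) us u) (Fin.snoc (α := fun _ => ∀ i, Y i) ys y) =
      S.stepUpdate (S.updateTo π us ys) u y := by
  simp [TeamModel.updateTo, Fin.foldl_succ_last]

theorem TeamModel.updateTo_succ (S : TeamModel N X Y U V W Ω) {r : ℕ}
    (π : ProbabilityMeasure X) (us : Fin (r + 1) → ∀ i, U i) (ys : Fin (r + 1) → ∀ i, Y i) :
    S.updateTo π us ys = S.stepUpdate (S.updateTo π (fun j : Fin r => us j.castSucc)
      (fun j : Fin r => ys j.castSucc)) (us (Fin.last r)) (ys (Fin.last r)) :=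
  Fin.foldl_succ_last _ _

theorem TeamModel.measurable_updateTo (S : TeamModel N X Y U V W Ω) {α : Type*}
    [MeasurableSpace α] {r : ℕ} {π : α → ProbabilityMeasure X} {us : α → Fin r → ∀ i, U i}
    {ys : α → Fin r → ∀ i, Y i} (hπ : Measurable π) (hus : Measurable us) (hys : Measurable ys) :
    Measurable fun p => S.updateTo (π p) (us p) (ys p) := by
  induction r with
  | zero => simpa [TeamModel.updateTo] using hπ
  | succ r ih =>
    simp_rw [S.updateTo_succ]
    exact S.measurable_stepUpdate (ih (by fun_prop) (by fun_prop)) (by fun_prop) (by fun_prop)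

theorem TeamModel.measurable_periodUpdate (S : TeamModel N X Y U V W Ω) {α : Type*}
    [MeasurableSpace α] {K : ℕ} {π : α → ProbabilityMeasure X} {us : α → Fin K → ∀ i, U i}
    {ys : α → Fin K → ∀ i, Y i} (hπ : Measurable π) (hus : Measurable us) (hys : Measurable ys) :
    Measurable fun p => S.periodUpdate (π p) (us p) (ys p) :=
  S.measurable_updateTo hπ hus hys

/-- Under the law of a period, the conditional law of the current state given the measurements and
the actions so far is obtained by recursive Bayesian updating. -/
theorem TeamModel.lintegral_stageLaw_eq_updateTo (S : TeamModel N X Y U V W Ω) {K : ℕ}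
    (π : ProbabilityMeasure X) (a : ActionMap U S.ψ K) {r : ℕ} (hr : r ≤ K)
    {f : StageData X Y U r → ℝ≥0∞} (hf : Measurable f) :
    ∫⁻ s, f s ∂S.stageLaw π a r hr =
      ∫⁻ s, ∫⁻ x, f (x, s.2) ∂(S.updateTo π s.2.2 s.2.1 : Measure X) ∂S.stageLaw π a r hr := by
  have hup {r : ℕ} : Measurable fun s : StageData X Y U r => S.updateTo π s.2.2 s.2.1 :=
    S.measurable_updateTo measurable_const measurable_snd.snd measurable_snd.fst
  have hint {r : ℕ} {f : StageData X Y U r → ℝ≥0∞} (hf : Measurable f) :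
      Measurable fun s : StageData X Y U r =>
        ∫⁻ x, f (x, s.2) ∂(S.updateTo π s.2.2 s.2.1 : Measure X) :=
    measurable_lintegral_probabilityMeasure hup (f := fun (s : StageData X Y U r) x => f (x, s.2))
      (hf.comp (measurable_snd.prodMk measurable_fst.snd))
  induction r with
  | zero =>
    rw [S.lintegral_stageLaw_zero π a hf, S.lintegral_stageLaw_zero π a (hint hf)]
    simp [TeamModel.updateTo]
  | succ r ih =>
    have hc := S.measurable_nextControl a (r := r) hr
    have hT {η : StageData X Y U r × (∀ i, Y i) → ProbabilityMeasure X} (hη : Measurable η) :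
        Measurable fun s : StageData X Y U r => ∫⁻ y, ∫⁻ x', f (stageSnoc s y
          (S.nextControl a hr s y) x') ∂(η (s, y) : Measure X) ∂S.jointChannel s.1 := by
      refine measurable_lintegral_param (κ := fun s : StageData X Y U r => S.jointChannel s.1)
        (S.measurable_jointChannel.comp measurable_fst) ?_
      refine measurable_lintegral_probabilityMeasure hη
        (f := fun p x' => f (stageSnoc p.1 p.2 (S.nextControl a hr p.1 p.2) x')) ?_
      exact hf.comp (measurable_stageSnoc measurable_fst.fst measurable_fst.snd
        (hc.comp measurable_fst) measurable_snd)
    let T : StageData X Y U r × (∀ i, Y i) → ProbabilityMeasure X := fun p =>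
      ⟨S.transition p.1.1 (S.nextControl a hr p.1 p.2), inferInstance⟩
    have hTm : Measurable T := Measurable.subtype_mk
      (S.measurable_transition.comp (measurable_fst.fst.prodMk hc))
    let B : StageData X Y U r × (∀ i, Y i) → ProbabilityMeasure X := fun p =>
      S.stepUpdate (S.updateTo π p.1.2.2 p.1.2.1) (S.nextControl a hr p.1 p.2) p.2
    have hBm : Measurable B := S.measurable_stepUpdate
      (S.measurable_updateTo measurable_const measurable_fst.snd.snd measurable_fst.snd.fst) hc
      measurable_snd
    rw [S.lintegral_stageLaw_succ π a hr hf, S.lintegral_stageLaw_succ π a hr (hint hf)]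
    simp_rw [S.lintegral_stageStep _ _ _ hf, S.lintegral_stageStep _ _ _ (hint hf)]
    calc ∫⁻ s, ∫⁻ y, ∫⁻ x', f (stageSnoc s y (S.nextControl a hr s y) x')
          ∂S.transition s.1 (S.nextControl a hr s y) ∂S.jointChannel s.1
          ∂S.stageLaw π a r (Nat.le_of_succ_le hr)
        = ∫⁻ s, ∫⁻ x, ∫⁻ y, ∫⁻ x', f (stageSnoc s y (S.nextControl a hr s y) x')
          ∂S.transition x (S.nextControl a hr s y) ∂S.jointChannel x
          ∂(S.updateTo π s.2.2 s.2.1 : Measure X) ∂S.stageLaw π a r (Nat.le_of_succ_le hr) :=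
          ih (Nat.le_of_succ_le hr) (hT hTm)
      _ = ∫⁻ s, ∫⁻ x, ∫⁻ y, ∫⁻ x', f (stageSnoc s y (S.nextControl a hr s y) x')
          ∂(B (s, y) : Measure X) ∂S.jointChannel x
          ∂(S.updateTo π s.2.2 s.2.1 : Measure X) ∂S.stageLaw π a r (Nat.le_of_succ_le hr) := by
          refine lintegral_congr fun s => ?_
          exact S.lintegral_transition_eq_stepUpdate _ (hc.comp measurable_prodMk_left)
            (F := fun y x' => f (stageSnoc s y (S.nextControl a hr s y) x'))
            (hf.comp (measurable_stageSnoc measurable_const measurable_fst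
              ((hc.comp measurable_prodMk_left).comp measurable_fst) measurable_snd))
      _ = ∫⁻ s, ∫⁻ y, ∫⁻ x', f (stageSnoc s y (S.nextControl a hr s y) x')
          ∂(B (s, y) : Measure X) ∂S.jointChannel s.1
          ∂S.stageLaw π a r (Nat.le_of_succ_le hr) :=
          (ih (Nat.le_of_succ_le hr) (hT hBm)).symm
      _ = _ := by
          refine lintegral_congr fun s => lintegral_congr fun y => ?_
          simp only [stageSnoc, S.updateTo_snoc, lintegral_const, measure_univ, mul_one]
          rfl

end Model

/-! ### Integrals of bounded functions -/

theorem measurable_integral_param {α β : Type*} [MeasurableSpace α] [MeasurableSpace β]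
    {κ : α → Measure β} (hκ : Measurable κ) [h : ∀ a, IsProbabilityMeasure (κ a)] {f : α → β → ℝ}
    (hf : Measurable (Function.uncurry f)) : Measurable fun a => ∫ b, f a b ∂κ a := by
  let η : Kernel α β := ⟨κ, hκ⟩
  have : IsMarkovKernel η := ⟨h⟩
  exact (StronglyMeasurable.integral_kernel_prod_right (κ := η) hf.stronglyMeasurable).measurable

theorem integrable_of_abs_le {α : Type*} [MeasurableSpace α] {μ : Measure α} [IsFiniteMeasure μ]
    {f : α → ℝ} (hf : Measurable f) {C : ℝ} (h : ∀ a, |f a| ≤ C) : Integrable f μ :=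
  Integrable.of_bound hf.aestronglyMeasurable C (Filter.Eventually.of_forall h)

theorem abs_integral_le_of_abs_le {α : Type*} [MeasurableSpace α] {μ : Measure α}
    [IsProbabilityMeasure μ] {f : α → ℝ} {C : ℝ} (h : ∀ a, |f a| ≤ C) : |∫ a, f a ∂μ| ≤ C := by
  simpa using norm_integral_le_of_norm_le_const (μ := μ) (f := f) (Filter.Eventually.of_forall h)

theorem measurable_finFoldl {α β : Type*} [MeasurableSpace α] [MeasurableSpace β] {n : ℕ}
    {G : Fin n → α → β → β} (hG : ∀ j, Measurable (Function.uncurry (G j))) {b : α → β}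
    (hb : Measurable b) : Measurable fun a => Fin.foldl n (fun x j => G j a x) (b a) := by
  induction n with
  | zero => simpa using hb
  | succ n ih =>
    simp_rw [Fin.foldl_succ_last]
    exact (hG (Fin.last n)).comp (measurable_id.prodMk (ih fun j => hG j.castSucc))

section Model

variable {N : ℕ} {X : Type*} {Y U : Fin N → Type*} {V : Type*} {W : Fin N → Type*} {Ω : Type*}
  [MeasurableSpace X] [∀ i, MeasurableSpace (Y i)] [∀ i, MeasurableSpace (U i)]
  [MeasurableSpace V] [∀ i, MeasurableSpace (W i)] [MeasurableSpace Ω]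

/-! ### Stage data with the next measurements, and the cost of a period -/

/-- The joint measurement channel as a kernel from the data before a stage. -/
noncomputable def TeamModel.channelKernel (S : TeamModel N X Y U V W Ω) (r : ℕ) :
    Kernel (StageData X Y U r) (∀ i, Y i) where
  toFun s := S.jointChannel s.1
  measurable' := S.measurable_jointChannel.comp measurable_fst

instance TeamModel.isMarkovKernel_channelKernel (S : TeamModel N X Y U V W Ω) (r : ℕ) :
    IsMarkovKernel (S.channelKernel r) :=
  ⟨fun s => S.isProbabilityMeasure_jointChannel s.1⟩

/-- The joint law of the data before stage `r` of a period and of the measurements at stage `r`. -/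
noncomputable def TeamModel.obsLaw (S : TeamModel N X Y U V W Ω) {K : ℕ} (π : ProbabilityMeasure X)
    (a : ActionMap U S.ψ K) {r : ℕ} (hr : r ≤ K) : Measure (StageData X Y U r × (∀ i, Y i)) :=
  S.stageLaw π a r hr ⊗ₘ S.channelKernel r

instance TeamModel.isProbabilityMeasure_obsLaw (S : TeamModel N X Y U V W Ω) {K : ℕ}
    (π : ProbabilityMeasure X) (a : ActionMap U S.ψ K) {r : ℕ} (hr : r ≤ K) :
    IsProbabilityMeasure (S.obsLaw π a hr) := by
  unfold TeamModel.obsLaw; infer_instance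

theorem TeamModel.lintegral_obsLaw (S : TeamModel N X Y U V W Ω) {K : ℕ} (π : ProbabilityMeasure X)
    (a : ActionMap U S.ψ K) {r : ℕ} (hr : r ≤ K) {f : StageData X Y U r × (∀ i, Y i) → ℝ≥0∞}
    (hf : Measurable f) :
    ∫⁻ p, f p ∂S.obsLaw π a hr =
      ∫⁻ s, ∫⁻ y, f (s, y) ∂S.jointChannel s.1 ∂S.stageLaw π a r hr :=
  Measure.lintegral_compProd hf

theorem TeamModel.stageCost_eq (S : TeamModel N X Y U V W Ω) {K : ℕ} (π : ProbabilityMeasure X)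
    (a : ActionMap U S.ψ K) (r : Fin K) :
    S.stageCost π a r =
      ∫ p, S.c p.1.1 (S.nextControl a r.2 p.1 p.2) ∂S.obsLaw π a r.2.le := by
  obtain ⟨C, hC⟩ := S.bounded_c
  have hm : Measurable fun p : StageData X Y U r × (∀ i, Y i) =>
      S.c p.1.1 (S.nextControl a r.2 p.1 p.2) :=
    S.measurable_c.comp (measurable_fst.fst.prodMk (S.measurable_nextControl a r.2))
  have hi : Integrable (fun p : StageData X Y U r × (∀ i, Y i) =>
      S.c p.1.1 (S.nextControl a r.2 p.1 p.2)) (S.stageLaw π a r r.2.le ⊗ₘ S.channelKernel r) :=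
    integrable_of_abs_le hm fun p => hC _ _
  exact (Measure.integral_compProd hi).symm

theorem TeamModel.abs_stageCost_le (S : TeamModel N X Y U V W Ω) {K : ℕ} {C : ℝ}
    (hC : ∀ x u, |S.c x u| ≤ C) (π : ProbabilityMeasure X) (a : ActionMap U S.ψ K) (r : Fin K) :
    |S.stageCost π a r| ≤ C := by
  rw [S.stageCost_eq]
  exact abs_integral_le_of_abs_le fun p => hC _ _

theorem TeamModel.abs_periodCost_le (S : TeamModel N X Y U V W Ω) (K : ℕ) :
    ∃ C, ∀ (π : ProbabilityMeasure X) (a : ActionMap U S.ψ K), |S.periodCost π a| ≤ C := by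
  obtain ⟨C, hC⟩ := S.bounded_c
  refine ⟨∑ r : Fin K, S.β ^ (r : ℕ) * C, fun π a => ?_⟩
  refine (Finset.abs_sum_le_sum_abs _ _).trans (Finset.sum_le_sum fun r _ => ?_)
  rw [abs_mul, abs_of_nonneg (pow_nonneg S.β_pos.le _)]
  exact mul_le_mul_of_nonneg_left (S.abs_stageCost_le hC π a r) (pow_nonneg S.β_pos.le _)

variable [∀ i, Finite (U i)] [∀ i, MeasurableSingletonClass (U i)] [∀ i, Nonempty (U i)]
  [∀ i, StandardBorelSpace (Y i)]

theorem TeamModel.measurable_obsLaw (S : TeamModel N X Y U V W Ω) {K r : ℕ} (hr : r ≤ K) :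
    Measurable fun p : ProbabilityMeasure X × ActionMap U S.ψ K => S.obsLaw p.1 p.2 hr := by
  refine measurable_of_lintegral fun f hf => ?_
  simp_rw [S.lintegral_obsLaw _ _ hr hf]
  refine S.measurable_lintegral_stageLaw hr (f := fun _ s => ∫⁻ y, f (s, y) ∂S.jointChannel s.1) ?_
  have h := measurable_lintegral_param (κ := fun s : StageData X Y U r => S.jointChannel s.1)
    (S.measurable_jointChannel.comp measurable_fst) (f := fun s y => f (s, y)) hf
  exact h.comp measurable_snd

theorem TeamModel.ae_obsLaw_nextControl_eq (S : TeamModel N X Y U V W Ω) {K : ℕ}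
    (π : ProbabilityMeasure X) (a : ActionMap U S.ψ K) {r : ℕ} (hr : r < K) :
    ∀ᵐ p ∂S.obsLaw π a hr.le, S.nextControl a hr p.1 p.2 =
        S.evalControl a hr (Fin.snoc (α := fun _ => ∀ i, Y i) p.1.2.1 p.2) p.1.2.2 := by
  refine Measure.ae_compProd_of_ae_ae ?_ (S.ae_control_eq π a hr)
  refine measurableSet_eq_fun (S.measurable_nextControl a hr) ?_
  exact (S.measurable_evalControl hr).comp (measurable_const.prodMk
    ((measurable_finSnoc measurable_fst.snd.fst measurable_snd).prodMk measurable_fst.snd.snd))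

theorem TeamModel.measurable_stageCost (S : TeamModel N X Y U V W Ω) {K : ℕ} (r : Fin K) :
    Measurable fun p : ProbabilityMeasure X × ActionMap U S.ψ K => S.stageCost p.1 p.2 r := by
  have h (p : ProbabilityMeasure X × ActionMap U S.ψ K) : S.stageCost p.1 p.2 r =
      ∫ s, S.c s.1.1 (S.evalControl p.2 r.2 (Fin.snoc (α := fun _ => ∀ i, Y i) s.1.2.1 s.2)
        s.1.2.2) ∂S.obsLaw p.1 p.2 r.2.le := by
    rw [S.stageCost_eq]
    refine integral_congr_ae ?_
    filter_upwards [S.ae_obsLaw_nextControl_eq p.1 p.2 r.2] with s hs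
    rw [hs]
  simp_rw [h]
  refine measurable_integral_param (κ := fun p : ProbabilityMeasure X × ActionMap U S.ψ K =>
    S.obsLaw p.1 p.2 r.2.le) (S.measurable_obsLaw r.2.le) ?_
  exact S.measurable_c.comp (measurable_snd.fst.fst.prodMk ((S.measurable_evalControl r.2).comp
    (measurable_fst.snd.prodMk
      ((measurable_finSnoc measurable_snd.fst.snd.fst measurable_snd.snd).prodMk
        measurable_snd.fst.snd.snd))))

theorem TeamModel.measurable_periodCost (S : TeamModel N X Y U V W Ω) (K : ℕ) :
    Measurable fun p : ProbabilityMeasure X × ActionMap U S.ψ K => S.periodCost p.1 p.2 :=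
  Finset.measurable_sum _ fun r _ => (S.measurable_stageCost r).const_mul _

/-! ### The kernels of the two decision processes -/

/-- The update of the predictor along a period with actions generated from the measurements. -/
noncomputable def TeamModel.playUpdate (S : TeamModel N X Y U V W Ω) {K : ℕ}
    (π : ProbabilityMeasure X) (a : ActionMap U S.ψ K) (y : Fin K → ∀ i, Y i) :
    ProbabilityMeasure X :=
  S.periodUpdate π (S.play a y) y

theorem TeamModel.measurable_playUpdate (S : TeamModel N X Y U V W Ω) {α : Type*}
    [MeasurableSpace α] {K : ℕ} {π : α → ProbabilityMeasure X} {a : α → ActionMap U S.ψ K}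
    {y : α → Fin K → ∀ i, Y i} (hπ : Measurable π) (ha : Measurable a) (hy : Measurable y) :
    Measurable fun p => S.playUpdate (π p) (a p) (y p) :=
  S.measurable_periodUpdate hπ (S.measurable_play.comp (ha.prodMk hy)) hy

theorem TeamModel.measurable_filter (S : TeamModel N X Y U V W Ω) (K M : ℕ) :
    Measurable (S.filter : WindowState S K M → ProbabilityMeasure X) := by
  refine measurable_finFoldl (G := fun j (z : WindowState S K M) π =>
    S.playUpdate π (z.2.2 j) (z.2.1 j)) (fun j => ?_) measurable_fst
  exact S.measurable_playUpdate measurable_snd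
    ((measurable_pi_apply j).comp measurable_fst.snd.snd)
    ((measurable_pi_apply j).comp measurable_fst.snd.fst)

theorem TeamModel.measurable_windowStep (S : TeamModel N X Y U V W Ω) {α : Type*}
    [MeasurableSpace α] {K M : ℕ} [NeZero M] {z : α → WindowState S K M}
    {a : α → ActionMap U S.ψ K} {y : α → Fin K → ∀ i, Y i} (hz : Measurable z)
    (ha : Measurable a) (hy : Measurable y) :
    Measurable fun p => S.windowStep (z p) (a p) (y p) := by
  refine Measurable.prodMk ?_ (Measurable.prodMk (measurable_pi_iff.2 fun j => ?_)
    (measurable_pi_iff.2 fun j => ?_))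
  · exact S.measurable_playUpdate hz.fst ((measurable_pi_apply 0).comp hz.snd.snd)
      ((measurable_pi_apply 0).comp hz.snd.fst)
  · by_cases hj : (j : ℕ) + 1 < M
    · simp only [hj, dif_pos]
      exact (measurable_pi_apply _).comp hz.snd.fst
    · simp only [hj, dif_neg, not_false_eq_true]
      exact hy
  · by_cases hj : (j : ℕ) + 1 < M
    · simp only [hj, dif_pos]
      exact (measurable_pi_apply _).comp hz.snd.snd
    · simp only [hj, dif_neg, not_false_eq_true]
      exact ha

/-- The kernel of the centralized reduction. -/
noncomputable def TeamModel.beliefKernel (S : TeamModel N X Y U V W Ω) (K : ℕ) :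
    Kernel (ProbabilityMeasure X × ActionMap U S.ψ K) (ProbabilityMeasure X) where
  toFun p := S.beliefTransition p.1 p.2
  measurable' := measurable_map_param'
    (κ := fun p : ProbabilityMeasure X × ActionMap U S.ψ K => S.stageLaw p.1 p.2 K le_rfl)
    (S.measurable_stageLaw le_rfl)
    (S.measurable_periodUpdate measurable_fst.fst measurable_snd.snd.snd measurable_snd.snd.fst)

instance TeamModel.isMarkovKernel_beliefKernel (S : TeamModel N X Y U V W Ω) (K : ℕ) :
    IsMarkovKernel (S.beliefKernel K) :=
  ⟨fun _ => Measure.isProbabilityMeasure_map (S.measurable_periodUpdate measurable_const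
    measurable_snd.snd measurable_snd.fst).aemeasurable⟩

/-- The kernel of the window process. -/
noncomputable def TeamModel.windowKernel (S : TeamModel N X Y U V W Ω) (K M : ℕ) [NeZero M] :
    Kernel (WindowState S K M × ActionMap U S.ψ K) (WindowState S K M) where
  toFun p := S.windowTransition p.1 p.2
  measurable' := measurable_map_param'
    (κ := fun p : WindowState S K M × ActionMap U S.ψ K =>
      S.stageLaw (S.filter p.1) p.2 K le_rfl)
    ((S.measurable_stageLaw le_rfl).comp (f := fun p : WindowState S K M × ActionMap U S.ψ K =>
      (S.filter p.1, p.2)) (((S.measurable_filter K M).comp measurable_fst).prodMk measurable_snd))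
    (F := fun p s => S.windowStep p.1 p.2 s.2.1)
    (S.measurable_windowStep measurable_fst.fst measurable_fst.snd measurable_snd.snd.fst)

theorem TeamModel.measurable_windowStep_data (S : TeamModel N X Y U V W Ω) {K M : ℕ} [NeZero M]
    (z : WindowState S K M) (a : ActionMap U S.ψ K) :
    Measurable fun s : StageData X Y U K => S.windowStep z a s.2.1 :=
  S.measurable_windowStep measurable_const measurable_const measurable_snd.fst

instance TeamModel.isMarkovKernel_windowKernel (S : TeamModel N X Y U V W Ω) (K M : ℕ) [NeZero M] :
    IsMarkovKernel (S.windowKernel K M) :=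
  ⟨fun p => Measure.isProbabilityMeasure_map (S.measurable_windowStep_data p.1 p.2).aemeasurable⟩

theorem TeamModel.measurable_windowCost (S : TeamModel N X Y U V W Ω) (K M : ℕ) :
    Measurable fun p : WindowState S K M × ActionMap U S.ψ K => S.windowCost p.1 p.2 :=
  (S.measurable_periodCost K).comp
    (((S.measurable_filter K M).comp measurable_fst).prodMk measurable_snd)

/-- Shifting the window by one period applies one more period update to the filter. -/
theorem TeamModel.filter_windowStep (S : TeamModel N X Y U V W Ω) {K M : ℕ} [NeZero M]
    (z : WindowState S K M) (a : ActionMap U S.ψ K) (y : Fin K → ∀ i, Y i) :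
    S.filter (S.windowStep z a y) = S.playUpdate (S.filter z) a y := by
  obtain ⟨m, rfl⟩ : ∃ m, M = m + 1 := ⟨M - 1, (Nat.succ_pred_eq_of_pos (NeZero.pos M)).symm⟩
  have h1 : S.filter (S.windowStep z a y) = S.playUpdate (Fin.foldl m (fun π j =>
      S.playUpdate π (z.2.2 j.succ) (z.2.1 j.succ)) (S.playUpdate z.1 (z.2.2 0) (z.2.1 0)))
        a y := by
    rw [TeamModel.filter, Fin.foldl_succ_last]
    have hlast : ¬ ((Fin.last m : Fin (m + 1)) : ℕ) + 1 < m + 1 := by simp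
    have hcast (j : Fin m) : ((j.castSucc : Fin (m + 1)) : ℕ) + 1 < m + 1 := by simp
    simp only [TeamModel.windowStep, hlast, hcast, dif_pos, dif_neg, not_false_eq_true]
    rfl
  rw [h1, TeamModel.filter, Fin.foldl_succ]
  rfl

/-- The filter maps the window process to the predictor process. -/
theorem TeamModel.map_filter_windowKernel (S : TeamModel N X Y U V W Ω) (K M : ℕ) [NeZero M]
    (z : WindowState S K M) (a : ActionMap U S.ψ K) :
    (S.windowKernel K M (z, a)).map S.filter = S.beliefKernel K (S.filter z, a) := by
  change ((S.stageLaw (S.filter z) a K le_rfl).map _).map S.filter =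
    (S.stageLaw (S.filter z) a K le_rfl).map _
  rw [Measure.map_map (S.measurable_filter K M) (S.measurable_windowStep_data z a)]
  refine Measure.map_congr ?_
  filter_upwards [S.ae_action_eq_play (S.filter z) a] with s hs
  simp only [Function.comp_apply, S.filter_windowStep, TeamModel.playUpdate, hs]

theorem TeamModel.beliefKernel_apply (S : TeamModel N X Y U V W Ω) {K : ℕ}
    (π : ProbabilityMeasure X) (a : ActionMap U S.ψ K) : S.beliefKernel K (π, a) =
      (S.stageLaw π a K le_rfl).map fun s => S.playUpdate π a s.2.1 := by
  refine Measure.map_congr ?_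
  filter_upwards [S.ae_action_eq_play π a] with s hs
  rw [hs]
  rfl

end Model

section Model

variable {N : ℕ} {X : Type*} {Y U : Fin N → Type*} {V : Type*} {W : Fin N → Type*} {Ω : Type*}
  [MeasurableSpace X] [∀ i, MeasurableSpace (Y i)] [∀ i, MeasurableSpace (U i)]
  [MeasurableSpace V] [∀ i, MeasurableSpace (W i)] [MeasurableSpace Ω]

/-! ### Independence of the noises -/

/-- The indices of the primitive random variables that are realized before time `t`. -/
def pastIndex (N t : ℕ) : Set (Unit ⊕ ℕ ⊕ (Fin N × ℕ))
  | .inl _ => True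
  | .inr (.inl s) => s < t
  | .inr (.inr p) => p.2 < t

/-- The σ-algebra generated by the initial state and the noises before time `t`. -/
@[reducible] def TeamModel.pastNoise (S : TeamModel N X Y U V W Ω) (t : ℕ) : MeasurableSpace Ω :=
  ⨆ k ∈ pastIndex N t, noiseSigma S.x₀ S.v S.w k

theorem TeamModel.noiseSigma_le (S : TeamModel N X Y U V W Ω) (k : Unit ⊕ ℕ ⊕ (Fin N × ℕ)) :
    noiseSigma S.x₀ S.v S.w k ≤ ‹MeasurableSpace Ω› := by
  rcases k with k | k | k
  · exact S.measurable_x₀.comap_le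
  · exact (S.measurable_v k).comap_le
  · exact (S.measurable_w k.1 k.2).comap_le

theorem TeamModel.pastNoise_le (S : TeamModel N X Y U V W Ω) (t : ℕ) :
    S.pastNoise t ≤ ‹MeasurableSpace Ω› :=
  iSup₂_le fun k _ => S.noiseSigma_le k

theorem TeamModel.measurable_noise (S : TeamModel N X Y U V W Ω) (t : ℕ) :
    Measurable fun ω i => S.w i t ω :=
  measurable_pi_iff.2 fun i => S.measurable_w i t

theorem TeamModel.map_noise (S : TeamModel N X Y U V W Ω) (t : ℕ) :
    S.P.map (fun ω i => S.w i t ω) = S.noiseLaw := by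
  have h : iIndepFun (fun i => S.w i t) S.P := by
    rw [iIndepFun_iff_iIndep]
    exact S.indep.precomp (g := fun i => Sum.inr (Sum.inr (i, t)))
      fun i j hij => by simpa using hij
  rw [h.map_fun_eq_pi_map fun i => (S.measurable_w i t).aemeasurable, TeamModel.noiseLaw]
  congr 1
  funext i
  exact S.identDistrib_w i t

instance TeamModel.isProbabilityMeasure_map_v (S : TeamModel N X Y U V W Ω) (t : ℕ) :
    IsProbabilityMeasure (S.P.map (S.v t)) :=
  Measure.isProbabilityMeasure_map (S.measurable_v t).aemeasurable

/-- The noises at time `t` are independent of the past, of each other, and have their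
stationary laws. -/
theorem TeamModel.lintegral_noise (S : TeamModel N X Y U V W Ω) {α : Type*} [MeasurableSpace α]
    {t : ℕ} {A : Ω → α} (hA : Measurable[S.pastNoise t] A)
    {f : α → (∀ i, W i) → V → ℝ≥0∞}
    (hf : Measurable fun p : α × (∀ i, W i) × V => f p.1 p.2.1 p.2.2) :
    ∫⁻ ω, f (A ω) (fun i => S.w i t ω) (S.v t ω) ∂S.P =
      ∫⁻ ω, ∫⁻ w, ∫⁻ v, f (A ω) w v ∂(S.P.map (S.v 0)) ∂S.noiseLaw ∂S.P := by
  have hAm : Measurable A := hA.mono (S.pastNoise_le t) le_rfl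
  have hwm := S.measurable_noise t
  have hvm := S.measurable_v t
  let Bw : Set (Unit ⊕ ℕ ⊕ (Fin N × ℕ)) := Set.range fun i : Fin N => Sum.inr (Sum.inr (i, t))
  let Bv : Set (Unit ⊕ ℕ ⊕ (Fin N × ℕ)) := {Sum.inr (Sum.inl t)}
  have hsub {k} {T : Set (Unit ⊕ ℕ ⊕ (Fin N × ℕ))} (hk : k ∈ T) :
      noiseSigma S.x₀ S.v S.w k ≤ ⨆ k ∈ T, noiseSigma S.x₀ S.v S.w k :=
    le_iSup₂ (f := fun k (_ : k ∈ T) => noiseSigma S.x₀ S.v S.w k) k hk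
  have hwB {T : Set (Unit ⊕ ℕ ⊕ (Fin N × ℕ))} (hT : Bw ⊆ T) :
      Measurable[⨆ k ∈ T, noiseSigma S.x₀ S.v S.w k] fun ω i => S.w i t ω := by
    refine @measurable_pi_lambda _ _ _ (_) _ _ fun i => ?_
    exact (comap_measurable _).mono (hsub (hT ⟨i, rfl⟩)) le_rfl
  have hvB {T : Set (Unit ⊕ ℕ ⊕ (Fin N × ℕ))} (hT : Bv ⊆ T) :
      Measurable[⨆ k ∈ T, noiseSigma S.x₀ S.v S.w k] (S.v t) :=
    (comap_measurable _).mono (hsub (hT rfl)) le_rfl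
  have hd1 : Disjoint (pastIndex N t) (Bw ∪ Bv) := by
    rw [Set.disjoint_left]
    rintro k hk (⟨i, rfl⟩ | rfl)
    · exact lt_irrefl t hk
    · exact lt_irrefl t hk
  have hd2 : Disjoint Bw Bv := by
    rw [Set.disjoint_left]
    rintro k ⟨i, rfl⟩ hk
    simp [Bv] at hk
  have hi1 : IndepFun A (fun ω => ((fun i => S.w i t ω), S.v t ω)) S.P := by
    rw [IndepFun_iff_Indep]
    refine indep_of_indep_of_le_left (indep_of_indep_of_le_right
      (indep_iSup_of_disjoint S.noiseSigma_le S.indep hd1) ?_) hA.comap_le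
    exact (Measurable.prodMk (hwB Set.subset_union_left) (hvB Set.subset_union_right)).comap_le
  have hi2 : IndepFun (fun ω i => S.w i t ω) (S.v t) S.P := by
    rw [IndepFun_iff_Indep]
    exact indep_of_indep_of_le_left (indep_of_indep_of_le_right
      (indep_iSup_of_disjoint S.noiseSigma_le S.indep hd2) (hvB subset_rfl).comap_le)
      (hwB subset_rfl).comap_le
  have hmap : S.P.map (fun ω => (A ω, (fun i => S.w i t ω), S.v t ω)) =
      (S.P.map A).prod (S.noiseLaw.prod (S.P.map (S.v 0))) := by
    rw [(indepFun_iff_map_prod_eq_prod_map_map hAm.aemeasurable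
      (hwm.prodMk hvm).aemeasurable).1 hi1, (indepFun_iff_map_prod_eq_prod_map_map
      hwm.aemeasurable hvm.aemeasurable).1 hi2, S.map_noise, S.identDistrib_v t]
  have h1 := lintegral_map (μ := S.P) hf (hAm.prodMk (hwm.prodMk hvm))
  rw [← h1, hmap, lintegral_prod _ hf.aemeasurable]
  have hm2 : Measurable fun a => ∫⁻ w, ∫⁻ v, f a w v ∂(S.P.map (S.v 0)) ∂S.noiseLaw := by
    refine Measurable.lintegral_prod_right (f := fun a w => ∫⁻ v, f a w v ∂(S.P.map (S.v 0))) ?_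
    refine Measurable.lintegral_prod_right (f := fun (p : α × (∀ i, W i)) v => f p.1 p.2 v) ?_
    exact hf.comp (measurable_fst.fst.prodMk (measurable_fst.snd.prodMk measurable_snd))
  rw [← lintegral_map hm2 hAm]
  refine lintegral_congr fun a => ?_
  exact lintegral_prod (fun p : (∀ i, W i) × V => f a p.1 p.2)
    (hf.comp measurable_prodMk_left).aemeasurable

/-! ### Measurability of the closed-loop processes -/

theorem TeamModel.runPeriod_succ (S : TeamModel N X Y U V W Ω) {K : ℕ} (a : ActionMap U S.ψ K)
    (q : ℕ) (ω : Ω) (x : X) {r : ℕ} (hr : r < K) :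
    S.runPeriod a q ω x (r + 1) hr =
      stageSnoc (S.runPeriod a q ω x r hr.le)
        (fun i => S.φ i (S.runPeriod a q ω x r hr.le).1 (S.w i (q * K + r) ω))
        (S.nextControl a hr (S.runPeriod a q ω x r hr.le)
          fun i => S.φ i (S.runPeriod a q ω x r hr.le).1 (S.w i (q * K + r) ω))
        (S.Φ (S.runPeriod a q ω x r hr.le).1
          (S.nextControl a hr (S.runPeriod a q ω x r hr.le)
            fun i => S.φ i (S.runPeriod a q ω x r hr.le).1 (S.w i (q * K + r) ω))
          (S.v (q * K + r) ω)) :=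
  rfl

theorem TeamModel.measurable_policyControl (S : TeamModel N X Y U V W Ω) {K : ℕ}
    (γ : TeamPolicy S K) {α : Type*} [MeasurableSpace α] {q r : ℕ} (hr : r < K)
    {I : α → CommonInfo Y U K q} {s : α → StageData X Y U r} {y : α → ∀ i, Y i}
    (hI : Measurable I) (hs : Measurable s) (hy : Measurable y) :
    Measurable fun p => S.nextControl (γ.act q (I p)) hr (s p) (y p) := by
  refine measurable_pi_iff.2 fun i => (γ.measurable_act q i ⟨r, hr⟩).comp (hI.prodMk ?_)
  have h1 := measurable_finSnoc hs.snd.fst hy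
  have h2 := hs.snd.snd
  exact Measurable.prodMk (by fun_prop) (by fun_prop)

theorem TeamModel.measurable_observe (S : TeamModel N X Y U V W Ω) {α : Type*} [MeasurableSpace α]
    {x : α → X} {w : α → ∀ i, W i} (hx : Measurable x) (hw : Measurable w) :
    Measurable fun p i => S.φ i (x p) (w p i) :=
  measurable_pi_iff.2 fun i =>
    (S.measurable_φ i).comp (hx.prodMk ((measurable_pi_apply i).comp hw))

/-- The σ-algebra on the domain `α` of `e` is arbitrary, so that with `e = id` this also covers
measurability with respect to the noises before a given time. -/
theorem TeamModel.measurable_runPeriod (S : TeamModel N X Y U V W Ω) {K : ℕ}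
    (γ : TeamPolicy S K) {α : Type*} [MeasurableSpace α] {e : α → Ω} {q r : ℕ} (hr : r ≤ K)
    {I : α → CommonInfo Y U K q} {x : α → X} (hI : Measurable I) (hx : Measurable x)
    (hv : ∀ s < q * K + r, Measurable fun p => S.v s (e p))
    (hw : ∀ i, ∀ s < q * K + r, Measurable fun p => S.w i s (e p)) :
    Measurable fun p => S.runPeriod (γ.act q (I p)) q (e p) (x p) r hr := by
  induction r with
  | zero => exact hx.prodMk measurable_const
  | succ r ih =>
    have hs := ih (Nat.le_of_succ_le hr) (fun s h => hv s (by omega))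
      (fun i s h => hw i s (by omega))
    have hy := S.measurable_observe hs.fst
      (measurable_pi_iff.2 fun i => hw i (q * K + r) (by omega))
    have hu := S.measurable_policyControl γ hr hI hs hy
    simp_rw [fun p => S.runPeriod_succ (γ.act q (I p)) q (e p) (x p) hr]
    exact measurable_stageSnoc hs hy hu
      (S.measurable_Φ.comp (hs.fst.prodMk (hu.prodMk (hv (q * K + r) (by omega)))))

theorem TeamModel.measurable_history_comp (S : TeamModel N X Y U V W Ω) {K : ℕ}
    (γ : TeamPolicy S K) {α : Type*} [MeasurableSpace α] {e : α → Ω} {q : ℕ}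
    (hx : Measurable fun p => S.x₀ (e p))
    (hv : ∀ s < q * K, Measurable fun p => S.v s (e p))
    (hw : ∀ i, ∀ s < q * K, Measurable fun p => S.w i s (e p)) :
    Measurable fun p => S.history γ (e p) q := by
  induction q with
  | zero => exact hx.prodMk measurable_const
  | succ q ih =>
    have hle : (q + 1) * K = q * K + K := Nat.succ_mul q K
    have hs := ih (fun s h => hv s (by omega)) (fun i s h => hw i s (by omega))
    have hb := S.measurable_runPeriod γ (le_refl K) hs.snd hs.fst (fun s h => hv s (by omega))
      (fun i s h => hw i s (by omega))
    exact hb.fst.prodMk ((measurable_finSnoc hs.snd.fst hb.snd.fst).prodMk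
      (measurable_finSnoc hs.snd.snd hb.snd.snd))

/-- The closed-loop system does not anticipate the noises. -/
theorem TeamModel.measurable_past (S : TeamModel N X Y U V W Ω) {K : ℕ} (γ : TeamPolicy S K)
    (q : ℕ) {r : ℕ} (hr : r ≤ K) :
    Measurable[S.pastNoise (q * K + r)] fun ω =>
      (S.history γ ω q, S.period γ q ω r hr) := by
  have hsub {k} (hk : k ∈ pastIndex N (q * K + r)) :
      noiseSigma S.x₀ S.v S.w k ≤ S.pastNoise (q * K + r) :=
    le_iSup₂ (f := fun k (_ : k ∈ pastIndex N (q * K + r)) => noiseSigma S.x₀ S.v S.w k) k hk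
  have hx : Measurable[S.pastNoise (q * K + r)] S.x₀ :=
    (comap_measurable _).mono (hsub (k := .inl ()) trivial) le_rfl
  have hv (s : ℕ) (hs : s < q * K + r) : Measurable[S.pastNoise (q * K + r)] (S.v s) :=
    (comap_measurable _).mono (hsub (k := .inr (.inl s)) hs) le_rfl
  have hw (i : Fin N) (s : ℕ) (hs : s < q * K + r) :
      Measurable[S.pastNoise (q * K + r)] (S.w i s) :=
    (comap_measurable _).mono (hsub (k := .inr (.inr (i, s))) hs) le_rfl
  have hH := @TeamModel.measurable_history_comp N X Y U V W Ω _ _ _ _ _ _ S K γ Ω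
    (S.pastNoise (q * K + r)) id q hx (fun s h => hv s (by omega)) (fun i s h => hw i s (by omega))
  have hR := @TeamModel.measurable_runPeriod N X Y U V W Ω _ _ _ _ _ _ S K γ Ω
    (S.pastNoise (q * K + r)) id q r hr _ _ (Measurable.snd hH) (Measurable.fst hH) hv hw
  exact Measurable.prodMk hH hR

theorem TeamModel.measurable_history (S : TeamModel N X Y U V W Ω) {K : ℕ} (γ : TeamPolicy S K)
    (q : ℕ) : Measurable fun ω => S.history γ ω q :=
  S.measurable_history_comp γ (e := id) S.measurable_x₀ (fun s _ => S.measurable_v s)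
    (fun i s _ => S.measurable_w i s)

theorem TeamModel.measurable_period (S : TeamModel N X Y U V W Ω) {K : ℕ} (γ : TeamPolicy S K)
    (q : ℕ) {r : ℕ} (hr : r ≤ K) : Measurable fun ω => S.period γ q ω r hr :=
  S.measurable_runPeriod γ (e := id) hr (S.measurable_history γ q).snd
    (S.measurable_history γ q).fst (fun s _ => S.measurable_v s) (fun i s _ => S.measurable_w i s)

/-! ### The law of a period in closed loop -/

/-- One stage driven by fresh noises has the law prescribed by the channels and the transition
kernel. -/
theorem TeamModel.lintegral_stage_noise (S : TeamModel N X Y U V W Ω) {r : ℕ}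
    (s : StageData X Y U r) {c : (∀ i, Y i) → ∀ i, U i} (hc : Measurable c)
    {f : StageData X Y U (r + 1) → ℝ≥0∞} (hf : Measurable f) :
    ∫⁻ w, ∫⁻ v, f (stageSnoc s (fun i => S.φ i s.1 (w i)) (c fun i => S.φ i s.1 (w i))
        (S.Φ s.1 (c fun i => S.φ i s.1 (w i)) v)) ∂(S.P.map (S.v 0)) ∂S.noiseLaw =
      ∫⁻ y, ∫⁻ s', f s' ∂S.stageStep s y (c y) ∂S.jointChannel s.1 := by
  have hΦ (u : ∀ i, U i) : Measurable fun v => S.Φ s.1 u v :=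
    S.measurable_Φ.comp (measurable_const.prodMk (measurable_const.prodMk measurable_id))
  have hT (u : ∀ i, U i) : S.transition s.1 u = (S.P.map (S.v 0)).map fun v => S.Φ s.1 u v := by
    rw [Measure.map_map (hΦ u) (S.measurable_v 0)]; rfl
  have hm : Measurable fun y => ∫⁻ s', f s' ∂S.stageStep s y (c y) :=
    measurable_lintegral_param (κ := fun y => S.stageStep s y (c y)) (f := fun _ s' => f s')
      (S.measurable_stageStep.comp (measurable_const.prodMk (measurable_id.prodMk hc)))
      (hf.comp measurable_snd)
  have hobs : Measurable fun (w : ∀ i, W i) i => S.φ i s.1 (w i) :=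
    S.measurable_observe measurable_const measurable_id
  rw [S.jointChannel_eq_map, lintegral_map hm hobs]
  refine lintegral_congr fun w => ?_
  rw [S.lintegral_stageStep _ _ _ hf, hT, lintegral_map _ (hΦ _)]
  exact hf.comp (measurable_stageSnoc measurable_const measurable_const measurable_const
    measurable_id)

/-- Given the state and the common information at its beginning, a period of the closed-loop
system has the law of a period started from that state. -/
theorem TeamModel.lintegral_period_diracLaw (S : TeamModel N X Y U V W Ω) {K : ℕ}
    (γ : TeamPolicy S K) (q : ℕ) {r : ℕ} (hr : r ≤ K)
    {f : X × CommonInfo Y U K q → StageData X Y U r → ℝ≥0∞}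
    (hf : Measurable (Function.uncurry f)) :
    ∫⁻ ω, f (S.history γ ω q) (S.period γ q ω r hr) ∂S.P =
      ∫⁻ ω, ∫⁻ s, f (S.history γ ω q) s
        ∂S.stageLaw (diracLaw (S.history γ ω q).1) (S.action γ q ω) r hr ∂S.P := by
  induction r with
  | zero =>
    refine lintegral_congr fun ω => ?_
    rw [S.lintegral_stageLaw_zero _ _ hf.of_uncurry_left]
    have hm : Measurable fun x => f (S.history γ ω q) (x, Fin.elim0, Fin.elim0) :=
      hf.of_uncurry_left.comp (measurable_id.prodMk measurable_const)
    exact (lintegral_dirac' _ hm).symm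
  | succ r ih =>
    let g : X × CommonInfo Y U K q → StageData X Y U r → ℝ≥0∞ := fun H s =>
      ∫⁻ y, ∫⁻ s', f H s' ∂S.stageStep s y (S.nextControl (γ.act q H.2) hr s y)
        ∂S.jointChannel s.1
    have hg : Measurable (Function.uncurry g) := by
      refine measurable_lintegral_param
        (κ := fun p : (X × CommonInfo Y U K q) × StageData X Y U r => S.jointChannel p.2.1)
        (S.measurable_jointChannel.comp measurable_snd.fst) ?_
      refine measurable_lintegral_param
        (κ := fun p : ((X × CommonInfo Y U K q) × StageData X Y U r) × (∀ i, Y i) =>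
          S.stageStep p.1.2 p.2 (S.nextControl (γ.act q p.1.1.2) hr p.1.2 p.2))
        (f := fun p s' => f p.1.1 s')
        (S.measurable_stageStep.comp (measurable_fst.snd.prodMk (measurable_snd.prodMk
          (S.measurable_policyControl γ hr measurable_fst.fst.snd measurable_fst.snd
            measurable_snd)))) ?_
      exact hf.comp (measurable_fst.fst.fst.prodMk measurable_snd)
    have hind := S.lintegral_noise (S.measurable_past γ q (Nat.le_of_succ_le hr))
      (f := fun p w v => f p.1 (stageSnoc p.2 (fun i => S.φ i p.2.1 (w i))
        (S.nextControl (γ.act q p.1.2) hr p.2 fun i => S.φ i p.2.1 (w i))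
        (S.Φ p.2.1 (S.nextControl (γ.act q p.1.2) hr p.2 fun i => S.φ i p.2.1 (w i)) v))) (by
        have hy := S.measurable_observe (α := ((X × CommonInfo Y U K q) × StageData X Y U r) ×
          (∀ i, W i) × V) (x := fun p => p.1.2.1) (w := fun p => p.2.1) measurable_fst.snd.fst
          measurable_snd.fst
        have hu := S.measurable_policyControl γ hr (α := ((X × CommonInfo Y U K q) ×
          StageData X Y U r) × (∀ i, W i) × V) (I := fun p => p.1.1.2) (s := fun p => p.1.2)
          measurable_fst.fst.snd measurable_fst.snd hy
        exact hf.comp (measurable_fst.fst.prodMk (measurable_stageSnoc measurable_fst.snd hy hu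
          (S.measurable_Φ.comp (measurable_fst.snd.fst.prodMk
            (hu.prodMk measurable_snd.snd))))))
    refine hind.trans ?_
    have h1 : ∀ ω, ∫⁻ w, ∫⁻ v, f (S.history γ ω q)
        (stageSnoc (S.period γ q ω r (Nat.le_of_succ_le hr))
          (fun i => S.φ i (S.period γ q ω r (Nat.le_of_succ_le hr)).1 (w i))
          (S.nextControl (γ.act q (S.history γ ω q).2) hr
            (S.period γ q ω r (Nat.le_of_succ_le hr))
            fun i => S.φ i (S.period γ q ω r (Nat.le_of_succ_le hr)).1 (w i))
          (S.Φ (S.period γ q ω r (Nat.le_of_succ_le hr)).1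
            (S.nextControl (γ.act q (S.history γ ω q).2) hr
              (S.period γ q ω r (Nat.le_of_succ_le hr))
              fun i => S.φ i (S.period γ q ω r (Nat.le_of_succ_le hr)).1 (w i)) v))
          ∂(S.P.map (S.v 0)) ∂S.noiseLaw =
        g (S.history γ ω q) (S.period γ q ω r (Nat.le_of_succ_le hr)) := fun ω =>
      S.lintegral_stage_noise _
        ((S.measurable_nextControl (γ.act q (S.history γ ω q).2) hr).comp measurable_prodMk_left)
        hf.of_uncurry_left
    refine (lintegral_congr h1).trans ?_
    rw [ih (Nat.le_of_succ_le hr) hg]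
    refine lintegral_congr fun ω => ?_
    exact (S.lintegral_stageLaw_succ _ _ hr hf.of_uncurry_left).symm

end Model

/-! ### Conditional expectations from disintegrations -/

section Disintegration

variable {Ω α β : Type*} {m : MeasurableSpace Ω} [mΩ : MeasurableSpace Ω] [MeasurableSpace α]
  [mβ : MeasurableSpace β]
  {P : Measure Ω} [IsProbabilityMeasure P] {I : Ω → β} {T : Ω → α} {κ : Kernel β α}
  [IsMarkovKernel κ]

theorem map_eq_compProd_of_lintegral (hI : Measurable I) (hT : Measurable T)
    (h : ∀ f : β → α → ℝ≥0∞, Measurable (Function.uncurry f) →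
      ∫⁻ ω, f (I ω) (T ω) ∂P = ∫⁻ ω, ∫⁻ s, f (I ω) s ∂κ (I ω) ∂P) :
    P.map (fun ω => (I ω, T ω)) = P.map I ⊗ₘ κ := by
  refine Measure.ext_of_lintegral _ fun f hf => ?_
  rw [lintegral_map hf (hI.prodMk hT), Measure.lintegral_compProd hf,
    lintegral_map hf.lintegral_kernel_prod_right' hI]
  exact h (fun b a => f (b, a)) hf

theorem integral_eq_of_map_eq_compProd (hI : Measurable I) (hT : Measurable T)
    (h : P.map (fun ω => (I ω, T ω)) = P.map I ⊗ₘ κ) {f : β → α → ℝ}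
    (hf : Measurable (Function.uncurry f)) {C : ℝ} (hC : ∀ b a, |f b a| ≤ C) :
    ∫ ω, f (I ω) (T ω) ∂P = ∫ ω, ∫ s, f (I ω) s ∂κ (I ω) ∂P := by
  have : IsProbabilityMeasure (P.map I) := Measure.isProbabilityMeasure_map hI.aemeasurable
  have hi : Integrable (Function.uncurry f) (P.map I ⊗ₘ κ) :=
    integrable_of_abs_le hf fun p => hC p.1 p.2
  have hm : Measurable fun b => ∫ s, f b s ∂κ b :=
    measurable_integral_param κ.measurable hf
  rw [← integral_map hI.aemeasurable (f := fun b => ∫ s, f b s ∂κ b) hm.aestronglyMeasurable]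
  have h1 := Measure.integral_compProd hi
  rw [← h, integral_map (hI.prodMk hT).aemeasurable hf.aestronglyMeasurable] at h1
  exact h1

/-- If `κ` disintegrates the law of `(I, T)`, then conditional expectations of functions of
`(I, T)` given less than `I` are computed by integrating against `κ`. -/
theorem condExp_of_map_eq_compProd (hI : Measurable I) (hT : Measurable T)
    (h : P.map (fun ω => (I ω, T ω)) = P.map I ⊗ₘ κ) {f : β → α → ℝ}
    (hf : Measurable (Function.uncurry f)) {C : ℝ} (hC : ∀ b a, |f b a| ≤ C)
    (hm : m ≤ mβ.comap I) {g : Ω → ℝ} (hg : Measurable[m] g)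
    (hgf : g =ᵐ[P] fun ω => ∫ s, f (I ω) s ∂κ (I ω)) :
    P[fun ω => f (I ω) (T ω) | m] =ᵐ[P] g := by
  have hmΩ : m ≤ mΩ := hm.trans hI.comap_le
  have hfm : Measurable fun ω => f (I ω) (T ω) := hf.comp (hI.prodMk hT)
  have hgi : Integrable g P := by
    refine Integrable.of_bound (hg.mono hmΩ le_rfl).aestronglyMeasurable C ?_
    filter_upwards [hgf] with ω hω
    rw [hω]
    exact abs_integral_le_of_abs_le fun a => hC _ a
  refine (ae_eq_condExp_of_forall_setIntegral_eq hmΩ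
    (integrable_of_abs_le hfm fun ω => hC _ _) (fun s _ _ => hgi.integrableOn) (fun s hs _ => ?_)
    hg.stronglyMeasurable.aestronglyMeasurable).symm
  obtain ⟨t, ht, rfl⟩ := hm s hs
  rw [← integral_indicator (hI ht), ← integral_indicator (hI ht)]
  have hind : Measurable (Function.uncurry fun b a => t.indicator (fun b => f b a) b) :=
    hf.indicator (measurable_fst ht)
  have habs (b : β) (a : α) : |t.indicator (fun b => f b a) b| ≤ C := by
    by_cases hb : b ∈ t
    · simpa [hb] using hC b a
    · simpa [hb] using (abs_nonneg _).trans (hC b a)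
  have h1 := integral_eq_of_map_eq_compProd hI hT h hind habs
  refine Eq.trans ?_ (h1.symm.trans ?_)
  · refine integral_congr_ae ?_
    filter_upwards [hgf] with ω hω
    by_cases hb : I ω ∈ t
    · simp [Set.indicator, hb, hω]
    · simp [Set.indicator, hb]
  · rfl

end Disintegration

/-! ### Common information, actions and predictors -/

section CommonInfo

variable {N : ℕ} {Y U : Fin N → Type*}

/-- The common information after a period with measurements `d.1` and actions `d.2`. -/
def infoSnoc {K q : ℕ} (I : CommonInfo Y U K q)
    (d : (Fin K → ∀ i, Y i) × (Fin K → ∀ i, U i)) : CommonInfo Y U K (q + 1) :=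
  (Fin.snoc (α := fun _ => Fin K → ∀ i, Y i) I.1 d.1,
    Fin.snoc (α := fun _ => Fin K → ∀ i, U i) I.2 d.2)

/-- The common information one period earlier. -/
def infoInit {K q : ℕ} (I : CommonInfo Y U K (q + 1)) : CommonInfo Y U K q :=
  (fun j => I.1 j.castSucc, fun j => I.2 j.castSucc)

theorem infoInit_infoSnoc {K q : ℕ} (I : CommonInfo Y U K q)
    (d : (Fin K → ∀ i, Y i) × (Fin K → ∀ i, U i)) : infoInit (infoSnoc I d) = I := by
  simp [infoInit, infoSnoc]

end CommonInfo

section Model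

variable {N : ℕ} {X : Type*} {Y U : Fin N → Type*} {V : Type*} {W : Fin N → Type*} {Ω : Type*}
  [MeasurableSpace X] [∀ i, MeasurableSpace (Y i)] [∀ i, MeasurableSpace (U i)]
  [MeasurableSpace V] [∀ i, MeasurableSpace (W i)] [MeasurableSpace Ω]

/-- The common information at the beginning of period `q`. -/
def TeamModel.info (S : TeamModel N X Y U V W Ω) {K : ℕ} (γ : TeamPolicy S K) (q : ℕ) (ω : Ω) :
    CommonInfo Y U K q :=
  (S.history γ ω q).2

theorem TeamModel.measurable_info (S : TeamModel N X Y U V W Ω) {K : ℕ} (γ : TeamPolicy S K)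
    (q : ℕ) : Measurable (S.info γ q) :=
  (S.measurable_history γ q).snd

theorem TeamPolicy.measurable_map_action {S : TeamModel N X Y U V W Ω} {K : ℕ}
    (γ : TeamPolicy S K) (q : ℕ) : Measurable (γ.act q) := by
  refine measurable_pi_iff.2 fun i => measurable_pi_iff.2 fun r => ?_
  refine measurable_comap_iff.2 (measurable_pi_iff.2 fun up => ?_)
  refine measurable_map_param (F := fun I (y : Fin (r + 1) → Y i) =>
    (y, (γ.act q I i r).toFun (y, up))) ?_
  exact measurable_snd.prodMk ((γ.measurable_act q i r).comp
    (measurable_fst.prodMk (measurable_snd.prodMk measurable_const)))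

theorem TeamModel.measurable_action (S : TeamModel N X Y U V W Ω) {K : ℕ} (γ : TeamPolicy S K)
    (q : ℕ) : Measurable (S.action γ q) :=
  (γ.measurable_map_action q).comp (S.measurable_info γ q)

theorem measurable_infoInit {K q : ℕ} :
    Measurable (infoInit : CommonInfo Y U K (q + 1) → CommonInfo Y U K q) := by
  unfold infoInit; fun_prop

theorem measurable_infoSnoc {α : Type*} [MeasurableSpace α] {K q : ℕ}
    {I : α → CommonInfo Y U K q} {d : α → (Fin K → ∀ i, Y i) × (Fin K → ∀ i, U i)}
    (hI : Measurable I) (hd : Measurable d) : Measurable fun p => infoSnoc (I p) (d p) :=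
  (measurable_finSnoc hI.fst hd.fst).prodMk (measurable_finSnoc hI.snd hd.snd)

theorem TeamModel.info_succ (S : TeamModel N X Y U V W Ω) {K : ℕ} (γ : TeamPolicy S K) (q : ℕ)
    (ω : Ω) : S.info γ (q + 1) ω = infoSnoc (S.info γ q ω) (S.period γ q ω K le_rfl).2 :=
  rfl

/-- The measurements of all agents at stage `r` of period `q`. -/
def TeamModel.stageObs (S : TeamModel N X Y U V W Ω) {K : ℕ} (γ : TeamPolicy S K) (q : ℕ) {r : ℕ}
    (hr : r ≤ K) (ω : Ω) : ∀ i, Y i :=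
  fun i => S.φ i (S.period γ q ω r hr).1 (S.w i (q * K + r) ω)

theorem TeamModel.measurable_stageObs (S : TeamModel N X Y U V W Ω) {K : ℕ} (γ : TeamPolicy S K)
    (q : ℕ) {r : ℕ} (hr : r ≤ K) : Measurable (S.stageObs γ q hr) :=
  S.measurable_observe (S.measurable_period γ q hr).fst (S.measurable_noise _)

variable [StandardBorelSpace X] [Nonempty X]

/-- The predictor as a function of the common information. -/
noncomputable def TeamModel.infoPredictor (S : TeamModel N X Y U V W Ω) {K : ℕ}
    (γ : TeamPolicy S K) (q : ℕ) (I : CommonInfo Y U K q) : ProbabilityMeasure X :=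
  ⟨condDistrib (fun ω => (S.history γ ω q).1) (fun ω => (S.history γ ω q).2) S.P I, inferInstance⟩

theorem TeamModel.measurable_infoPredictor (S : TeamModel N X Y U V W Ω) {K : ℕ}
    (γ : TeamPolicy S K) (q : ℕ) : Measurable (S.infoPredictor γ q) :=
  measurable_of_coe_probabilityMeasure (Kernel.measurable _)

theorem TeamModel.predictor_eq (S : TeamModel N X Y U V W Ω) {K : ℕ}
    (γ : TeamPolicy S K) (q : ℕ) (ω : Ω) :
    S.predictor γ q ω = S.infoPredictor γ q (S.info γ q ω) :=
  rfl

theorem TeamModel.measurable_predictor (S : TeamModel N X Y U V W Ω) {K : ℕ}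
    (γ : TeamPolicy S K) (q : ℕ) : Measurable (S.predictor γ q) :=
  (S.measurable_infoPredictor γ q).comp (S.measurable_info γ q)

theorem TeamModel.lintegral_history_eq (S : TeamModel N X Y U V W Ω) {K : ℕ} (γ : TeamPolicy S K)
    (q : ℕ) {f : CommonInfo Y U K q → X → ℝ≥0∞} (hf : Measurable (Function.uncurry f)) :
    ∫⁻ ω, f (S.info γ q ω) (S.history γ ω q).1 ∂S.P =
      ∫⁻ ω, ∫⁻ x, f (S.info γ q ω) x ∂(S.predictor γ q ω : Measure X) ∂S.P := by
  have hx := (S.measurable_history γ q).fst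
  have hI := S.measurable_info γ q
  have h : S.P.map (S.info γ q) ⊗ₘ condDistrib (fun ω => (S.history γ ω q).1) (S.info γ q) S.P =
      S.P.map fun ω => (S.info γ q ω, (S.history γ ω q).1) :=
    compProd_map_condDistrib hx.aemeasurable
  have h1 := lintegral_map (μ := S.P) hf (hI.prodMk hx)
  rw [← h, Measure.lintegral_compProd hf, lintegral_map hf.lintegral_kernel_prod_right' hI] at h1
  exact h1.symm

theorem TeamModel.measurable_info_pair (S : TeamModel N X Y U V W Ω) {K : ℕ} (γ : TeamPolicy S K)
    (q : ℕ) : Measurable fun I : CommonInfo Y U K q => (S.infoPredictor γ q I, γ.act q I) :=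
  (S.measurable_infoPredictor γ q).prodMk (γ.measurable_map_action q)

variable [∀ i, Finite (U i)] [∀ i, MeasurableSingletonClass (U i)] [∀ i, Nonempty (U i)]
  [∀ i, StandardBorelSpace (Y i)]

/-- Given the common information, a period of the closed-loop system has the law of a period
started from the predictor. -/
theorem TeamModel.lintegral_period (S : TeamModel N X Y U V W Ω) {K : ℕ} (γ : TeamPolicy S K)
    (q : ℕ) {r : ℕ} (hr : r ≤ K) {f : CommonInfo Y U K q → StageData X Y U r → ℝ≥0∞}
    (hf : Measurable (Function.uncurry f)) :
    ∫⁻ ω, f (S.info γ q ω) (S.period γ q ω r hr) ∂S.P =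
      ∫⁻ ω, ∫⁻ s, f (S.info γ q ω) s
        ∂S.stageLaw (S.predictor γ q ω) (S.action γ q ω) r hr ∂S.P := by
  refine (S.lintegral_period_diracLaw γ q hr (f := fun H s => f H.2 s)
    (hf.comp (measurable_fst.snd.prodMk measurable_snd))).trans ?_
  have hm : Measurable (Function.uncurry fun (I : CommonInfo Y U K q) (x : X) =>
      ∫⁻ s, f I s ∂S.stageLaw (diracLaw x) (γ.act q I) r hr) := by
    refine measurable_lintegral_param (κ := fun p : CommonInfo Y U K q × X =>
      S.stageLaw (diracLaw p.2) (γ.act q p.1) r hr) (f := fun p s => f p.1 s) ?_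
      (hf.comp (measurable_fst.fst.prodMk measurable_snd))
    exact (S.measurable_stageLaw hr).comp (f := fun p : CommonInfo Y U K q × X =>
      (diracLaw p.2, γ.act q p.1)) ((measurable_diracLaw.comp measurable_snd).prodMk
        ((γ.measurable_map_action q).comp measurable_fst))
  refine (S.lintegral_history_eq γ q hm).trans (lintegral_congr fun ω => ?_)
  exact (S.lintegral_stageLaw_eq _ _ hr hf.of_uncurry_left).symm

/-- The version of `TeamModel.lintegral_period` that includes the measurements of the next stage. -/
theorem TeamModel.lintegral_obs (S : TeamModel N X Y U V W Ω) {K : ℕ} (γ : TeamPolicy S K)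
    (q : ℕ) {r : ℕ} (hr : r ≤ K)
    {f : CommonInfo Y U K q → StageData X Y U r × (∀ i, Y i) → ℝ≥0∞}
    (hf : Measurable (Function.uncurry f)) :
    ∫⁻ ω, f (S.info γ q ω) (S.period γ q ω r hr, S.stageObs γ q hr ω) ∂S.P =
      ∫⁻ ω, ∫⁻ p, f (S.info γ q ω) p
        ∂S.obsLaw (S.predictor γ q ω) (S.action γ q ω) hr ∂S.P := by
  have hind := S.lintegral_noise (S.measurable_past γ q hr)
    (f := fun p w _ => f p.1.2 (p.2, fun i => S.φ i p.2.1 (w i))) (by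
      refine hf.comp (measurable_fst.fst.snd.prodMk (measurable_fst.snd.prodMk ?_))
      exact S.measurable_observe (x := fun p : ((X × CommonInfo Y U K q) × StageData X Y U r) ×
        (∀ i, W i) × V => p.1.2.1) (w := fun p => p.2.1) measurable_fst.snd.fst
        measurable_snd.fst)
  refine hind.trans ?_
  have h1 (ω : Ω) : ∫⁻ w, ∫⁻ _, f (S.info γ q ω) (S.period γ q ω r hr,
        fun i => S.φ i (S.period γ q ω r hr).1 (w i)) ∂(S.P.map (S.v 0)) ∂S.noiseLaw =
      ∫⁻ y, f (S.info γ q ω) (S.period γ q ω r hr, y)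
        ∂S.jointChannel (S.period γ q ω r hr).1 := by
    have hobs : Measurable fun (w : ∀ i, W i) i => S.φ i (S.period γ q ω r hr).1 (w i) :=
      S.measurable_observe measurable_const measurable_id
    have hfy : Measurable fun y => f (S.info γ q ω) (S.period γ q ω r hr, y) :=
      hf.of_uncurry_left.comp measurable_prodMk_left
    rw [S.jointChannel_eq_map, lintegral_map hfy hobs]
    simp
  refine (lintegral_congr h1).trans ?_
  rw [S.lintegral_period γ q hr (f := fun I s => ∫⁻ y, f I (s, y) ∂S.jointChannel s.1)]
  · exact lintegral_congr fun ω => (S.lintegral_obsLaw _ _ hr hf.of_uncurry_left).symm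
  · refine measurable_lintegral_param (κ := fun p : CommonInfo Y U K q × StageData X Y U r =>
      S.jointChannel p.2.1) (f := fun p y => f p.1 (p.2, y))
      (S.measurable_jointChannel.comp measurable_snd.fst) ?_
    exact hf.comp (measurable_fst.fst.prodMk (measurable_fst.snd.prodMk measurable_snd))

/-- The conditional law of a closed-loop period given the common information. -/
noncomputable def TeamModel.periodKernel (S : TeamModel N X Y U V W Ω) {K : ℕ}
    (γ : TeamPolicy S K) (q : ℕ) : Kernel (CommonInfo Y U K q) (StageData X Y U K) where
  toFun I := S.stageLaw (S.infoPredictor γ q I) (γ.act q I) K le_rfl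
  measurable' := (S.measurable_stageLaw le_rfl).comp (S.measurable_info_pair γ q)

instance TeamModel.isMarkovKernel_periodKernel (S : TeamModel N X Y U V W Ω) {K : ℕ}
    (γ : TeamPolicy S K) (q : ℕ) : IsMarkovKernel (S.periodKernel γ q) :=
  ⟨fun _ => S.isProbabilityMeasure_stageLaw _ _ _ _⟩

/-- The conditional law of the data up to the measurements of stage `r` of a closed-loop period,
given the common information. -/
noncomputable def TeamModel.obsKernel (S : TeamModel N X Y U V W Ω) {K : ℕ}
    (γ : TeamPolicy S K) (q : ℕ) {r : ℕ} (hr : r ≤ K) :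
    Kernel (CommonInfo Y U K q) (StageData X Y U r × (∀ i, Y i)) where
  toFun I := S.obsLaw (S.infoPredictor γ q I) (γ.act q I) hr
  measurable' := (S.measurable_obsLaw hr).comp (S.measurable_info_pair γ q)

instance TeamModel.isMarkovKernel_obsKernel (S : TeamModel N X Y U V W Ω) {K : ℕ}
    (γ : TeamPolicy S K) (q : ℕ) {r : ℕ} (hr : r ≤ K) : IsMarkovKernel (S.obsKernel γ q hr) :=
  ⟨fun _ => S.isProbabilityMeasure_obsLaw _ _ _⟩

theorem TeamModel.map_period_eq_compProd (S : TeamModel N X Y U V W Ω) {K : ℕ}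
    (γ : TeamPolicy S K) (q : ℕ) :
    S.P.map (fun ω => (S.info γ q ω, S.period γ q ω K le_rfl)) =
      S.P.map (S.info γ q) ⊗ₘ S.periodKernel γ q :=
  map_eq_compProd_of_lintegral (S.measurable_info γ q) (S.measurable_period γ q le_rfl)
    fun _ hf => S.lintegral_period γ q le_rfl hf

theorem TeamModel.map_obs_eq_compProd (S : TeamModel N X Y U V W Ω) {K : ℕ}
    (γ : TeamPolicy S K) (q : ℕ) {r : ℕ} (hr : r ≤ K) :
    S.P.map (fun ω => (S.info γ q ω, (S.period γ q ω r hr, S.stageObs γ q hr ω))) =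
      S.P.map (S.info γ q) ⊗ₘ S.obsKernel γ q hr :=
  map_eq_compProd_of_lintegral (S.measurable_info γ q)
    ((S.measurable_period γ q hr).prodMk (S.measurable_stageObs γ q hr))
    fun _ hf => S.lintegral_obs γ q hr hf

/-- Almost sure properties of a period under the laws `stageLaw` hold in closed loop. -/
theorem TeamModel.ae_period (S : TeamModel N X Y U V W Ω) {K : ℕ} (γ : TeamPolicy S K) (q : ℕ)
    {p : CommonInfo Y U K q → StageData X Y U K → Prop}
    (hp : MeasurableSet {d : CommonInfo Y U K q × StageData X Y U K | p d.1 d.2})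
    (h : ∀ I, ∀ᵐ s ∂S.stageLaw (S.infoPredictor γ q I) (γ.act q I) K le_rfl, p I s) :
    ∀ᵐ ω ∂S.P, p (S.info γ q ω) (S.period γ q ω K le_rfl) := by
  have h1 : ∀ᵐ d ∂(S.P.map (S.info γ q) ⊗ₘ S.periodKernel γ q), p d.1 d.2 :=
    Measure.ae_compProd_of_ae_ae hp (Filter.Eventually.of_forall h)
  rw [← S.map_period_eq_compProd] at h1
  exact ae_of_ae_map ((S.measurable_info γ q).prodMk
    (S.measurable_period γ q le_rfl)).aemeasurable h1

theorem TeamModel.ae_actions_eq_play (S : TeamModel N X Y U V W Ω) {K : ℕ} (γ : TeamPolicy S K)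
    (q : ℕ) : ∀ᵐ ω ∂S.P,
      (S.period γ q ω K le_rfl).2.2 = S.play (S.action γ q ω) (S.measurements γ q ω) := by
  refine S.ae_period γ q (p := fun I s => s.2.2 = S.play (γ.act q I) s.2.1) ?_
    fun I => S.ae_action_eq_play _ _
  exact measurableSet_eq_fun measurable_snd.snd.snd (S.measurable_play.comp
    (((γ.measurable_map_action q).comp measurable_fst).prodMk measurable_snd.snd.fst))

/-- The predictor is updated by the Bayesian filter. -/
theorem TeamModel.ae_predictor_succ (S : TeamModel N X Y U V W Ω) {K : ℕ} (γ : TeamPolicy S K)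
    (q : ℕ) : ∀ᵐ ω ∂S.P, S.predictor γ (q + 1) ω =
      S.playUpdate (S.predictor γ q ω) (S.action γ q ω) (S.measurements γ q ω) := by
  let G : CommonInfo Y U K (q + 1) → ProbabilityMeasure X := fun I =>
    S.periodUpdate (S.infoPredictor γ q (infoInit I)) (I.2 (Fin.last q)) (I.1 (Fin.last q))
  have hG : Measurable G := S.measurable_periodUpdate
    ((S.measurable_infoPredictor γ q).comp measurable_infoInit)
    ((measurable_pi_apply _).comp measurable_snd) ((measurable_pi_apply _).comp measurable_fst)
  let κ : Kernel (CommonInfo Y U K (q + 1)) X :=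
    ⟨fun I => (G I : Measure X), measurable_subtype_coe.comp hG⟩
  have hκ : IsMarkovKernel κ := ⟨fun I => (G I).2⟩
  have hG' (ω : Ω) : G (S.info γ (q + 1) ω) = S.periodUpdate (S.predictor γ q ω)
      (S.period γ q ω K le_rfl).2.2 (S.period γ q ω K le_rfl).2.1 := by
    simp only [G, S.info_succ, infoInit_infoSnoc]
    simp [infoSnoc, S.predictor_eq]
  have hx := (S.measurable_history γ (q + 1)).fst
  have hlaw : S.P.map (fun ω => (S.info γ (q + 1) ω, (S.history γ ω (q + 1)).1)) =
      S.P.map (S.info γ (q + 1)) ⊗ₘ κ := by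
    refine map_eq_compProd_of_lintegral (S.measurable_info γ (q + 1)) hx fun f hf => ?_
    have hm1 : Measurable (Function.uncurry fun (I : CommonInfo Y U K q) (s : StageData X Y U K) =>
        f (infoSnoc I s.2) s.1) :=
      hf.comp ((measurable_infoSnoc measurable_fst measurable_snd.snd).prodMk measurable_snd.fst)
    have hm2 : Measurable (Function.uncurry fun (I : CommonInfo Y U K q) (s : StageData X Y U K) =>
        ∫⁻ x, f (infoSnoc I s.2) x
          ∂(S.periodUpdate (S.infoPredictor γ q I) s.2.2 s.2.1 : Measure X)) := by
      refine measurable_lintegral_probabilityMeasure (η := fun p : CommonInfo Y U K q ×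
        StageData X Y U K => S.periodUpdate (S.infoPredictor γ q p.1) p.2.2.2 p.2.2.1)
        (f := fun p x => f (infoSnoc p.1 p.2.2) x)
        (S.measurable_periodUpdate ((S.measurable_infoPredictor γ q).comp measurable_fst)
          measurable_snd.snd.snd measurable_snd.snd.fst) ?_
      exact hf.comp ((measurable_infoSnoc measurable_fst.fst measurable_fst.snd.snd).prodMk
        measurable_snd)
    refine (S.lintegral_period γ q le_rfl hm1).trans ?_
    have h2 := S.lintegral_period γ q le_rfl hm2
    have h3 (ω : Ω) : ∫⁻ x, f (S.info γ (q + 1) ω) x ∂κ (S.info γ (q + 1) ω) =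
        ∫⁻ x, f (infoSnoc (S.info γ q ω) (S.period γ q ω K le_rfl).2) x
          ∂(S.periodUpdate (S.infoPredictor γ q (S.info γ q ω)) (S.period γ q ω K le_rfl).2.2
            (S.period γ q ω K le_rfl).2.1 : Measure X) := by
      change ∫⁻ x, f (S.info γ (q + 1) ω) x ∂(G (S.info γ (q + 1) ω) : Measure X) = _
      rw [hG']
      rfl
    refine Eq.trans ?_ (h2.symm.trans (lintegral_congr h3).symm)
    refine lintegral_congr fun ω => ?_
    exact S.lintegral_stageLaw_eq_updateTo _ _ le_rfl hm1.of_uncurry_left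
  have h := condDistrib_ae_eq_of_measure_eq_compProd (μ := S.P) (S.info γ (q + 1))
    hx.aemeasurable hlaw
  have h' := ae_of_ae_map (S.measurable_info γ (q + 1)).aemeasurable h
  filter_upwards [h', S.ae_actions_eq_play γ q] with ω h1 h2
  have h4 : S.predictor γ (q + 1) ω = G (S.info γ (q + 1) ω) := Subtype.ext h1
  rw [h4, hG', h2]
  rfl

end Model

/-! ### The window as a function of the common information -/

section CommonInfo

variable {N : ℕ} {Y U : Fin N → Type*}

/-- The common information at the beginning of an earlier period. -/
def infoTake {K q q' : ℕ} (h : q ≤ q') (I : CommonInfo Y U K q') : CommonInfo Y U K q :=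
  (fun j => I.1 (Fin.castLE h j), fun j => I.2 (Fin.castLE h j))

end CommonInfo

section Model

variable {N : ℕ} {X : Type*} {Y U : Fin N → Type*} {V : Type*} {W : Fin N → Type*} {Ω : Type*}
  {m : MeasurableSpace Ω} [MeasurableSpace X] [∀ i, MeasurableSpace (Y i)]
  [∀ i, MeasurableSpace (U i)]
  [MeasurableSpace V] [∀ i, MeasurableSpace (W i)] [MeasurableSpace Ω]

theorem measurable_infoTake {K q q' : ℕ} (h : q ≤ q') :
    Measurable (infoTake h : CommonInfo Y U K q' → CommonInfo Y U K q) := by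
  unfold infoTake; fun_prop

theorem TeamModel.infoTake_info (S : TeamModel N X Y U V W Ω) {K : ℕ} (γ : TeamPolicy S K)
    {q q' : ℕ} (h : q ≤ q') (ω : Ω) : infoTake h (S.info γ q' ω) = S.info γ q ω := by
  induction q', h using Nat.le_induction with
  | base => rfl
  | succ n hn ih =>
    rw [← ih]
    refine Prod.ext (funext fun j => ?_) (funext fun j => ?_)
    · exact Fin.snoc_castSucc (α := fun _ => Fin K → ∀ i, Y i) _ _ (Fin.castLE hn j)
    · exact Fin.snoc_castSucc (α := fun _ => Fin K → ∀ i, U i) _ _ (Fin.castLE hn j)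

theorem TeamModel.info_measurements (S : TeamModel N X Y U V W Ω) {K : ℕ} (γ : TeamPolicy S K)
    {q q' : ℕ} (h : q < q') (ω : Ω) : (S.info γ q' ω).1 ⟨q, h⟩ = S.measurements γ q ω := by
  have h1 := congrArg (fun I : CommonInfo Y U K (q + 1) => I.1 (Fin.last q))
    (S.infoTake_info γ (Nat.succ_le_of_lt h) ω)
  refine Eq.trans h1 ?_
  exact Fin.snoc_last (α := fun _ => Fin K → ∀ i, Y i) _ _

/-- The σ-algebra of the common information. -/
@[reducible] def TeamModel.infoSigma (S : TeamModel N X Y U V W Ω) {K : ℕ} (γ : TeamPolicy S K)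
    (q : ℕ) : MeasurableSpace Ω :=
  MeasurableSpace.comap (S.info γ q) inferInstance

theorem TeamModel.infoSigma_mono (S : TeamModel N X Y U V W Ω) {K : ℕ} (γ : TeamPolicy S K)
    {q q' : ℕ} (h : q ≤ q') : S.infoSigma γ q ≤ S.infoSigma γ q' := by
  rw [TeamModel.infoSigma, ← funext (S.infoTake_info γ h)]
  exact Measurable.comap_le ((measurable_infoTake h).comp (comap_measurable _))

theorem TeamModel.infoSigma_action_le (S : TeamModel N X Y U V W Ω) {K : ℕ} (γ : TeamPolicy S K)
    (q : ℕ) : MeasurableSpace.comap (S.action γ q) inferInstance ≤ S.infoSigma γ q :=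
  Measurable.comap_le ((γ.measurable_map_action q).comp (comap_measurable _))

variable [StandardBorelSpace X] [Nonempty X]

/-- The window state at the beginning of period `M + k`, as a function of the common
information. -/
noncomputable def TeamModel.infoWindow (S : TeamModel N X Y U V W Ω) {K : ℕ} (M : ℕ)
    (γ : TeamPolicy S K) (k : ℕ) (I : CommonInfo Y U K (M + k)) : WindowState S K M :=
  (S.infoPredictor γ k (infoTake (Nat.le_add_left k M) I),
    fun j => I.1 ⟨k + j, by omega⟩,
    fun j => γ.act (k + j) (infoTake (by omega) I))

theorem TeamModel.measurable_infoWindow (S : TeamModel N X Y U V W Ω) {K : ℕ} (M : ℕ)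
    (γ : TeamPolicy S K) (k : ℕ) : Measurable (S.infoWindow M γ k) := by
  refine ((S.measurable_infoPredictor γ k).comp (measurable_infoTake _)).prodMk
    (Measurable.prodMk ?_ (measurable_pi_iff.2 fun j => ?_))
  · fun_prop
  · exact (γ.measurable_map_action (k + j)).comp (measurable_infoTake _)

theorem TeamModel.window_eq (S : TeamModel N X Y U V W Ω) {K : ℕ} (M : ℕ)
    (γ : TeamPolicy S K) (k : ℕ) (ω : Ω) :
    S.window M γ k ω = S.infoWindow M γ k (S.info γ (M + k) ω) := by
  refine Prod.ext ?_ (Prod.ext (funext fun j => ?_) (funext fun j => ?_))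
  · simp only [TeamModel.infoWindow, S.infoTake_info]
    rfl
  · exact (S.info_measurements γ _ ω).symm
  · simp only [TeamModel.infoWindow, S.infoTake_info]
    rfl

theorem TeamModel.measurable_window (S : TeamModel N X Y U V W Ω) {K : ℕ} (M : ℕ)
    (γ : TeamPolicy S K) (k : ℕ) : Measurable (S.window M γ k) := by
  rw [funext (S.window_eq M γ k)]
  exact (S.measurable_infoWindow M γ k).comp (S.measurable_info γ _)

theorem TeamModel.pastSigma_window_le (S : TeamModel N X Y U V W Ω) {K : ℕ} (M : ℕ)
    (γ : TeamPolicy S K) (k : ℕ) :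
    pastSigma (S.window M γ) (fun k => S.action γ (M + k)) k ≤ S.infoSigma γ (M + k) := by
  refine iSup_le fun j => ?_
  refine (sup_le ?_ (S.infoSigma_action_le γ (M + j))).trans (S.infoSigma_mono γ (by omega))
  rw [funext (S.window_eq M γ j)]
  exact Measurable.comap_le ((S.measurable_infoWindow M γ j).comp (comap_measurable _))

theorem TeamModel.pastSigma_predictor_le (S : TeamModel N X Y U V W Ω) {K : ℕ} (M : ℕ)
    (γ : TeamPolicy S K) (k : ℕ) :
    pastSigma (fun k => S.predictor γ (M + k)) (fun k => S.action γ (M + k)) k ≤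
      S.infoSigma γ (M + k) := by
  refine iSup_le fun j => ?_
  refine (sup_le ?_ (S.infoSigma_action_le γ (M + j))).trans (S.infoSigma_mono γ (by omega))
  exact Measurable.comap_le ((S.measurable_infoPredictor γ (M + j)).comp (comap_measurable _))

theorem measurable_pastSigma {Ω 𝓢 𝓐 : Type*} [MeasurableSpace 𝓢] [MeasurableSpace 𝓐]
    (Z : ℕ → Ω → 𝓢) (A : ℕ → Ω → 𝓐) (k : ℕ) :
    Measurable[pastSigma Z A k] fun ω => (Z k ω, A k ω) := by
  have hle := le_iSup (fun j : Fin (k + 1) => MeasurableSpace.comap (Z j) inferInstance ⊔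
    MeasurableSpace.comap (A j) inferInstance) (Fin.last k)
  have h1 : Measurable[pastSigma Z A k] (Z k) :=
    (comap_measurable (Z k)).mono (le_sup_left.trans hle) le_rfl
  have h2 : Measurable[pastSigma Z A k] (A k) :=
    (comap_measurable (A k)).mono (le_sup_right.trans hle) le_rfl
  exact Measurable.prodMk h1 h2

variable [∀ i, Finite (U i)] [∀ i, MeasurableSingletonClass (U i)] [∀ i, Nonempty (U i)]
  [∀ i, StandardBorelSpace (Y i)]

/-! ### The window process and the predictor process -/

theorem TeamModel.ae_foldl_predictor (S : TeamModel N X Y U V W Ω) {K : ℕ} (γ : TeamPolicy S K)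
    (k n : ℕ) : ∀ᵐ ω ∂S.P, Fin.foldl n (fun π j => S.playUpdate π (S.action γ (k + j) ω)
      (S.measurements γ (k + j) ω)) (S.predictor γ k ω) = S.predictor γ (k + n) ω := by
  induction n with
  | zero => exact Filter.Eventually.of_forall fun ω => by simp
  | succ n ih =>
    filter_upwards [ih, S.ae_predictor_succ γ (k + n)] with ω h1 h2
    rw [Fin.foldl_succ_last]
    simp only [Fin.val_castSucc, Fin.val_last, h1]
    exact h2.symm

theorem TeamModel.ae_filter_window (S : TeamModel N X Y U V W Ω) {K : ℕ} (M : ℕ)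
    (γ : TeamPolicy S K) (k : ℕ) :
    ∀ᵐ ω ∂S.P, S.filter (S.window M γ k ω) = S.predictor γ (M + k) ω := by
  rw [Nat.add_comm M k]
  exact S.ae_foldl_predictor γ k M

theorem TeamModel.ae_window_succ (S : TeamModel N X Y U V W Ω) {K : ℕ} (M : ℕ) [NeZero M]
    (γ : TeamPolicy S K) (k : ℕ) : ∀ᵐ ω ∂S.P, S.window M γ (k + 1) ω =
      S.windowStep (S.window M γ k ω) (S.action γ (M + k) ω) (S.measurements γ (M + k) ω) := by
  filter_upwards [S.ae_predictor_succ γ k] with ω h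
  refine Prod.ext ?_ (Prod.ext (funext fun j => ?_) (funext fun j => ?_))
  · exact h
  all_goals
    by_cases hj : (j : ℕ) + 1 < M
    · simp only [TeamModel.window, TeamModel.windowStep, hj, dif_pos]
      rw [show k + 1 + (j : ℕ) = k + (j + 1) by omega]
    · simp only [TeamModel.window, TeamModel.windowStep, hj, dif_neg, not_false_eq_true]
      rw [show k + 1 + (j : ℕ) = M + k by omega]

/-- Conditional probabilities of functions of the common information and of the measurements of the
next period, given less than the common information. -/
theorem TeamModel.condExp_indicator (S : TeamModel N X Y U V W Ω) {K : ℕ} (γ : TeamPolicy S K)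
    (q : ℕ) {𝓩 : Type*} [MeasurableSpace 𝓩] {F : CommonInfo Y U K q → (Fin K → ∀ i, Y i) → 𝓩}
    (hF : Measurable (Function.uncurry F)) {Z : Ω → 𝓩}
    (hZ : ∀ᵐ ω ∂S.P, Z ω = F (S.info γ q ω) (S.measurements γ q ω)) {B : Set 𝓩}
    (hB : MeasurableSet B) (hm : m ≤ S.infoSigma γ q) {g : Ω → ℝ}
    (hg : Measurable[m] g) (hgF : ∀ᵐ ω ∂S.P, g ω =
      ((S.stageLaw (S.predictor γ q ω) (S.action γ q ω) K le_rfl).map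
        fun s => F (S.info γ q ω) s.2.1).real B) :
    S.P[(Z ⁻¹' B).indicator (fun _ => (1 : ℝ)) | m] =ᵐ[S.P] g := by
  let f : CommonInfo Y U K q → StageData X Y U K → ℝ := fun I s =>
    (B.indicator (fun _ => (1 : ℝ))) (F I s.2.1)
  have hFm : Measurable fun p : CommonInfo Y U K q × StageData X Y U K => F p.1 p.2.2.1 :=
    hF.comp (measurable_fst.prodMk measurable_snd.snd.fst)
  have hf : Measurable (Function.uncurry f) := (measurable_const.indicator hB).comp hFm
  have habs (I : CommonInfo Y U K q) (s : StageData X Y U K) : |f I s| ≤ 1 := by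
    by_cases h : F I s.2.1 ∈ B <;> simp [f, h]
  have h := condExp_of_map_eq_compProd (S.measurable_info γ q) (S.measurable_period γ q le_rfl)
    (S.map_period_eq_compProd γ q) hf habs hm hg ?_
  · refine (condExp_congr_ae ?_).trans h
    filter_upwards [hZ] with ω hω
    change B.indicator (fun _ => (1 : ℝ)) (Z ω) = _
    rw [hω]
    rfl
  · filter_upwards [hgF] with ω hω
    rw [hω]
    have hFω : Measurable fun s : StageData X Y U K => F (S.info γ q ω) s.2.1 :=
      hFm.of_uncurry_left (f := fun I (s : StageData X Y U K) => F I s.2.1)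
    rw [← integral_indicator_one hB, integral_map hFω.aemeasurable
      (measurable_one.indicator hB).aestronglyMeasurable]
    rfl

theorem TeamModel.isControlledMarkov_window (S : TeamModel N X Y U V W Ω) {K M : ℕ} [NeZero M]
    (γ : TeamPolicy S K) : IsControlledMarkov S.P (S.window M γ) (fun k => S.action γ (M + k))
      (S.windowKernel K M) where
  measurable_state k := S.measurable_window M γ k
  measurable_action k := S.measurable_action γ (M + k)
  markov k B hB := by
    refine S.condExp_indicator γ (M + k)
      (F := fun I y => S.windowStep (S.infoWindow M γ k I) (γ.act (M + k) I) y) ?_ ?_ hB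
      (S.pastSigma_window_le M γ k) ?_ ?_
    · exact S.measurable_windowStep ((S.measurable_infoWindow M γ k).comp measurable_fst)
        ((γ.measurable_map_action (M + k)).comp measurable_fst) measurable_snd
    · filter_upwards [S.ae_window_succ M γ k] with ω hω
      rw [hω, S.window_eq]
      rfl
    · exact ((S.windowKernel K M).measurable_coe hB).ennreal_toReal.comp
        (measurable_pastSigma _ _ k)
    · filter_upwards [S.ae_filter_window M γ k] with ω hω
      rw [← hω, S.window_eq]
      rfl

theorem TeamModel.isControlledMarkov_predictor (S : TeamModel N X Y U V W Ω) {K : ℕ} (M : ℕ)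
    (γ : TeamPolicy S K) : IsControlledMarkov S.P (fun k => S.predictor γ (M + k))
      (fun k => S.action γ (M + k)) (S.beliefKernel K) where
  measurable_state k := S.measurable_predictor γ (M + k)
  measurable_action k := S.measurable_action γ (M + k)
  markov k B hB := by
    refine S.condExp_indicator γ (M + k)
      (F := fun I y => S.playUpdate (S.infoPredictor γ (M + k) I) (γ.act (M + k) I) y) ?_ ?_ hB
      (S.pastSigma_predictor_le M γ k) ?_ ?_
    · exact S.measurable_playUpdate ((S.measurable_infoPredictor γ _).comp measurable_fst)
        ((γ.measurable_map_action (M + k)).comp measurable_fst) measurable_snd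
    · exact S.ae_predictor_succ γ (M + k)
    · exact ((S.beliefKernel K).measurable_coe hB).ennreal_toReal.comp
        (measurable_pastSigma (fun k => S.predictor γ (M + k)) _ k)
    · exact Filter.Eventually.of_forall fun ω => by rw [S.beliefKernel_apply]; rfl

end Model

section Model

variable {N : ℕ} {X : Type*} {Y U : Fin N → Type*} {V : Type*} {W : Fin N → Type*} {Ω : Type*}
  [MeasurableSpace X] [∀ i, MeasurableSpace (Y i)]
  [∀ i, MeasurableSpace (U i)]
  [MeasurableSpace V] [∀ i, MeasurableSpace (W i)] [MeasurableSpace Ω]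

/-! ### Costs in closed loop -/

/-- The actions recorded in a period are those generated at the respective stages. -/
theorem TeamModel.runPeriod_control (S : TeamModel N X Y U V W Ω) {K : ℕ} (a : ActionMap U S.ψ K)
    (q : ℕ) (ω : Ω) (x : X) {r n : ℕ} (hr : r < n) (hn : n ≤ K) :
    (S.runPeriod a q ω x n hn).2.2 ⟨r, hr⟩ =
      S.nextControl a (hr.trans_le hn) (S.runPeriod a q ω x r (hr.le.trans hn))
        fun i => S.φ i (S.runPeriod a q ω x r (hr.le.trans hn)).1 (S.w i (q * K + r) ω) := by
  induction n, (Nat.succ_le_of_lt hr) using Nat.le_induction with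
  | base =>
    rw [S.runPeriod_succ a q ω x hn]
    exact Fin.snoc_last (α := fun _ => ∀ i, U i) _ _
  | succ n hle ih =>
    rw [← ih hle (Nat.le_of_succ_le hn), S.runPeriod_succ a q ω x hn]
    exact Fin.snoc_castSucc (α := fun _ => ∀ i, U i) _ _ ⟨r, hle⟩

theorem TeamModel.period_congr (S : TeamModel N X Y U V W Ω) {K : ℕ} (γ : TeamPolicy S K)
    {q q' r r' : ℕ} (hq : q' = q) (hr : r' = r) (h : r ≤ K) (h' : r' ≤ K) (ω : Ω) :
    (S.period γ q' ω r' h').1 = (S.period γ q ω r h).1 := by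
  subst hq hr; rfl

theorem TeamModel.stateAt_eq (S : TeamModel N X Y U V W Ω) {K : ℕ} [NeZero K] (γ : TeamPolicy S K)
    (q : ℕ) (r : Fin K) (ω : Ω) :
    S.stateAt γ (q * K + r) ω = (S.period γ q ω r r.2.le).1 := by
  refine S.period_congr γ ?_ ?_ _ _ ω
  · rw [Nat.mul_comm, Nat.mul_add_div (NeZero.pos K), Nat.div_eq_of_lt r.2, add_zero]
  · rw [Nat.mul_comm, Nat.mul_add_mod, Nat.mod_eq_of_lt r.2]

theorem TeamModel.controlAt_eq (S : TeamModel N X Y U V W Ω) {K : ℕ} [NeZero K]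
    (γ : TeamPolicy S K) (q : ℕ) (r : Fin K) (ω : Ω) :
    S.controlAt γ (q * K + r) ω = S.nextControl (S.action γ q ω) r.2 (S.period γ q ω r r.2.le)
      (S.stageObs γ q r.2.le ω) := by
  have hq : (q * K + r) / K = q := by
    rw [Nat.mul_comm, Nat.mul_add_div (NeZero.pos K), Nat.div_eq_of_lt r.2, add_zero]
  have hr : (q * K + r) % K = r := by rw [Nat.mul_comm, Nat.mul_add_mod, Nat.mod_eq_of_lt r.2]
  have h : S.controlAt γ (q * K + r) ω = (S.period γ q ω K le_rfl).2.2 r := by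
    unfold TeamModel.controlAt
    have aux (q' : ℕ) (hq' : q' = q) (j : Fin K) (hj : (j : ℕ) = r) :
        (S.period γ q' ω K le_rfl).2.2 j = (S.period γ q ω K le_rfl).2.2 r := by
      subst hq'
      rw [Fin.ext hj]
    exact aux _ hq _ hr
  rw [h]
  exact S.runPeriod_control _ q ω _ r.2 le_rfl

/-- The cost of stage `r` of period `q` in closed loop. -/
theorem TeamModel.cost_eq (S : TeamModel N X Y U V W Ω) {K : ℕ} [NeZero K]
    (γ : TeamPolicy S K) (q : ℕ) (r : Fin K) (ω : Ω) :
    S.c (S.stateAt γ (q * K + r) ω) (S.controlAt γ (q * K + r) ω) =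
      S.c (S.period γ q ω r r.2.le).1 (S.nextControl (γ.act q (S.info γ q ω)) r.2
        (S.period γ q ω r r.2.le) (S.stageObs γ q r.2.le ω)) := by
  rw [S.stateAt_eq, S.controlAt_eq]
  rfl

theorem TeamModel.measurable_infoCost (S : TeamModel N X Y U V W Ω) {K : ℕ}
    (γ : TeamPolicy S K) (q : ℕ) (r : Fin K) :
    Measurable (Function.uncurry fun (I : CommonInfo Y U K q)
      (p : StageData X Y U r × (∀ i, Y i)) => S.c p.1.1 (S.nextControl (γ.act q I) r.2 p.1 p.2)) :=
  S.measurable_c.comp (measurable_snd.fst.fst.prodMk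
    (S.measurable_policyControl γ r.2 measurable_fst measurable_snd.fst measurable_snd.snd))

theorem TeamModel.measurable_cost (S : TeamModel N X Y U V W Ω) {K : ℕ} [NeZero K]
    (γ : TeamPolicy S K) (q : ℕ) (r : Fin K) : Measurable fun ω =>
      S.c (S.stateAt γ (q * K + r) ω) (S.controlAt γ (q * K + r) ω) := by
  simp_rw [S.cost_eq]
  exact (S.measurable_infoCost γ q r).comp ((S.measurable_info γ q).prodMk
    ((S.measurable_period γ q r.2.le).prodMk (S.measurable_stageObs γ q r.2.le)))

theorem TeamModel.integrable_cost (S : TeamModel N X Y U V W Ω) {K : ℕ} [NeZero K]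
    (γ : TeamPolicy S K) (q : ℕ) (r : Fin K) : Integrable (fun ω =>
      S.c (S.stateAt γ (q * K + r) ω) (S.controlAt γ (q * K + r) ω)) S.P := by
  obtain ⟨C, hC⟩ := S.bounded_c
  exact integrable_of_abs_le (S.measurable_cost γ q r) fun ω => hC _ _

/-- The discounted cost from period `M` on, grouped into periods. -/
theorem TeamModel.costFrom_eq_tsum (S : TeamModel N X Y U V W Ω) {K : ℕ} [NeZero K] (M : ℕ)
    (γ : TeamPolicy S K) : S.costFrom (M * K) γ = ∑' k : ℕ, (S.β ^ K) ^ (M + k) *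
      ∫ ω, ∑ r : Fin K, S.β ^ (r : ℕ) *
        S.c (S.stateAt γ ((M + k) * K + r) ω) (S.controlAt γ ((M + k) * K + r) ω) ∂S.P := by
  obtain ⟨C, hC⟩ := S.bounded_c
  let e : ℕ → ℝ := fun t => S.β ^ (M * K + t) *
    ∫ ω, S.c (S.stateAt γ (M * K + t) ω) (S.controlAt γ (M * K + t) ω) ∂S.P
  have hsum : Summable e := by
    refine Summable.of_norm_bounded (g := fun t => S.β ^ t * (S.β ^ (M * K) * C))
      ((summable_geometric_of_lt_one S.β_pos.le S.β_lt_one).mul_right _) fun t => ?_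
    rw [norm_mul, Real.norm_of_nonneg (pow_nonneg S.β_pos.le _), pow_add, ← mul_assoc,
      mul_comm (S.β ^ t)]
    refine mul_le_mul_of_nonneg_left ?_
      (mul_nonneg (pow_nonneg S.β_pos.le _) (pow_nonneg S.β_pos.le _))
    exact abs_integral_le_of_abs_le fun ω => hC _ _
  let σ := (Nat.divModEquiv K).symm
  have hsum' : Summable fun p : ℕ × Fin K => e (σ p) := σ.summable_iff.2 hsum
  have h1 : S.costFrom (M * K) γ = ∑' p : ℕ × Fin K, e (σ p) := (σ.tsum_eq e).symm
  rw [h1, Summable.tsum_prod hsum']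
  refine tsum_congr fun k => ?_
  rw [tsum_fintype, integral_finsetSum _ fun r _ => (S.integrable_cost γ (M + k) r).const_mul _,
    Finset.mul_sum]
  refine Finset.sum_congr rfl fun r _ => ?_
  have ht : M * K + σ (k, r) = (M + k) * K + r := by
    simp only [σ, Nat.divModEquiv_symm_apply]
    ring
  simp only [e, ht]
  rw [integral_const_mul, ← mul_assoc, ← pow_mul, ← pow_add, Nat.mul_comm K (M + k)]

variable [∀ i, Finite (U i)] [∀ i, MeasurableSingletonClass (U i)] [∀ i, Nonempty (U i)]
  [∀ i, StandardBorelSpace (Y i)]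

theorem TeamModel.measurable_stageCost_filter (S : TeamModel N X Y U V W Ω) {K : ℕ} (M : ℕ)
    (r : Fin K) : Measurable fun p : WindowState S K M × ActionMap U S.ψ K =>
      S.stageCost (S.filter p.1) p.2 r :=
  (S.measurable_stageCost r).comp (f := fun p : WindowState S K M × ActionMap U S.ψ K =>
    (S.filter p.1, p.2)) (((S.measurable_filter K M).comp measurable_fst).prodMk measurable_snd)

variable [StandardBorelSpace X] [Nonempty X]

/-- The conditional expectation of the cost of a period is the cost of the window process. The past
of the window process is coarser than the common information, but the filter of the window state is
the predictor, which determines the conditional law of the period. -/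
theorem TeamModel.condExp_cost (S : TeamModel N X Y U V W Ω) {K : ℕ} [NeZero K] (M : ℕ)
    (γ : TeamPolicy S K) (k : ℕ) :
    S.P[fun ω => ∑ r : Fin K, S.β ^ (r : ℕ) *
        S.c (S.stateAt γ ((M + k) * K + r) ω) (S.controlAt γ ((M + k) * K + r) ω) |
      pastSigma (S.window M γ) (fun k => S.action γ (M + k)) k]
      =ᵐ[S.P] fun ω => S.windowCost (S.window M γ k ω) (S.action γ (M + k) ω) := by
  obtain ⟨C, hC⟩ := S.bounded_c
  have hβ (r : Fin K) : |S.β ^ (r : ℕ)| ≤ 1 := by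
    rw [abs_of_nonneg (pow_nonneg S.β_pos.le _)]
    exact pow_le_one₀ S.β_pos.le S.β_lt_one.le
  have hsum : (fun ω => ∑ r : Fin K, S.β ^ (r : ℕ) *
      S.c (S.stateAt γ ((M + k) * K + r) ω) (S.controlAt γ ((M + k) * K + r) ω)) =
      ∑ r : Fin K, fun ω => S.β ^ (r : ℕ) *
        S.c (S.stateAt γ ((M + k) * K + r) ω) (S.controlAt γ ((M + k) * K + r) ω) := by
    funext ω; rw [Finset.sum_apply]
  rw [hsum]
  refine (condExp_finsetSum
    (fun r _ => (S.integrable_cost γ (M + k) r).const_mul (S.β ^ (r : ℕ))) _).trans ?_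
  have hr (r : Fin K) : S.P[fun ω => S.β ^ (r : ℕ) *
        S.c (S.stateAt γ ((M + k) * K + r) ω) (S.controlAt γ ((M + k) * K + r) ω) |
      pastSigma (S.window M γ) (fun k => S.action γ (M + k)) k] =ᵐ[S.P]
      fun ω => S.β ^ (r : ℕ) *
        S.stageCost (S.filter (S.window M γ k ω)) (S.action γ (M + k) ω) r := by
    simp_rw [S.cost_eq]
    refine condExp_of_map_eq_compProd (C := C) (S.measurable_info γ (M + k))
      ((S.measurable_period γ (M + k) r.2.le).prodMk (S.measurable_stageObs γ (M + k) r.2.le))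
      (S.map_obs_eq_compProd γ (M + k) r.2.le) (f := fun I p => S.β ^ (r : ℕ) *
        S.c p.1.1 (S.nextControl (γ.act (M + k) I) r.2 p.1 p.2))
      ((S.measurable_infoCost γ (M + k) r).const_mul _) (fun I p => ?_)
      (S.pastSigma_window_le M γ k) ?_ ?_
    · rw [abs_mul]
      exact (mul_le_mul (hβ r) (hC _ _) (abs_nonneg _) zero_le_one).trans (one_mul C).le
    · have h1 : Measurable fun p : WindowState S K M × ActionMap U S.ψ K =>
          S.β ^ (r : ℕ) * S.stageCost (S.filter p.1) p.2 r :=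
        (S.measurable_stageCost_filter M r).const_mul _
      have h2 := measurable_pastSigma (S.window M γ) (fun k => S.action γ (M + k)) k
      have h3 := h1.comp h2
      exact h3
    · filter_upwards [S.ae_filter_window M γ k] with ω hω
      rw [hω, S.stageCost_eq, integral_const_mul]
      rfl
  filter_upwards [ae_all_iff.2 hr] with ω hω
  rw [Finset.sum_apply]
  exact Finset.sum_congr rfl fun r _ => hω r

theorem TeamModel.costFrom_eq_window (S : TeamModel N X Y U V W Ω) {K : ℕ} [NeZero K] (M : ℕ)
    (γ : TeamPolicy S K) : S.costFrom (M * K) γ = ∑' k : ℕ, (S.β ^ K) ^ (M + k) *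
      ∫ ω, S.windowCost (S.window M γ k ω) (S.action γ (M + k) ω) ∂S.P := by
  rw [S.costFrom_eq_tsum]
  refine tsum_congr fun k => ?_
  congr 1
  rw [← integral_congr_ae (S.condExp_cost M γ k)]
  exact (integral_condExp ((S.pastSigma_window_le M γ k).trans
    (S.measurable_info γ (M + k)).comap_le)).symm

theorem TeamModel.costFrom_eq_predictor (S : TeamModel N X Y U V W Ω) {K : ℕ} [NeZero K] (M : ℕ)
    (γ : TeamPolicy S K) : S.costFrom (M * K) γ = ∑' k : ℕ, (S.β ^ K) ^ (M + k) *
      ∫ ω, S.periodCost (S.predictor γ (M + k) ω) (S.action γ (M + k) ω) ∂S.P := by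
  rw [S.costFrom_eq_window]
  refine tsum_congr fun k => ?_
  congr 1
  refine integral_congr_ae ?_
  filter_upwards [S.ae_filter_window M γ k] with ω hω
  rw [TeamModel.windowCost, hω]

end Model

/-! ### Actions with the same Young measures -/

section Young

variable {N : ℕ} {Y U : Fin N → Type*} [∀ i, MeasurableSpace (Y i)] [∀ i, MeasurableSpace (U i)]
  {ψ : ∀ i, ProbabilityMeasure (Y i)} {K : ℕ}

theorem ActionMap.measurable_of_youngLaw_eq {D : Type*} [MeasurableSpace D]
    {t : D → ActionMap U ψ K} (h : ∀ d d' i r, (t d i r).youngLaw = (t d' i r).youngLaw) :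
    Measurable t := by
  refine measurable_pi_iff.2 fun i => measurable_pi_iff.2 fun r => measurable_comap_iff.2 ?_
  exact measurable_const' fun d d' => h d d' i r

/-- The σ-algebra on actions is generated by the Young measures, so that measurable functions do
not distinguish actions with the same Young measures. -/
theorem ActionMap.eq_of_youngLaw_eq {β : Type*} [MeasurableSpace β] [MeasurableSingletonClass β]
    {f : ActionMap U ψ K → β} (hf : Measurable f) {a a' : ActionMap U ψ K}
    (h : ∀ i r, (a i r).youngLaw = (a' i r).youngLaw) : f a = f a' := by
  let t : Bool → ActionMap U ψ K := fun b => if b then a else a'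
  -- The map `t` is measurable even for the trivial σ-algebra on `Bool`.
  have ht := @ActionMap.measurable_of_youngLaw_eq N Y U _ _ ψ K Bool ⊥ t fun d d' i r => by
    cases d <;> cases d' <;> simp [t, h i r]
  have hs := (hf.comp ht) (measurableSet_singleton (f a))
  rcases MeasurableSpace.measurableSet_bot_iff.1 hs with h0 | h1
  · have : true ∈ (f ∘ t) ⁻¹' {f a} := by simp [t]
    simp [h0] at this
  · have : false ∈ (f ∘ t) ⁻¹' {f a} := by simp [h1]
    simpa [t] using this.symm

end Young

section Model

variable {N : ℕ} {X : Type*} {Y U : Fin N → Type*} {V : Type*} {W : Fin N → Type*} {Ω : Type*}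
  [MeasurableSpace X] [∀ i, MeasurableSpace (Y i)] [∀ i, MeasurableSpace (U i)]
  [MeasurableSpace V] [∀ i, MeasurableSpace (W i)] [MeasurableSpace Ω]

theorem TeamModel.windowCost_congr [∀ i, Finite (U i)]
    [∀ i, MeasurableSingletonClass (U i)] [∀ i, Nonempty (U i)] [∀ i, StandardBorelSpace (Y i)]
    (S : TeamModel N X Y U V W Ω) {K M : ℕ}
    (z : WindowState S K M) {a a' : ActionMap U S.ψ K}
    (h : ∀ i r, (a i r).youngLaw = (a' i r).youngLaw) : S.windowCost z a = S.windowCost z a' := by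
  have h2 : Measurable fun a : ActionMap U S.ψ K => S.periodCost (S.filter z) a :=
    (S.measurable_periodCost K).comp measurable_prodMk_left
  exact ActionMap.eq_of_youngLaw_eq h2 h

/-! ### Policies that agree in the first periods -/

theorem TeamModel.history_congr (S : TeamModel N X Y U V W Ω) {K : ℕ} {γ γ' : TeamPolicy S K}
    {n : ℕ} (h : ∀ q < n, γ.act q = γ'.act q) (ω : Ω) : S.history γ ω n = S.history γ' ω n := by
  induction n with
  | zero => rfl
  | succ n ih =>
    simp only [TeamModel.history, ih fun q hq => h q (hq.trans n.lt_succ_self),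
      h n n.lt_succ_self]

theorem TeamModel.info_congr (S : TeamModel N X Y U V W Ω) {K : ℕ} {γ γ' : TeamPolicy S K}
    {n : ℕ} (h : ∀ q < n, γ.act q = γ'.act q) (ω : Ω) : S.info γ n ω = S.info γ' n ω :=
  congrArg Prod.snd (S.history_congr h ω)

variable [StandardBorelSpace X] [Nonempty X]

theorem TeamModel.infoPredictor_congr (S : TeamModel N X Y U V W Ω) {K : ℕ}
    {γ γ' : TeamPolicy S K} {n : ℕ} (h : ∀ q < n, γ.act q = γ'.act q) :
    S.infoPredictor γ n = S.infoPredictor γ' n := by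
  unfold TeamModel.infoPredictor
  have h1 : (fun ω => (S.history γ ω n).1) = fun ω => (S.history γ' ω n).1 :=
    funext fun ω => congrArg Prod.fst (S.history_congr h ω)
  have h2 : (fun ω => (S.history γ ω n).2) = fun ω => (S.history γ' ω n).2 :=
    funext fun ω => congrArg Prod.snd (S.history_congr h ω)
  funext I
  refine Subtype.ext ?_
  change condDistrib _ _ _ I = condDistrib _ _ _ I
  rw [h1, h2]

theorem TeamModel.infoWindow_congr (S : TeamModel N X Y U V W Ω) {K M : ℕ}
    {γ γ' : TeamPolicy S K} {k : ℕ} (h : ∀ q < M + k, γ.act q = γ'.act q) :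
    S.infoWindow M γ k = S.infoWindow M γ' k := by
  funext I
  unfold TeamModel.infoWindow
  rw [S.infoPredictor_congr fun q hq => h q (by omega)]
  simp_rw [fun j : Fin M => h (k + j) (by omega)]

theorem TeamModel.window_congr (S : TeamModel N X Y U V W Ω) {K M : ℕ}
    {γ γ' : TeamPolicy S K} {k : ℕ} (h : ∀ q < M + k, γ.act q = γ'.act q) (ω : Ω) :
    S.window M γ k ω = S.window M γ' k ω := by
  rw [S.window_eq, S.window_eq, S.infoWindow_congr h, S.info_congr h]

theorem TeamModel.predictor_congr (S : TeamModel N X Y U V W Ω) {K : ℕ}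
    {γ γ' : TeamPolicy S K} {q : ℕ} (h : ∀ p < q, γ.act p = γ'.act p) (ω : Ω) :
    S.predictor γ q ω = S.predictor γ' q ω := by
  rw [S.predictor_eq, S.predictor_eq, S.infoPredictor_congr h, S.info_congr h]

/-- The window states up to period `M + k`, as a function of the common information. -/
noncomputable def TeamModel.infoWindows (S : TeamModel N X Y U V W Ω) {K : ℕ} (M : ℕ)
    (γ : TeamPolicy S K) (k : ℕ) (I : CommonInfo Y U K (M + k)) :
    Fin (k + 1) → WindowState S K M :=
  fun j => S.infoWindow M γ j (infoTake (by omega) I)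

theorem TeamModel.measurable_infoWindows (S : TeamModel N X Y U V W Ω) {K : ℕ} (M : ℕ)
    (γ : TeamPolicy S K) (k : ℕ) : Measurable (S.infoWindows M γ k) :=
  measurable_pi_iff.2 fun j => (S.measurable_infoWindow M γ j).comp (measurable_infoTake _)

theorem TeamModel.infoWindows_info (S : TeamModel N X Y U V W Ω) {K : ℕ} (M : ℕ)
    (γ : TeamPolicy S K) (k : ℕ) (ω : Ω) :
    S.infoWindows M γ k (S.info γ (M + k) ω) = fun j : Fin (k + 1) => S.window M γ j ω := by
  funext j
  rw [S.window_eq, TeamModel.infoWindows, S.infoTake_info]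

theorem TeamModel.infoWindows_congr (S : TeamModel N X Y U V W Ω) {K M : ℕ}
    {γ γ' : TeamPolicy S K} {k : ℕ} (h : ∀ q < M + k, γ.act q = γ'.act q) :
    S.infoWindows M γ k = S.infoWindows M γ' k := by
  funext I j
  exact congrFun (S.infoWindow_congr fun q hq => h q (by omega)) _

variable [∀ i, Finite (U i)] [∀ i, MeasurableSingletonClass (U i)] [∀ i, Nonempty (U i)]
  [∀ i, StandardBorelSpace (Y i)]

/-! ### Implementation of policies of the window process -/

/-- The jointly measurable version of an action. -/
noncomputable def ActionMap.evalMap {ψ : ∀ i, ProbabilityMeasure (Y i)} {K : ℕ}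
    (a : ActionMap U ψ K) : ActionMap U ψ K :=
  fun i r => ⟨(a i r).eval, LocalMap.measurable_eval.of_uncurry_left⟩

theorem ActionMap.youngLaw_evalMap {ψ : ∀ i, ProbabilityMeasure (Y i)} {K : ℕ}
    (a : ActionMap U ψ K) (i : Fin N) (r : Fin K) :
    (a.evalMap i r).youngLaw = (a i r).youngLaw := by
  funext up
  refine Measure.map_congr ?_
  filter_upwards [LocalMap.eval_ae_eq (a i r) up] with y hy
  exact Prod.ext rfl hy

/-- The policy `γ`, changed in period `q` to the measurable selection `F` of actions. -/
noncomputable def TeamPolicy.setAct {S : TeamModel N X Y U V W Ω} {K : ℕ} (γ : TeamPolicy S K)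
    (q : ℕ) (F : CommonInfo Y U K q → ActionMap U S.ψ K) (hF : Measurable F) : TeamPolicy S K where
  act := Function.update γ.act q fun I => (F I).evalMap
  measurable_act p i r := by
    by_cases h : p = q
    · subst h
      simp only [Function.update_self]
      exact LocalMap.measurable_eval.comp (((measurable_pi_apply r).comp
        ((measurable_pi_apply i).comp (hF.comp measurable_fst))).prodMk measurable_snd)
    · simp only [Function.update_of_ne h]
      exact γ.measurable_act p i r

/-- Policies that use `g` in the periods `M, …, M + k - 1` and `γ₀` in the other periods. -/
noncomputable def TeamModel.implementTo (S : TeamModel N X Y U V W Ω) {K M : ℕ}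
    (γ₀ : TeamPolicy S K) (g : HistoryPolicy (WindowState S K M) (ActionMap U S.ψ K)) :
    ℕ → TeamPolicy S K
  | 0 => γ₀
  | k + 1 => (S.implementTo γ₀ g k).setAct (M + k)
      (fun I => g.act k (S.infoWindows M (S.implementTo γ₀ g k) k I))
      ((g.measurable_act k).comp (S.measurable_infoWindows M _ k))

theorem TeamModel.implementTo_act_eq (S : TeamModel N X Y U V W Ω) {K M : ℕ}
    (γ₀ : TeamPolicy S K) (g : HistoryPolicy (WindowState S K M) (ActionMap U S.ψ K))
    {k n q : ℕ} (hkn : k ≤ n) (hq : q < M + k) :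
    (S.implementTo γ₀ g n).act q = (S.implementTo γ₀ g k).act q := by
  induction n, hkn using Nat.le_induction with
  | base => rfl
  | succ n hn ih =>
    rw [← ih]
    exact Function.update_of_ne (by omega) _ _

/-- The team policy that uses `γ₀` in the periods before `M`, and implements the policy `g` of the
window process from period `M` on: agents compute the window states from the common information. -/
noncomputable def TeamModel.implement (S : TeamModel N X Y U V W Ω) {K M : ℕ}
    (γ₀ : TeamPolicy S K) (g : HistoryPolicy (WindowState S K M) (ActionMap U S.ψ K)) :
    TeamPolicy S K where
  act q := (S.implementTo γ₀ g (q + 1 - M)).act q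
  measurable_act q := (S.implementTo γ₀ g (q + 1 - M)).measurable_act q

theorem TeamModel.implement_act_of_lt (S : TeamModel N X Y U V W Ω) {K M : ℕ}
    (γ₀ : TeamPolicy S K) (g : HistoryPolicy (WindowState S K M) (ActionMap U S.ψ K)) {k q : ℕ}
    (hq : q < M + k) : (S.implement γ₀ g).act q = (S.implementTo γ₀ g k).act q :=
  (S.implementTo_act_eq γ₀ g (by omega) (by omega)).symm

theorem TeamModel.implement_act_add (S : TeamModel N X Y U V W Ω) {K M : ℕ}
    (γ₀ : TeamPolicy S K) (g : HistoryPolicy (WindowState S K M) (ActionMap U S.ψ K)) (k : ℕ)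
    (I : CommonInfo Y U K (M + k)) : (S.implement γ₀ g).act (M + k) I =
      (g.act k (S.infoWindows M (S.implement γ₀ g) k I)).evalMap := by
  rw [S.implement_act_of_lt γ₀ g (k := k + 1) (by omega),
    S.infoWindows_congr fun q hq => S.implement_act_of_lt γ₀ g hq]
  exact congrFun (Function.update_self (M + k) (fun I => ActionMap.evalMap
    (g.act k (S.infoWindows M (S.implementTo γ₀ g k) k I))) (S.implementTo γ₀ g k).act) I

theorem TeamModel.youngLaw_implement (S : TeamModel N X Y U V W Ω) {K M : ℕ}
    (γ₀ : TeamPolicy S K) (g : HistoryPolicy (WindowState S K M) (ActionMap U S.ψ K)) (k : ℕ)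
    (ω : Ω) (i : Fin N) (r : Fin K) : (S.action (S.implement γ₀ g) (M + k) ω i r).youngLaw =
      (g.act k (fun j : Fin (k + 1) => S.window M (S.implement γ₀ g) j ω) i r).youngLaw := by
  have h : S.action (S.implement γ₀ g) (M + k) ω =
      (g.act k (fun j : Fin (k + 1) => S.window M (S.implement γ₀ g) j ω)).evalMap := by
    rw [← S.infoWindows_info]
    exact S.implement_act_add γ₀ g k _
  rw [h, ActionMap.youngLaw_evalMap]

/-- If the actions have the Young measures prescribed by `g`, then the window process has the law
of the decision process under `g`. -/
theorem TeamModel.map_windows_eq_histLaw (S : TeamModel N X Y U V W Ω) {K M : ℕ} [NeZero M]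
    (γ : TeamPolicy S K) (g : HistoryPolicy (WindowState S K M) (ActionMap U S.ψ K))
    (h : ∀ k ω i r, (S.action γ (M + k) ω i r).youngLaw =
      (g.act k (fun j : Fin (k + 1) => S.window M γ j ω) i r).youngLaw) (k : ℕ) :
    S.P.map (fun ω (j : Fin (k + 1)) => S.window M γ j ω) =
      histLaw (S.windowKernel K M) (S.P.map (S.window M γ 0)) g k := by
  have hmeas (k : ℕ) : Measurable fun ω (j : Fin (k + 1)) => S.window M γ j ω :=
    measurable_pi_iff.2 fun j => S.measurable_window M γ j
  induction k with
  | zero =>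
    rw [histLaw, Measure.map_map (by fun_prop) (S.measurable_window M γ 0)]
    congr 1
    funext ω j
    rw [Fin.fin_one_eq_zero j]
    rfl
  | succ k ih =>
    have hstep : Measurable fun s : Fin (k + 1) → WindowState S K M =>
        (S.windowKernel K M (s (Fin.last k), g.act k s)).map fun s' =>
          (Fin.snoc (α := fun _ => WindowState S K M) s s' : Fin (k + 2) → _) := by
      refine measurable_map_param' (κ := fun s : Fin (k + 1) → WindowState S K M =>
        S.windowKernel K M (s (Fin.last k), g.act k s)) ?_ ?_
      · exact (S.windowKernel K M).measurable.comp
          ((measurable_pi_apply _).prodMk (g.measurable_act k))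
      · exact measurable_finSnoc measurable_fst measurable_snd
    rw [histLaw, ← ih]
    refine Measure.ext_of_lintegral _ fun f hf => ?_
    rw [lintegral_map hf (hmeas (k + 1)), Measure.lintegral_bind hstep.aemeasurable hf.aemeasurable,
      lintegral_map (f := fun s => ∫⁻ x, f x ∂_)
        (Measure.measurable_lintegral hf |>.comp hstep) (hmeas k)]
    have hF : Measurable (Function.uncurry fun (I : CommonInfo Y U K (M + k))
        (s : StageData X Y U K) => f (Fin.snoc (α := fun _ => WindowState S K M)
          (S.infoWindows M γ k I)
          (S.windowStep (S.infoWindow M γ k I) (γ.act (M + k) I) s.2.1))) := by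
      refine hf.comp (measurable_finSnoc ((S.measurable_infoWindows M γ k).comp measurable_fst) ?_)
      exact S.measurable_windowStep ((S.measurable_infoWindow M γ k).comp measurable_fst)
        ((γ.measurable_map_action (M + k)).comp measurable_fst) measurable_snd.snd.fst
    have h1 := S.lintegral_period γ (M + k) le_rfl hF
    refine Eq.trans ?_ (h1.trans ?_)
    · refine lintegral_congr_ae ?_
      filter_upwards [S.ae_window_succ M γ k] with ω hω
      rw [S.infoWindows_info]
      congr 1
      funext j
      refine Fin.lastCases ?_ (fun j => ?_) j
      · rw [Fin.snoc_last, Fin.val_last, hω, S.window_eq]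
        rfl
      · rw [Fin.snoc_castSucc]
        rfl
    · refine lintegral_congr_ae ?_
      filter_upwards [S.ae_filter_window M γ k] with ω hω
      have hsn : Measurable fun s' => (Fin.snoc (α := fun _ => WindowState S K M)
          (fun j : Fin (k + 1) => S.window M γ j ω) s' : Fin (k + 2) → _) :=
        measurable_finSnoc measurable_const measurable_id
      -- The transition law depends on the action only through its Young measures.
      have hker : S.windowKernel K M (S.window M γ k ω, g.act k fun j => S.window M γ j ω) =
          S.windowKernel K M (S.window M γ k ω, S.action γ (M + k) ω) := by
        ext B hB
        exact (ActionMap.eq_of_youngLaw_eq (((S.windowKernel K M).measurable_coe hB).comp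
          (measurable_const.prodMk measurable_id)) (h k ω)).symm
      rw [lintegral_map hf hsn]
      refine Eq.trans ?_ (congrArg (fun μ => ∫⁻ s', f (Fin.snoc (α := fun _ => WindowState S K M)
          (fun j : Fin (k + 1) => S.window M γ j ω) s') ∂μ) hker.symm)
      refine Eq.trans ?_ (lintegral_map (hf.comp hsn) (S.measurable_windowStep_data
        (S.window M γ k ω) (S.action γ (M + k) ω))).symm
      rw [hω, S.infoWindows_info, S.window_eq]
      rfl

theorem TeamModel.costFrom_eq_expectedCost (S : TeamModel N X Y U V W Ω) {K M : ℕ} [NeZero K]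
    [NeZero M] (γ : TeamPolicy S K) (g : HistoryPolicy (WindowState S K M) (ActionMap U S.ψ K))
    (h : ∀ k ω i r, (S.action γ (M + k) ω i r).youngLaw =
      (g.act k (fun j : Fin (k + 1) => S.window M γ j ω) i r).youngLaw) :
    S.costFrom (M * K) γ = (S.β ^ K) ^ M *
      expectedCost (S.windowKernel K M) S.windowCost (S.β ^ K) (S.P.map (S.window M γ 0)) g := by
  rw [S.costFrom_eq_window, expectedCost, ← tsum_mul_left]
  refine tsum_congr fun k => ?_
  have hmeas : Measurable fun ω (j : Fin (k + 1)) => S.window M γ j ω :=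
    measurable_pi_iff.2 fun j => S.measurable_window M γ j
  have hcost : Measurable fun s : Fin (k + 1) → WindowState S K M =>
      S.windowCost (s (Fin.last k)) (g.act k s) :=
    (S.measurable_windowCost K M).comp (f := fun s : Fin (k + 1) → WindowState S K M =>
      (s (Fin.last k), g.act k s)) ((measurable_pi_apply _).prodMk (g.measurable_act k))
  have h1 := integral_map (μ := S.P) hmeas.aemeasurable hcost.aestronglyMeasurable
  rw [S.map_windows_eq_histLaw γ g h k] at h1
  rw [h1, pow_add, mul_assoc]
  congr 2
  exact integral_congr_ae (Filter.Eventually.of_forall fun ω => S.windowCost_congr _ (h k ω))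

theorem TeamModel.window_implement_zero (S : TeamModel N X Y U V W Ω) {K M : ℕ}
    (γ₀ : TeamPolicy S K) (g : HistoryPolicy (WindowState S K M) (ActionMap U S.ψ K)) :
    S.window M (S.implement γ₀ g) 0 = S.window M γ₀ 0 :=
  funext fun ω => S.window_congr (fun _ hq => S.implement_act_of_lt γ₀ g (k := 0) hq) ω

end Model

section MDP

variable {𝓢 𝓐 : Type*} [MeasurableSpace 𝓢] [MeasurableSpace 𝓐]

/-! ### Markov policies: marginal laws and expected costs -/

/-- The law of the state at time `k` under the Markov policy `a`. -/
noncomputable def stateLaw (κ : Kernel (𝓢 × 𝓐) 𝓢) (ν : Measure 𝓢) (a : ℕ → 𝓢 → 𝓐) : ℕ → Measure 𝓢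
  | 0 => ν
  | k + 1 => (stateLaw κ ν a k).bind fun s => κ (s, a k s)

theorem stateLaw_succ' (κ : Kernel (𝓢 × 𝓐) 𝓢) (ν : Measure 𝓢) (a : ℕ → 𝓢 → 𝓐) (k : ℕ) :
    stateLaw κ ν a (k + 1) =
      stateLaw κ (ν.bind fun s => κ (s, a 0 s)) (fun k => a (k + 1)) k := by
  induction k with
  | zero => rfl
  | succ k ih => rw [stateLaw, ih]; rfl

theorem measurable_kernel_comp (κ : Kernel (𝓢 × 𝓐) 𝓢) {a : 𝓢 → 𝓐} (ha : Measurable a) :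
    Measurable fun s => κ (s, a s) :=
  κ.measurable.comp (measurable_id.prodMk ha)

theorem isProbabilityMeasure_bind_kernel (κ : Kernel (𝓢 × 𝓐) 𝓢) [IsMarkovKernel κ] (ν : Measure 𝓢)
    [IsProbabilityMeasure ν] {a : 𝓢 → 𝓐} (ha : Measurable a) :
    IsProbabilityMeasure (ν.bind fun s => κ (s, a s)) :=
  isProbabilityMeasure_bind (measurable_kernel_comp κ ha).aemeasurable
    (Filter.Eventually.of_forall fun _ => inferInstance)

theorem isProbabilityMeasure_stateLaw (κ : Kernel (𝓢 × 𝓐) 𝓢) [IsMarkovKernel κ] (ν : Measure 𝓢)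
    [IsProbabilityMeasure ν] {a : ℕ → 𝓢 → 𝓐} (ha : ∀ k, Measurable (a k)) (k : ℕ) :
    IsProbabilityMeasure (stateLaw κ ν a k) := by
  induction k with
  | zero => assumption
  | succ k ih => exact isProbabilityMeasure_bind_kernel κ _ (ha k)

theorem measurable_histLaw_step (κ : Kernel (𝓢 × 𝓐) 𝓢) [IsMarkovKernel κ] (g : HistoryPolicy 𝓢 𝓐)
    (k : ℕ) : Measurable fun s : Fin (k + 1) → 𝓢 =>
      (κ (s (Fin.last k), g.act k s)).map fun s' =>
        (Fin.snoc (α := fun _ => 𝓢) s s' : Fin (k + 2) → 𝓢) := by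
  refine measurable_map_param' (κ := fun s : Fin (k + 1) → 𝓢 => κ (s (Fin.last k), g.act k s))
    ?_ (measurable_finSnoc measurable_fst measurable_snd)
  exact κ.measurable.comp ((measurable_pi_apply _).prodMk (g.measurable_act k))

theorem isProbabilityMeasure_histLaw (κ : Kernel (𝓢 × 𝓐) 𝓢) [IsMarkovKernel κ] (ν : Measure 𝓢)
    [IsProbabilityMeasure ν] (g : HistoryPolicy 𝓢 𝓐) (k : ℕ) :
    IsProbabilityMeasure (histLaw κ ν g k) := by
  induction k with
  | zero => exact Measure.isProbabilityMeasure_map (by fun_prop)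
  | succ k ih =>
    refine isProbabilityMeasure_bind (measurable_histLaw_step κ g k).aemeasurable
      (Filter.Eventually.of_forall fun s => Measure.isProbabilityMeasure_map ?_)
    exact (measurable_finSnoc measurable_const measurable_id).aemeasurable

theorem map_last_histLaw (κ : Kernel (𝓢 × 𝓐) 𝓢) [IsMarkovKernel κ] (ν : Measure 𝓢)
    (g : MarkovPolicy 𝓢 𝓐) (k : ℕ) :
    (histLaw κ ν g.toHistory k).map (fun s => s (Fin.last k)) = stateLaw κ ν g.act k := by
  induction k with
  | zero =>
    rw [histLaw, Measure.map_map (by fun_prop) (by fun_prop)]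
    exact Measure.map_id
  | succ k ih =>
    rw [histLaw, stateLaw, ← ih]
    refine Measure.ext_of_lintegral _ fun f hf => ?_
    have hstep := measurable_histLaw_step κ g.toHistory k
    have hg := measurable_kernel_comp κ (g.measurable_act k)
    have hlast (k : ℕ) : Measurable fun s : Fin (k + 1) → 𝓢 => s (Fin.last k) :=
      measurable_pi_apply _
    rw [lintegral_map hf (hlast (k + 1)),
      Measure.lintegral_bind (f := fun s => f (s (Fin.last (k + 1)))) hstep.aemeasurable
        (hf.comp (hlast (k + 1))).aemeasurable,
      Measure.lintegral_bind hg.aemeasurable hf.aemeasurable,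
      lintegral_map (f := fun s => ∫⁻ x, f x ∂κ (s, g.act k s))
        ((Measure.measurable_lintegral hf).comp hg) (hlast k)]
    refine lintegral_congr fun s => ?_
    have hf' : Measurable fun s : Fin (k + 2) → 𝓢 => f (s (Fin.last (k + 1))) :=
      hf.comp (hlast (k + 1))
    rw [lintegral_map hf' (measurable_finSnoc measurable_const measurable_id')]
    simp [MarkovPolicy.toHistory]

theorem expectedCost_toHistory (κ : Kernel (𝓢 × 𝓐) 𝓢) [IsMarkovKernel κ] {r : 𝓢 → 𝓐 → ℝ}
    (hr : Measurable (Function.uncurry r)) (b : ℝ) (ν : Measure 𝓢) (g : MarkovPolicy 𝓢 𝓐) :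
    expectedCost κ r b ν g.toHistory =
      ∑' k : ℕ, b ^ k * ∫ s, r s (g.act k s) ∂stateLaw κ ν g.act k := by
  refine tsum_congr fun k => ?_
  have hm : Measurable fun s => r s (g.act k s) :=
    hr.comp (measurable_id.prodMk (g.measurable_act k))
  rw [← map_last_histLaw, integral_map (measurable_pi_apply _).aemeasurable
    hm.aestronglyMeasurable]
  rfl

/-- The marginal laws of a decision process whose states are mapped to the states of another one,
when the policy only depends on the image. -/
theorem map_stateLaw_comp {𝓢' : Type*} [MeasurableSpace 𝓢'] {κ : Kernel (𝓢 × 𝓐) 𝓢}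
    {κ' : Kernel (𝓢' × 𝓐) 𝓢'} {f : 𝓢 → 𝓢'} (hf : Measurable f)
    (h : ∀ s a, (κ (s, a)).map f = κ' (f s, a)) (ν : Measure 𝓢) {a : ℕ → 𝓢' → 𝓐}
    (ha : ∀ k, Measurable (a k)) (k : ℕ) :
    (stateLaw κ ν (fun k s => a k (f s)) k).map f = stateLaw κ' (ν.map f) a k := by
  induction k with
  | zero => rfl
  | succ k ih =>
    rw [stateLaw, stateLaw, ← ih]
    have h1 : Measurable fun s => κ (s, a k (f s)) := measurable_kernel_comp κ ((ha k).comp hf)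
    have h2 := measurable_kernel_comp κ' (ha k)
    refine Measure.ext_of_lintegral _ fun F hF => ?_
    rw [lintegral_map hF hf, Measure.lintegral_bind (f := fun s => F (f s)) h1.aemeasurable
        (hF.comp hf).aemeasurable,
      Measure.lintegral_bind h2.aemeasurable hF.aemeasurable,
      lintegral_map (f := fun s => ∫⁻ x, F x ∂κ' (s, a k s))
        ((Measure.measurable_lintegral hF).comp h2) hf]
    refine lintegral_congr fun s => ?_
    rw [← h, lintegral_map hF hf]

theorem expectedCost_comp {𝓢' : Type*} [MeasurableSpace 𝓢'] {κ : Kernel (𝓢 × 𝓐) 𝓢}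
    [IsMarkovKernel κ] {κ' : Kernel (𝓢' × 𝓐) 𝓢'} [IsMarkovKernel κ'] {f : 𝓢 → 𝓢'}
    (hf : Measurable f) (h : ∀ s a, (κ (s, a)).map f = κ' (f s, a)) {r : 𝓢' → 𝓐 → ℝ}
    (hr : Measurable (Function.uncurry r)) (b : ℝ) (ν : Measure 𝓢) (g : MarkovPolicy 𝓢' 𝓐) :
    expectedCost κ (fun s a => r (f s) a) b ν (g.comp f hf).toHistory =
      expectedCost κ' r b (ν.map f) g.toHistory := by
  have hr' : Measurable (Function.uncurry fun s a => r (f s) a) :=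
    hr.comp ((hf.comp measurable_fst).prodMk measurable_snd)
  rw [expectedCost_toHistory κ hr', expectedCost_toHistory κ' hr]
  refine tsum_congr fun k => ?_
  have hm : Measurable fun s => r s (g.act k s) :=
    hr.comp (measurable_id.prodMk (g.measurable_act k))
  rw [← map_stateLaw_comp hf h ν g.measurable_act, integral_map hf.aemeasurable
    hm.aestronglyMeasurable]
  rfl

/-! ### Bounds for discounted sums -/

theorem summable_discounted {b C : ℝ} (hb0 : 0 ≤ b) (hb1 : b < 1) {e : ℕ → ℝ}
    (he : ∀ k, |e k| ≤ C) : Summable fun k => b ^ k * e k := by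
  refine Summable.of_norm_bounded (g := fun k => b ^ k * C)
    ((summable_geometric_of_lt_one hb0 hb1).mul_right _) fun k => ?_
  rw [norm_mul, Real.norm_of_nonneg (pow_nonneg hb0 _)]
  exact mul_le_mul_of_nonneg_left (he k) (pow_nonneg hb0 _)

theorem abs_tsum_discounted_le {b C : ℝ} (hb0 : 0 ≤ b) (hb1 : b < 1) {e : ℕ → ℝ}
    (he : ∀ k, |e k| ≤ C) : |∑' k, b ^ k * e k| ≤ C / (1 - b) := by
  have hg : HasSum (fun k => b ^ k * C) ((1 - b)⁻¹ * C) :=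
    (hasSum_geometric_of_lt_one hb0 hb1).mul_right C
  have h := tsum_of_norm_bounded hg (f := fun k => b ^ k * e k) fun k => by
    rw [norm_mul, Real.norm_of_nonneg (pow_nonneg hb0 _)]
    exact mul_le_mul_of_nonneg_left (he k) (pow_nonneg hb0 _)
  rwa [inv_mul_eq_div] at h

theorem abs_tsum_sub_sum_le {b C : ℝ} (hb0 : 0 ≤ b) (hb1 : b < 1) {e : ℕ → ℝ}
    (he : ∀ k, |e k| ≤ C) (n : ℕ) :
    |∑' k, b ^ k * e k - ∑ k ∈ Finset.range n, b ^ k * e k| ≤ b ^ n * (C / (1 - b)) := by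
  rw [← (summable_discounted hb0 hb1 he).sum_add_tsum_nat_add n, add_sub_cancel_left]
  simp_rw [pow_add, mul_comm _ (b ^ n), mul_assoc, tsum_mul_left]
  rw [abs_mul, abs_of_nonneg (pow_nonneg hb0 n)]
  exact mul_le_mul_of_nonneg_left (abs_tsum_discounted_le hb0 hb1 fun k => he (k + n))
    (pow_nonneg hb0 n)

theorem abs_expectedCost_le (κ : Kernel (𝓢 × 𝓐) 𝓢) [IsMarkovKernel κ] {r : 𝓢 → 𝓐 → ℝ} {b C : ℝ}
    (hb0 : 0 ≤ b) (hb1 : b < 1) (hr : ∀ s a, |r s a| ≤ C) (ν : Measure 𝓢) [IsProbabilityMeasure ν]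
    (g : HistoryPolicy 𝓢 𝓐) : |expectedCost κ r b ν g| ≤ C / (1 - b) := by
  refine abs_tsum_discounted_le hb0 hb1 fun k => ?_
  have := isProbabilityMeasure_histLaw κ ν g k
  exact abs_integral_le_of_abs_le fun s => hr _ _

end MDP

section Selection

theorem integral_bind_kernel {α β : Type*} [MeasurableSpace α] [MeasurableSpace β]
    {κ : Kernel α β} [IsMarkovKernel κ] (ν : Measure α) [IsProbabilityMeasure ν] {w : β → ℝ}
    (hw : Measurable w) {D : ℝ} (hD : ∀ s, |w s| ≤ D) :
    ∫ s, w s ∂(ν.bind κ) = ∫ s, ∫ s', w s' ∂κ s ∂ν := by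
  rw [Measure.comp_eq_comp_const_apply, Kernel.integral_comp, Kernel.const_apply]
  exact integrable_of_abs_le hw hD

variable {𝓢 𝓐 : Type*} [MeasurableSpace 𝓢] [MeasurableSpace 𝓐]

/-! ### Deterministic Markov policies that improve on randomized ones -/

/-- The expected cost over `n` stages, from time `k` on, of the randomized Markov policy that draws
a seed `u` uniformly in the unit interval at each time `j` and applies the action `α j s u` in
state `s`. -/
noncomputable def seedCost (κ : Kernel (𝓢 × 𝓐) 𝓢) (r : 𝓢 → 𝓐 → ℝ) (b : ℝ)
    (α : ℕ → 𝓢 → unitInterval → 𝓐) : ℕ → ℕ → 𝓢 → ℝ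
  | 0, _, _ => 0
  | n + 1, k, s => ∫ u, (r s (α k s u) + b * ∫ s', seedCost κ r b α n (k + 1) s' ∂κ (s, α k s u))

variable {κ : Kernel (𝓢 × 𝓐) 𝓢} [IsMarkovKernel κ] {r : 𝓢 → 𝓐 → ℝ} {b C : ℝ}
  {α : ℕ → 𝓢 → unitInterval → 𝓐}

theorem measurable_stageValue (hr : Measurable (Function.uncurry r)) {w : 𝓢 → ℝ}
    (hw : Measurable w) :
    Measurable (Function.uncurry fun s a => r s a + b * ∫ s', w s' ∂κ (s, a)) :=
  hr.add ((measurable_integral_param κ.measurable (f := fun _ s' => w s')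
    (hw.comp measurable_snd)).const_mul b)

theorem abs_stageValue_le (hr : ∀ s a, |r s a| ≤ C) (hb0 : 0 ≤ b) (hb1 : b ≤ 1) {w : 𝓢 → ℝ}
    {D : ℝ} (hw : ∀ s, |w s| ≤ D) (s : 𝓢) (a : 𝓐) :
    |r s a + b * ∫ s', w s' ∂κ (s, a)| ≤ C + D := by
  refine (abs_add_le _ _).trans (add_le_add (hr s a) ?_)
  rw [abs_mul, abs_of_nonneg hb0]
  have h : |∫ s', w s' ∂κ (s, a)| ≤ D := abs_integral_le_of_abs_le hw
  exact (mul_le_of_le_one_left (abs_nonneg _) hb1).trans h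

theorem measurable_seedCost (hr : Measurable (Function.uncurry r))
    (hα : ∀ k, Measurable (Function.uncurry (α k))) (n k : ℕ) :
    Measurable (seedCost κ r b α n k) := by
  induction n generalizing k with
  | zero => exact measurable_const
  | succ n ih =>
    refine measurable_integral_param (κ := fun _ : 𝓢 => (volume : Measure unitInterval))
      measurable_const ?_
    exact (measurable_stageValue hr (ih (k + 1))).comp (measurable_fst.prodMk (hα k))

theorem abs_seedCost_le (hr : ∀ s a, |r s a| ≤ C) (hb0 : 0 ≤ b) (hb1 : b ≤ 1) (n k : ℕ) (s : 𝓢) :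
    |seedCost κ r b α n k s| ≤ n * C := by
  induction n generalizing k s with
  | zero => simp [seedCost]
  | succ n ih =>
    refine abs_integral_le_of_abs_le fun u => ?_
    refine (abs_stageValue_le hr hb0 hb1 (ih (k + 1)) s (α k s u)).trans (le_of_eq ?_)
    push_cast
    ring

/-- Fixing the seeds at suitable values, one after the other, does not increase the cost over a
finite horizon. -/
theorem exists_markov_le_seedCost [Nonempty 𝓐] (hrm : Measurable (Function.uncurry r))
    (hr : ∀ s a, |r s a| ≤ C) (hb0 : 0 ≤ b) (hb1 : b ≤ 1)
    (hα : ∀ k, Measurable (Function.uncurry (α k))) (n k : ℕ) (ν : Measure 𝓢)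
    [IsProbabilityMeasure ν] : ∃ a : ℕ → 𝓢 → 𝓐, (∀ j, Measurable (a j)) ∧
      ∑ j ∈ Finset.range n, b ^ j * ∫ s, r s (a j s) ∂stateLaw κ ν a j ≤
        ∫ s, seedCost κ r b α n k s ∂ν := by
  induction n generalizing k ν with
  | zero => exact ⟨fun _ _ => Classical.arbitrary 𝓐, fun _ => measurable_const, by simp [seedCost]⟩
  | succ n ih =>
    set w := seedCost κ r b α n (k + 1) with hw
    have hwm : Measurable w := measurable_seedCost hrm hα n (k + 1)
    have hwb (s : 𝓢) : |w s| ≤ n * C := abs_seedCost_le hr hb0 hb1 n (k + 1) s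
    have hQm : Measurable (Function.uncurry fun s u =>
        r s (α k s u) + b * ∫ s', w s' ∂κ (s, α k s u)) :=
      (measurable_stageValue hrm hwm).comp (measurable_fst.prodMk (hα k))
    have hQb (p : 𝓢 × unitInterval) := abs_stageValue_le (κ := κ) hr hb0 hb1 hwb p.1 (α k p.1 p.2)
    have hQi : Integrable (Function.uncurry fun s u =>
        r s (α k s u) + b * ∫ s', w s' ∂κ (s, α k s u)) (ν.prod volume) :=
      integrable_of_abs_le hQm hQb
    -- Some seed is at least as good as the average over all seeds.
    obtain ⟨u, hu⟩ := exists_le_integral hQi.integral_prod_right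
    simp only [Function.uncurry_apply_pair] at hu
    rw [← integral_integral_swap hQi] at hu
    have hau : Measurable fun s => α k s u := (hα k).comp measurable_prodMk_right
    have := isProbabilityMeasure_bind_kernel κ ν hau
    obtain ⟨a, ha, hle⟩ := ih (k + 1) (ν.bind fun s => κ (s, α k s u))
    refine ⟨fun j => Nat.casesOn j (fun s => α k s u) a, fun j => by cases j <;> simp [hau, ha], ?_⟩
    rw [Finset.sum_range_succ']
    simp only [pow_succ', stateLaw_succ', mul_assoc, ← Finset.mul_sum, pow_zero, one_mul]
    refine le_trans ?_ hu
    have hbind : ∫ s, w s ∂(ν.bind fun s => κ (s, α k s u)) =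
        ∫ s, ∫ s', w s' ∂κ (s, α k s u) ∂ν :=
      integral_bind_kernel (κ := κ.comap (fun s => (s, α k s u)) (measurable_id.prodMk hau))
        ν hwm hwb
    have hi1 : Integrable (fun s => r s (α k s u)) ν :=
      integrable_of_abs_le (hrm.comp (measurable_id.prodMk hau)) fun s => hr s _
    have hi2 : Integrable (fun s => ∫ s', w s' ∂κ (s, α k s u)) ν :=
      integrable_of_abs_le (measurable_integral_param (measurable_kernel_comp κ hau)
        (f := fun _ s' => w s') (hwm.comp measurable_snd)) fun s => abs_integral_le_of_abs_le hwb
    rw [integral_add hi1 (hi2.const_mul b), integral_const_mul, ← hbind, add_comm]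
    exact add_le_add_right (mul_le_mul_of_nonneg_left hle hb0) _

variable {Ω : Type*} [MeasurableSpace Ω] {P : Measure Ω} [IsProbabilityMeasure P] {Z : ℕ → Ω → 𝓢}
  {A : ℕ → Ω → 𝓐}

/-- If the randomized Markov policy given by `α` reproduces the joint laws of state and action at
each time, then it has the same cost as the controlled process. -/
theorem integral_seedCost (hrm : Measurable (Function.uncurry r)) (hr : ∀ s a, |r s a| ≤ C)
    (hb0 : 0 ≤ b) (hb1 : b ≤ 1) (hα : ∀ k, Measurable (Function.uncurry (α k)))
    (hZ : ∀ k, Measurable (Z k)) (hA : ∀ k, Measurable (A k))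
    (hlaw : ∀ k, P.map (fun ω => (Z k ω, A k ω)) =
      ((P.map (Z k)).prod volume).map fun p => (p.1, α k p.1 p.2))
    (hstep : ∀ k, P.map (Z (k + 1)) = (P.map fun ω => (Z k ω, A k ω)).bind κ) (n k : ℕ) :
    ∫ s, seedCost κ r b α n k s ∂P.map (Z k) =
      ∑ j ∈ Finset.range n, b ^ j * ∫ ω, r (Z (k + j) ω) (A (k + j) ω) ∂P := by
  induction n generalizing k with
  | zero => simp [seedCost]
  | succ n ih =>
    have hprob (k : ℕ) : IsProbabilityMeasure (P.map (Z k)) :=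
      Measure.isProbabilityMeasure_map (hZ k).aemeasurable
    have hZA : Measurable fun ω => (Z k ω, A k ω) := (hZ k).prodMk (hA k)
    have : IsProbabilityMeasure (P.map fun ω => (Z k ω, A k ω)) :=
      Measure.isProbabilityMeasure_map hZA.aemeasurable
    set w := seedCost κ r b α n (k + 1) with hw
    have hwm : Measurable w := measurable_seedCost hrm hα n (k + 1)
    have hwb (s : 𝓢) : |w s| ≤ n * C := abs_seedCost_le hr hb0 hb1 n (k + 1) s
    have hQm := measurable_stageValue (κ := κ) (b := b) hrm hwm
    have hQb (p : 𝓢 × 𝓐) := abs_stageValue_le (κ := κ) hr hb0 hb1 hwb p.1 p.2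
    have hg : Measurable fun p : 𝓢 × unitInterval => (p.1, α k p.1 p.2) :=
      measurable_fst.prodMk (hα k)
    have h1 : ∫ s, seedCost κ r b α (n + 1) k s ∂P.map (Z k) =
        ∫ p, (r p.1 p.2 + b * ∫ s', w s' ∂κ p) ∂P.map fun ω => (Z k ω, A k ω) := by
      rw [hlaw]
      refine Eq.trans ?_ (integral_map hg.aemeasurable hQm.aestronglyMeasurable).symm
      refine integral_integral (f := fun s u => r s (α k s u) + b * ∫ s', w s' ∂κ (s, α k s u)) ?_
      exact integrable_of_abs_le (hQm.comp hg) fun p => hQb (p.1, α k p.1 p.2)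
    have hi1 : Integrable (fun p : 𝓢 × 𝓐 => r p.1 p.2) (P.map fun ω => (Z k ω, A k ω)) :=
      integrable_of_abs_le hrm fun p => hr _ _
    have hi2 : Integrable (fun p => ∫ s', w s' ∂κ p) (P.map fun ω => (Z k ω, A k ω)) :=
      integrable_of_abs_le (measurable_integral_param κ.measurable
        (f := fun _ s' => w s') (hwm.comp measurable_snd)) fun s => abs_integral_le_of_abs_le hwb
    rw [h1, integral_add hi1 (hi2.const_mul b), integral_const_mul,
      ← integral_bind_kernel _ hwm hwb, ← hstep, ih (k + 1), Finset.sum_range_succ', Finset.mul_sum]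
    have h2 := integral_map hZA.aemeasurable hi1.aestronglyMeasurable
    rw [h2, add_comm]
    congr 1
    · refine Finset.sum_congr rfl fun j _ => ?_
      rw [pow_succ', mul_assoc, show k + 1 + j = k + (j + 1) by omega]
    · simp

/-- A controlled process whose actions are functions of data `I k` in standard Borel spaces is
matched, as regards the joint laws of state and action at each time, by a randomized Markov policy
driven by uniform seeds. -/
theorem exists_seed {𝓘 : Type*} [MeasurableSpace 𝓘] [StandardBorelSpace 𝓘] [Nonempty 𝓘]
    {Z : Ω → 𝓢} (hZ : Measurable Z) {I : Ω → 𝓘} (hI : Measurable I) {a : 𝓘 → 𝓐}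
    (ha : Measurable a) : ∃ α : 𝓢 → unitInterval → 𝓐, Measurable (Function.uncurry α) ∧
      P.map (fun ω => (Z ω, a (I ω))) =
        ((P.map Z).prod volume).map fun p => (p.1, α p.1 p.2) := by
  obtain ⟨f, hf, hfκ⟩ := (condDistrib I Z P).exists_measurable_map_eq_unitInterval
  refine ⟨fun s u => a (f s u), ha.comp hf, ?_⟩
  have : IsProbabilityMeasure (P.map Z) := Measure.isProbabilityMeasure_map hZ.aemeasurable
  have hsa : Measurable fun p : 𝓢 × 𝓘 => (p.1, a p.2) :=
    measurable_fst.prodMk (ha.comp measurable_snd)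
  have hsf : Measurable fun p : 𝓢 × unitInterval => (p.1, f p.1 p.2) := measurable_fst.prodMk hf
  have h1 : P.map (fun ω => (Z ω, I ω)) =
      ((P.map Z).prod volume).map fun p => (p.1, f p.1 p.2) := by
    refine (compProd_map_condDistrib hI.aemeasurable).symm.trans ?_
    refine Measure.ext_of_lintegral _ fun F hF => ?_
    rw [Measure.lintegral_compProd hF, lintegral_map hF hsf,
      lintegral_prod (fun p => F (p.1, f p.1 p.2)) (hF.comp hsf).aemeasurable]
    refine lintegral_congr fun s => ?_
    rw [← hfκ s]
    exact lintegral_map (hF.comp measurable_prodMk_left) hf.of_uncurry_left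
  have h2 := congrArg (Measure.map fun p : 𝓢 × 𝓘 => (p.1, a p.2)) h1
  rw [Measure.map_map hsa (hZ.prodMk hI), Measure.map_map hsa hsf] at h2
  exact h2

theorem IsControlledMarkov.map_succ (h : IsControlledMarkov P Z A κ) (k : ℕ) :
    P.map (Z (k + 1)) = (P.map fun ω => (Z k ω, A k ω)).bind κ := by
  have hZA : Measurable fun ω => (Z k ω, A k ω) :=
    (h.measurable_state k).prodMk (h.measurable_action k)
  have hle : pastSigma Z A k ≤ ‹MeasurableSpace Ω› := iSup_le fun j =>
    sup_le (h.measurable_state j).comap_le (h.measurable_action j).comap_le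
  have : IsProbabilityMeasure (P.map fun ω => (Z k ω, A k ω)) :=
    Measure.isProbabilityMeasure_map hZA.aemeasurable
  ext B hB
  have hκB : Measurable fun p => κ p B := κ.measurable_coe hB
  have h1 : ∫ ω, (Z (k + 1) ⁻¹' B).indicator (fun _ => (1 : ℝ)) ω ∂P =
      ∫ ω, (κ (Z k ω, A k ω)).real B ∂P := by
    rw [← integral_congr_ae (h.markov k B hB)]
    exact (integral_condExp hle).symm
  have h2 := integral_indicator_one (μ := P) (h.measurable_state (k + 1) hB)
  rw [Measure.map_apply (h.measurable_state _) hB, Measure.bind_apply hB κ.aemeasurable,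
    lintegral_map hκB hZA, ← ENNReal.toReal_eq_toReal_iff' (measure_ne_top _ _), ← measureReal_def,
    ← h2]
  · refine h1.trans ?_
    exact integral_toReal (hκB.comp hZA).aemeasurable
      (Filter.Eventually.of_forall fun ω => measure_lt_top _ _)
  · refine ((lintegral_mono fun ω => prob_le_one).trans_lt ?_).ne
    simp

/-- Deterministic Markov policies do at least as well, up to `ε`, as any controlled process with
the same kernel whose actions are functions of data in standard Borel spaces. -/
theorem IsControlledMarkov.exists_markovPolicy_le [Nonempty 𝓐] (h : IsControlledMarkov P Z A κ)
    {𝓘 : ℕ → Type*} [∀ k, MeasurableSpace (𝓘 k)] [∀ k, StandardBorelSpace (𝓘 k)]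
    [∀ k, Nonempty (𝓘 k)] {I : ∀ k, Ω → 𝓘 k} (hI : ∀ k, Measurable (I k))
    {a : ∀ k, 𝓘 k → 𝓐} (ha : ∀ k, Measurable (a k)) (hA : ∀ k ω, A k ω = a k (I k ω))
    (hrm : Measurable (Function.uncurry r)) (hr : ∀ s a, |r s a| ≤ C)
    (hb0 : 0 ≤ b) (hb1 : b < 1) {ε : ℝ} (hε : 0 < ε) :
    ∃ g : MarkovPolicy 𝓢 𝓐, expectedCost κ r b (P.map (Z 0)) g.toHistory ≤
      ∑' k, b ^ k * ∫ ω, r (Z k ω) (A k ω) ∂P + ε := by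
  choose α hα hlaw using fun k => exists_seed (P := P) (h.measurable_state k) (hI k) (ha k)
  have hA' (k : ℕ) : A k = fun ω => a k (I k ω) := funext (hA k)
  have hprob : IsProbabilityMeasure (P.map (Z 0)) :=
    Measure.isProbabilityMeasure_map (h.measurable_state 0).aemeasurable
  -- The costs after time `n` are smaller than `ε / 2` for both processes.
  obtain ⟨n, hn⟩ : ∃ n, b ^ n * (C / (1 - b)) < ε / 2 := by
    have h0 := (tendsto_pow_atTop_nhds_zero_of_lt_one hb0 hb1).mul_const (C / (1 - b))
    rw [zero_mul] at h0
    exact (h0.eventually (gt_mem_nhds (half_pos hε))).exists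
  obtain ⟨g, hg, hle⟩ := exists_markov_le_seedCost (κ := κ) hrm hr hb0 hb1.le hα n 0 (P.map (Z 0))
  rw [integral_seedCost hrm hr hb0 hb1.le hα h.measurable_state h.measurable_action
    (fun k => by rw [← hlaw k, hA' k]) h.map_succ] at hle
  simp only [zero_add] at hle
  refine ⟨⟨g, hg⟩, ?_⟩
  rw [expectedCost_toHistory κ hrm]
  have h1 := abs_tsum_sub_sum_le (C := C) hb0 hb1
    (e := fun k => ∫ s, r s (g k s) ∂stateLaw κ (P.map (Z 0)) g k) (fun k => by
      have := isProbabilityMeasure_stateLaw κ (P.map (Z 0)) hg k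
      exact abs_integral_le_of_abs_le fun s => hr _ _) n
  have h2 := abs_tsum_sub_sum_le (C := C) hb0 hb1 (e := fun k => ∫ ω, r (Z k ω) (A k ω) ∂P)
    (fun k => abs_integral_le_of_abs_le fun ω => hr _ _) n
  have h3 := (abs_le.1 h1).2
  have h4 := (abs_le.1 h2).1
  linarith

end Selection

section Model

variable {N : ℕ} {X : Type*} {Y U : Fin N → Type*} {V : Type*} {W : Fin N → Type*} {Ω : Type*}
  [MeasurableSpace X] [∀ i, MeasurableSpace (Y i)] [∀ i, MeasurableSpace (U i)]
  [MeasurableSpace V] [∀ i, MeasurableSpace (W i)] [MeasurableSpace Ω]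

/-! ### Equality of the optimal costs -/

theorem TeamModel.discount_lt_one (S : TeamModel N X Y U V W Ω) (K : ℕ) [NeZero K] :
    S.β ^ K < 1 :=
  pow_lt_one₀ S.β_pos.le S.β_lt_one (NeZero.ne K)

variable [∀ i, StandardBorelSpace (Y i)]
  [∀ i, MeasurableSingletonClass (U i)] [∀ i, Finite (U i)] [∀ i, Nonempty (U i)]

theorem TeamModel.expectedCost_filter (S : TeamModel N X Y U V W Ω) (K M : ℕ) [NeZero M]
    (ν : Measure (WindowState S K M))
    (g : MarkovPolicy (ProbabilityMeasure X) (ActionMap U S.ψ K)) (b : ℝ) :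
    expectedCost (S.windowKernel K M) S.windowCost b ν
        (g.comp S.filter (S.measurable_filter K M)).toHistory =
      expectedCost (S.beliefKernel K) S.periodCost b (ν.map S.filter) g.toHistory :=
  expectedCost_comp (r := S.periodCost) (S.measurable_filter K M) (S.map_filter_windowKernel K M)
    (S.measurable_periodCost K) b ν g

variable [StandardBorelSpace X] [Nonempty X]

instance ActionMap.instNonempty {ψ : ∀ i, ProbabilityMeasure (Y i)} {K : ℕ} :
    Nonempty (ActionMap U ψ K) :=
  ⟨fun _ _ => ⟨fun _ => Classical.arbitrary _, measurable_const⟩⟩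

instance HistoryPolicy.instNonempty {𝓢 𝓐 : Type*} [MeasurableSpace 𝓢] [MeasurableSpace 𝓐]
    [Nonempty 𝓐] : Nonempty (HistoryPolicy 𝓢 𝓐) :=
  ⟨⟨fun _ _ => Classical.arbitrary 𝓐, fun _ => measurable_const⟩⟩

instance MarkovPolicy.instNonempty {𝓢 𝓐 : Type*} [MeasurableSpace 𝓢] [MeasurableSpace 𝓐]
    [Nonempty 𝓐] : Nonempty (MarkovPolicy 𝓢 𝓐) :=
  ⟨⟨fun _ _ => Classical.arbitrary 𝓐, fun _ => measurable_const⟩⟩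

theorem TeamModel.map_filter_window (S : TeamModel N X Y U V W Ω) {K : ℕ} (M : ℕ)
    (γ : TeamPolicy S K) :
    (S.P.map (S.window M γ 0)).map S.filter = S.P.map (S.predictor γ M) := by
  rw [Measure.map_map (S.measurable_filter K M) (S.measurable_window M γ 0)]
  exact Measure.map_congr (S.ae_filter_window M γ 0)

theorem TeamModel.costFrom_eq_mul (S : TeamModel N X Y U V W Ω) {K : ℕ} [NeZero K] (M : ℕ)
    (γ : TeamPolicy S K) : S.costFrom (M * K) γ = (S.β ^ K) ^ M * ∑' k : ℕ, (S.β ^ K) ^ k *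
      ∫ ω, S.periodCost (S.predictor γ (M + k) ω) (S.action γ (M + k) ω) ∂S.P := by
  rw [S.costFrom_eq_predictor, ← tsum_mul_left]
  exact tsum_congr fun k => by rw [pow_add, mul_assoc]

theorem TeamModel.bddBelow_costFrom (S : TeamModel N X Y U V W Ω) (K M : ℕ) [NeZero K]
    (p : TeamPolicy S K → Prop) :
    BddBelow (Set.range fun γ : {γ : TeamPolicy S K // p γ} => S.costFrom (M * K) γ.1) := by
  obtain ⟨C, hC⟩ := S.abs_periodCost_le K
  have hb0 : 0 ≤ S.β ^ K := pow_nonneg S.β_pos.le K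
  refine ⟨-((S.β ^ K) ^ M * (C / (1 - S.β ^ K))), ?_⟩
  rintro _ ⟨γ, rfl⟩
  change _ ≤ S.costFrom (M * K) γ.1
  rw [S.costFrom_eq_mul, ← mul_neg]
  refine mul_le_mul_of_nonneg_left ?_ (pow_nonneg hb0 M)
  exact (abs_le.1 (abs_tsum_discounted_le hb0 (S.discount_lt_one K) fun k =>
    abs_integral_le_of_abs_le fun ω => hC _ _)).1

theorem bddBelow_expectedCost {𝓢 𝓐 ι : Type*} [MeasurableSpace 𝓢] [MeasurableSpace 𝓐]
    (κ : Kernel (𝓢 × 𝓐) 𝓢) [IsMarkovKernel κ] {r : 𝓢 → 𝓐 → ℝ} {b C : ℝ} (hb0 : 0 ≤ b) (hb1 : b < 1)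
    (hr : ∀ s a, |r s a| ≤ C) (ν : Measure 𝓢) [IsProbabilityMeasure ν]
    (g : ι → HistoryPolicy 𝓢 𝓐) : BddBelow (Set.range fun i => expectedCost κ r b ν (g i)) := by
  refine ⟨-(C / (1 - b)), ?_⟩
  rintro _ ⟨i, rfl⟩
  exact (abs_le.1 (abs_expectedCost_le κ hb0 hb1 hr ν (g i))).1

/-- Up to `ε`, Markov policies of the centralized reduction do at least as well as any team
policy. -/
theorem TeamModel.exists_markovPolicy_le_costFrom (S : TeamModel N X Y U V W Ω) {K : ℕ} [NeZero K]
    (M : ℕ) (γ : TeamPolicy S K) {ε : ℝ} (hε : 0 < ε) :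
    ∃ g : MarkovPolicy (ProbabilityMeasure X) (ActionMap U S.ψ K), (S.β ^ K) ^ M *
      expectedCost (S.beliefKernel K) S.periodCost (S.β ^ K) (S.P.map (S.predictor γ M))
        g.toHistory ≤ S.costFrom (M * K) γ + (S.β ^ K) ^ M * ε := by
  obtain ⟨C, hC⟩ := S.abs_periodCost_le K
  have hb0 : 0 ≤ S.β ^ K := pow_nonneg S.β_pos.le K
  have hΩ : Nonempty Ω := nonempty_of_isProbabilityMeasure S.P
  have hne (k : ℕ) : Nonempty (CommonInfo Y U K (M + k)) := hΩ.map (S.info γ (M + k))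
  obtain ⟨g, hg⟩ := (S.isControlledMarkov_predictor M γ).exists_markovPolicy_le
    (r := S.periodCost) (𝓘 := fun k => CommonInfo Y U K (M + k))
    (fun k => S.measurable_info γ (M + k))
    (fun k => γ.measurable_map_action (M + k)) (fun k ω => rfl) (S.measurable_periodCost K) hC hb0
    (S.discount_lt_one K) hε
  refine ⟨g, ?_⟩
  rw [S.costFrom_eq_mul, ← mul_add]
  exact mul_le_mul_of_nonneg_left hg (pow_nonneg hb0 M)

/-- The optimal costs over team policies, over history-dependent and Markov policies of the window
process, and over Markov policies of the centralized reduction agree. -/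
theorem TeamModel.iInf_costFrom (S : TeamModel N X Y U V W Ω) (K M : ℕ) [NeZero K] [NeZero M]
    (γ₀ : TeamPolicy S K) :
    (⨅ γ : {γ : TeamPolicy S K // ∀ q < M, γ.act q = γ₀.act q}, S.costFrom (M * K) γ.1) =
      (S.β ^ K) ^ M * (⨅ g : HistoryPolicy (WindowState S K M) (ActionMap U S.ψ K),
        expectedCost (S.windowKernel K M) S.windowCost (S.β ^ K) (S.P.map (S.window M γ₀ 0)) g) ∧
    (⨅ γ : {γ : TeamPolicy S K // ∀ q < M, γ.act q = γ₀.act q}, S.costFrom (M * K) γ.1) =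
      (S.β ^ K) ^ M * (⨅ g : MarkovPolicy (WindowState S K M) (ActionMap U S.ψ K),
        expectedCost (S.windowKernel K M) S.windowCost (S.β ^ K) (S.P.map (S.window M γ₀ 0))
          g.toHistory) ∧
    (⨅ γ : {γ : TeamPolicy S K // ∀ q < M, γ.act q = γ₀.act q}, S.costFrom (M * K) γ.1) =
      (S.β ^ K) ^ M * (⨅ g : MarkovPolicy (ProbabilityMeasure X) (ActionMap U S.ψ K),
        expectedCost (S.beliefKernel K) S.periodCost (S.β ^ K) (S.P.map (S.predictor γ₀ M))
          g.toHistory) := by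
  obtain ⟨C, hC⟩ := S.abs_periodCost_le K
  have hb0 : 0 ≤ S.β ^ K := pow_nonneg S.β_pos.le K
  have hb1 := S.discount_lt_one K
  have hc : 0 ≤ (S.β ^ K) ^ M := pow_nonneg hb0 M
  have hνw : IsProbabilityMeasure (S.P.map (S.window M γ₀ 0)) :=
    Measure.isProbabilityMeasure_map (S.measurable_window M γ₀ 0).aemeasurable
  have hν : IsProbabilityMeasure (S.P.map (S.predictor γ₀ M)) :=
    Measure.isProbabilityMeasure_map (S.measurable_predictor γ₀ M).aemeasurable
  have hCw (z : WindowState S K M) (a : ActionMap U S.ψ K) : |S.windowCost z a| ≤ C := hC _ _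
  set J := ⨅ γ : {γ : TeamPolicy S K // ∀ q < M, γ.act q = γ₀.act q}, S.costFrom (M * K) γ.1
  set JH := ⨅ g : HistoryPolicy (WindowState S K M) (ActionMap U S.ψ K),
    expectedCost (S.windowKernel K M) S.windowCost (S.β ^ K) (S.P.map (S.window M γ₀ 0)) g
    with hJH
  set JM := ⨅ g : MarkovPolicy (WindowState S K M) (ActionMap U S.ψ K),
    expectedCost (S.windowKernel K M) S.windowCost (S.β ^ K) (S.P.map (S.window M γ₀ 0))
      g.toHistory
  set JB := ⨅ g : MarkovPolicy (ProbabilityMeasure X) (ActionMap U S.ψ K),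
    expectedCost (S.beliefKernel K) S.periodCost (S.β ^ K) (S.P.map (S.predictor γ₀ M)) g.toHistory
  have h1 : J ≤ (S.β ^ K) ^ M * JH := by
    rw [hJH, Real.mul_iInf_of_nonneg hc]
    refine le_ciInf fun g => ?_
    have hcost := S.costFrom_eq_expectedCost _ g (S.youngLaw_implement γ₀ g)
    rw [S.window_implement_zero] at hcost
    rw [← hcost]
    exact ciInf_le (S.bddBelow_costFrom K M fun γ => ∀ q < M, γ.act q = γ₀.act q)
      ⟨S.implement γ₀ g, fun q hq => S.implement_act_of_lt γ₀ g (k := 0) hq⟩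
  have h2 : JH ≤ JM := le_ciInf fun g => ciInf_le
    (bddBelow_expectedCost _ hb0 hb1 hCw _ fun g => g) g.toHistory
  have h3 : JM ≤ JB := by
    refine le_ciInf fun g => ?_
    rw [← S.map_filter_window, ← S.expectedCost_filter]
    exact ciInf_le (bddBelow_expectedCost _ hb0 hb1 hCw _ MarkovPolicy.toHistory)
      (g.comp S.filter (S.measurable_filter K M))
  have h4 : (S.β ^ K) ^ M * JB ≤ J := by
    have : Nonempty {γ : TeamPolicy S K // ∀ q < M, γ.act q = γ₀.act q} := ⟨γ₀, fun _ _ => rfl⟩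
    refine le_ciInf fun γ => le_of_forall_pos_le_add fun ε hε => ?_
    obtain ⟨g, hg⟩ := S.exists_markovPolicy_le_costFrom M γ.1 hε
    rw [funext fun ω => S.predictor_congr γ.2 ω] at hg
    refine (mul_le_mul_of_nonneg_left (ciInf_le
      (bddBelow_expectedCost _ hb0 hb1 hC _ MarkovPolicy.toHistory) g) hc).trans (hg.trans ?_)
    exact add_le_add_right (mul_le_of_le_one_left hε.le (pow_le_one₀ hb0 hb1.le)) _
  have h2' := mul_le_mul_of_nonneg_left h2 hc
  have h3' := mul_le_mul_of_nonneg_left h3 hc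
  exact ⟨le_antisymm h1 (by linarith), le_antisymm (by linarith) (by linarith),
    le_antisymm (by linarith) h4⟩

end Model

end PeriodicSharing

open PeriodicSharing in
theorem mainTheorem4 {N : ℕ} {X : Type*} {Y U : Fin N → Type*} {V : Type*} {W : Fin N → Type*}
    {Ω : Type*} [MeasurableSpace X] [StandardBorelSpace X] [Nonempty X]
    [∀ i, MeasurableSpace (Y i)] [∀ i, StandardBorelSpace (Y i)]
    [∀ i, MeasurableSpace (U i)] [∀ i, MeasurableSingletonClass (U i)] [∀ i, Finite (U i)]
    [∀ i, Nonempty (U i)]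
    [MeasurableSpace V] [∀ i, MeasurableSpace (W i)] [MeasurableSpace Ω]
    (S : TeamModel N X Y U V W Ω) (K M : ℕ) [NeZero K] [NeZero M] :
    -- `eval` is a jointly measurable version of every local map
    (∀ (i : Fin N) (r : ℕ),
      (Measurable fun p : LocalMap U S.ψ i r × PrivInfo Y U i r => p.1.eval p.2) ∧
      ∀ (f : LocalMap U S.ψ i r) (up : Fin r → U i),
        ∀ᵐ y ∂(Measure.pi fun _ : Fin (r + 1) => (S.ψ i : Measure (Y i))),
          f.eval (y, up) = f.toFun (y, up)) ∧
    -- the data of the two Markov decision processes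
    ∃ (θ : Kernel (ProbabilityMeasure X × ActionMap U S.ψ K) (ProbabilityMeasure X))
      (θw : Kernel (WindowState S K M × ActionMap U S.ψ K) (WindowState S K M))
      (hfilter : Measurable (S.filter : WindowState S K M → ProbabilityMeasure X)),
      IsMarkovKernel θ ∧ IsMarkovKernel θw ∧
      (∀ π a, θ (π, a) = S.beliefTransition π a) ∧
      (∀ z a, θw (z, a) = S.windowTransition z a) ∧
      (Measurable fun p : ProbabilityMeasure X × ActionMap U S.ψ K => S.periodCost p.1 p.2) ∧
      (Measurable fun p : WindowState S K M × ActionMap U S.ψ K => S.windowCost p.1 p.2) ∧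
      (∃ C, ∀ (π : ProbabilityMeasure X) (a : ActionMap U S.ψ K), |S.periodCost π a| ≤ C) ∧
      -- the filter maps the window process to the predictor process
      (∀ z a, (θw (z, a)).map S.filter = θ (S.filter z, a)) ∧
      -- behaviour of the two processes under an arbitrary admissible team policy
      (∀ γ : TeamPolicy S K,
        (∀ k, ∀ᵐ ω ∂S.P, S.filter (S.window M γ k ω) = S.predictor γ (M + k) ω) ∧
        IsControlledMarkov S.P (S.window M γ) (fun k => S.action γ (M + k)) θw ∧
        IsControlledMarkov S.P (fun k => S.predictor γ (M + k)) (fun k => S.action γ (M + k)) θ ∧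
        (∀ k, S.P[fun ω => ∑ r : Fin K, S.β ^ (r : ℕ) *
              S.c (S.stateAt γ ((M + k) * K + r) ω) (S.controlAt γ ((M + k) * K + r) ω) |
            pastSigma (S.window M γ) (fun k => S.action γ (M + k)) k]
          =ᵐ[S.P] fun ω => S.windowCost (S.window M γ k ω) (S.action γ (M + k) ω)) ∧
        S.costFrom (M * K) γ = ∑' k : ℕ, (S.β ^ K) ^ (M + k) *
          ∫ ω, S.windowCost (S.window M γ k ω) (S.action γ (M + k) ω) ∂S.P ∧
        S.costFrom (M * K) γ = ∑' k : ℕ, (S.β ^ K) ^ (M + k) *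
          ∫ ω, S.periodCost (S.predictor γ (M + k) ω) (S.action γ (M + k) ω) ∂S.P) ∧
      -- every policy of the window process is implemented by an admissible team policy
      (∀ (γ₀ : TeamPolicy S K) (g : HistoryPolicy (WindowState S K M) (ActionMap U S.ψ K)),
        ∃ γ : TeamPolicy S K, (∀ q < M, γ.act q = γ₀.act q) ∧
          (∀ k, ∀ᵐ ω ∂S.P, ∀ (i : Fin N) (r : Fin K),
            (S.action γ (M + k) ω i r).youngLaw =
              (g.act k (fun j : Fin (k + 1) => S.window M γ j ω) i r).youngLaw) ∧
          (∀ k, S.P.map (fun ω (j : Fin (k + 1)) => S.window M γ j ω) =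
            histLaw θw (S.P.map (S.window M γ₀ 0)) g k) ∧
          S.costFrom (M * K) γ = (S.β ^ K) ^ M *
            expectedCost θw S.windowCost (S.β ^ K) (S.P.map (S.window M γ₀ 0)) g) ∧
      -- a policy of the predictor process induces one of the window process with the same cost
      (∀ (ν : Measure (WindowState S K M)) [IsProbabilityMeasure ν]
          (g : MarkovPolicy (ProbabilityMeasure X) (ActionMap U S.ψ K)),
        expectedCost θw S.windowCost (S.β ^ K) ν (g.comp S.filter hfilter).toHistory =
          expectedCost θ S.periodCost (S.β ^ K) (ν.map S.filter) g.toHistory) ∧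
      -- equality of the optimal costs after any initial segment of `M` periods
      (∀ γ₀ : TeamPolicy S K,
        (⨅ γ : {γ : TeamPolicy S K // ∀ q < M, γ.act q = γ₀.act q}, S.costFrom (M * K) γ.1) =
          (S.β ^ K) ^ M * (⨅ g : HistoryPolicy (WindowState S K M) (ActionMap U S.ψ K),
            expectedCost θw S.windowCost (S.β ^ K) (S.P.map (S.window M γ₀ 0)) g) ∧
        (⨅ γ : {γ : TeamPolicy S K // ∀ q < M, γ.act q = γ₀.act q}, S.costFrom (M * K) γ.1) =
          (S.β ^ K) ^ M * (⨅ g : MarkovPolicy (WindowState S K M) (ActionMap U S.ψ K),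
            expectedCost θw S.windowCost (S.β ^ K) (S.P.map (S.window M γ₀ 0)) g.toHistory) ∧
        (⨅ γ : {γ : TeamPolicy S K // ∀ q < M, γ.act q = γ₀.act q}, S.costFrom (M * K) γ.1) =
          (S.β ^ K) ^ M * (⨅ g : MarkovPolicy (ProbabilityMeasure X) (ActionMap U S.ψ K),
            expectedCost θ S.periodCost (S.β ^ K) (S.P.map (S.predictor γ₀ M)) g.toHistory)) := by
  refine ⟨fun i r => ⟨LocalMap.measurable_eval, LocalMap.eval_ae_eq⟩, S.beliefKernel K,
    S.windowKernel K M, S.measurable_filter K M, inferInstance, inferInstance, fun _ _ => rfl,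
    fun _ _ => rfl, S.measurable_periodCost K, S.measurable_windowCost K M, S.abs_periodCost_le K,
    S.map_filter_windowKernel K M, fun γ => ⟨S.ae_filter_window M γ, S.isControlledMarkov_window γ,
      S.isControlledMarkov_predictor M γ, S.condExp_cost M γ, S.costFrom_eq_window M γ,
      S.costFrom_eq_predictor M γ⟩, fun γ₀ g => ⟨S.implement γ₀ g,
      fun q hq => S.implement_act_of_lt γ₀ g (k := 0) hq,
      fun k => Filter.Eventually.of_forall fun ω i r => S.youngLaw_implement γ₀ g k ω i r, ?_, ?_⟩,
    fun ν _ g => S.expectedCost_filter K M ν g _, S.iInf_costFrom K M⟩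
  · rw [← S.window_implement_zero γ₀ g]
    exact S.map_windows_eq_histLaw _ g (S.youngLaw_implement γ₀ g)
  · rw [← S.window_implement_zero γ₀ g]
    exact S.costFrom_eq_expectedCost _ g (S.youngLaw_implement γ₀ g)
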